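/- Let $G$ be a group. A family of subgroups of $G$ is a non-empty set of subgroups of $G$ closed under conjugation; it is full if it is also closed under taking subgroups. For a family $\mathfrak F$ of subgroups of $G$, let $\mathcal O_{\mathfrak F}G$ be the orbit category, with objects the homogeneous $G$-sets $G/H$, $H\in\mathfrak F$, and morphisms the $G$-maps. A right Bredon module is a contravariant functor from $\mathcal O_{\mathfrak F}G$ to abelian groups. The Bredon cohomological dimension $\operatorname{cd}_{\mathfrak F}G\in\mathbb N\cup\{\infty\}$ is the least $n$ such that the constant right Bredon module $\underline{\mathbb Z}$ has a projective resolution $0\to P_n\to\cdots\to P_0\to\underline{\mathbb Z}\to 0$ in the category of right Bredon modules, and $\infty$ if there is no such $n$. For a subgroup $K\le G$ put $\mathfrak F\cap K=\{H\cap K: H\in\mathfrak F\}$, and let $\overline{\mathfrak F}=\{H\le G: H\le K\text{ for some }K\in\mathfrak F\}$ be the completion of $\mathfrak F$. A group is virtually cyclic if it has a cyclic subgroup of finite index; write $\underline{\underline{\operatorname{cd}}}\,G$ for $\operatorname{cd}_{\mathfrak F}G$ with $\mathfrak F$ the family of virtually cyclic subgroups of $G$. Theorem. Let $G_1,G_2$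 be groups. (1) Let $\mathfrak F_1,\mathfrak F_2$ be full families of subgroups of $G_1,G_2$ respectively, let $\mathfrak F_1\times\mathfrak F_2=\{H_1\times H_2: H_1\in\mathfrak F_1,\ H_2\in\mathfrak F_2\}$, and let $\mathfrak G\subseteq\overline{\mathfrak F_1\times\mathfrak F_2}$ be a full family of subgroups of $G_1\times G_2$. If $k\in\mathbb N$ (where $0\in\mathbb N$) satisfies $\operatorname{cd}_{\mathfrak G\cap K}K\le k$ for every $K\in\mathfrak F_1\times\mathfrak F_2$, then $$\operatorname{cd}_{\mathfrak G}(G_1\times G_2)\le\operatorname{cd}_{\mathfrak F_1}G_1+\operatorname{cd}_{\mathfrak F_2}G_2+k.$$ (2) $\underline{\underline{\operatorname{cd}}}(G_1\times G_2)\le\underline{\underline{\operatorname{cd}}}\,G_1+\underline{\underline{\operatorname{cd}}}\,G_2+3.$ (3) The bound in (2) is sharp: $\underline{\underline{\operatorname{cd}}}\,\mathbb Z=0$ and $\underline{\underline{\operatorname{cd}}}\,\mathbb Z^2=3$, so that equality holds in (2) for $G_1=G_2=\mathbb Z$. -/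

import Mathlib

open CategoryTheory

universe u

namespace Bredon

section Families

variable {G : Type u} [Group G]

/-- A *family* of subgroups of `G`: a non-empty set of subgroups closed under conjugation. -/
structure IsFamily (F : Set (Subgroup G)) : Prop where
  nonempty : F.Nonempty
  conj_mem : ∀ H ∈ F, ∀ g : G, H.map (MulAut.conj g).toMonoidHom ∈ F

/-- A *full* family of subgroups of `G`: a family closed under passing to subgroups. -/
structure IsFullFamily (F : Set (Subgroup G)) : Prop extends IsFamily F where
  mem_of_le : ∀ H ∈ F, ∀ K : Subgroup G, K ≤ H → K ∈ F

/-- The set `F ∩ K = {H ∩ K : H ∈ F}` of subgroups of the group `K`. -/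
def restrictFamily (F : Set (Subgroup G)) (K : Subgroup G) : Set (Subgroup K) :=
  {L | ∃ H ∈ F, L = H.subgroupOf K}

/-- The completion of `F`: all subgroups of members of `F`. -/
def completion (F : Set (Subgroup G)) : Set (Subgroup G) :=
  {H | ∃ K ∈ F, H ≤ K}

end Families

/-- The cartesian product `F₁ × F₂ = {H₁ × H₂ : H₁ ∈ F₁, H₂ ∈ F₂}`. -/
def prodFamily {G₁ G₂ : Type u} [Group G₁] [Group G₂]
    (F₁ : Set (Subgroup G₁)) (F₂ : Set (Subgroup G₂)) : Set (Subgroup (G₁ × G₂)) :=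
  {H | ∃ H₁ ∈ F₁, ∃ H₂ ∈ F₂, H = H₁.prod H₂}

/-- A group is *virtually cyclic* if it has a cyclic subgroup of finite index. -/
def IsVirtuallyCyclic (G : Type u) [Group G] : Prop :=
  ∃ C : Subgroup G, IsCyclic C ∧ C.FiniteIndex

/-- The family of virtually cyclic subgroups of `G`. -/
def vcFamily (G : Type u) [Group G] : Set (Subgroup G) :=
  {H | IsVirtuallyCyclic H}

/-- Objects of the orbit category of `G` with respect to `F`: the homogeneous `G`-sets `G ⧸ H`
with `H ∈ F`, recorded by the subgroup `H`. -/
structure OrbitCategory {G : Type u} [Group G] (F : Set (Subgroup G)) : Type u where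
  /-- the stabiliser `H` of the orbit `G ⧸ H` -/
  subgroup : Subgroup G
  mem : subgroup ∈ F

/-- Morphisms of the orbit category are the `G`-equivariant maps `G ⧸ H → G ⧸ K`. -/
instance {G : Type u} [Group G] (F : Set (Subgroup G)) : SmallCategory (OrbitCategory F) where
  Hom X Y := (G ⧸ X.subgroup) →[G] (G ⧸ Y.subgroup)
  id X := MulActionHom.id G
  comp f g := MulActionHom.comp g f

section Modules

variable {G : Type u} [Group G] (F : Set (Subgroup G))

/-- Right Bredon modules: contravariant functors from the orbit category to abelian groups
(that is, `ℤ`-modules), with natural transformations as morphisms. -/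
abbrev RightModule : Type (u + 1) := (OrbitCategory F)ᵒᵖ ⥤ ModuleCat.{u} ℤ

/-- The trivial right Bredon module: constant with value `ℤ`, all morphisms act by the identity. -/
noncomputable abbrev trivialModule : RightModule F :=
  (Functor.const (OrbitCategory F)ᵒᵖ).obj (ModuleCat.of ℤ (ULift.{u} ℤ))

/-- The trivial module has a projective resolution `0 → Pₙ → ⋯ → P₀ → ℤ → 0`. -/
def HasProjectiveResolutionOfLength (n : ℕ) : Prop :=
  ∃ P : ProjectiveResolution (trivialModule F), ∀ i : ℕ, n < i → Limits.IsZero (P.complex.X i)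

/-- The Bredon cohomological dimension `cd_F G`: the least length of a projective resolution of
the trivial module, and `⊤` if there is no projective resolution of finite length. -/
noncomputable def cd : ℕ∞ :=
  ⨅ (n : ℕ) (_ : HasProjectiveResolutionOfLength F n), (n : ℕ∞)

end Modules

end Bredon

/-! By `cd_le_iff`, the Bredon dimension is the projective dimension of the constant module ℤ over
the opposite of the orbit category. The free module ℤ[S] on a set-valued functor S is the
pushforward, along an exact functor that preserves projectives, of the constant module on the
category of elements of S. When S is the fixed point presheaf of G/K, that category is the opposite
orbit category of K for F ∩ K. So ℤ[?, G/K] has projective dimension at most cd of K for F ∩ K, even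
if K is not in F.

Part (1). Let f : G → Q carry 𝔊 into F. Restriction along L ↦ f(L) is exact and keeps ℤ constant. It
turns the free module ℤ[?, Q/K] into that of Q/K viewed as a G-set, whose stabilisers are preimages
of conjugates of K. If these preimages have dimension at most k, then cd 𝔊 ≤ cd F + k
(`cd_le_of_hom`). This is applied to G₁ × G₂ → G₁ and then to K₁ × G₂ → G₂ (`cd_prod_le`).

Part (2). By (1) it suffices that a product of two virtually cyclic groups has dimension at most 3.
Each factor acts on a line with finite kernel, so the product acts on a plane with finite cell
stabilisers. An infinite virtually cyclic subgroup lifts exactly one rational direction to a fixed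
vertex of the quotient of the plane by that direction. Form a star whose centre is the plane, with
one leaf for each direction and an edge to each leaf. Evaluated at a finite subgroup it is a star on
the fixed directions; at an infinite one it is a single leaf. This gives 0 → ℤ[edges] → ℤ[centre] ⊕
ℤ[leaves] → ℤ → 0 with terms of projective dimension at most 2, 2 and 1, so ℤ has projective
dimension at most 3 (`cd_vcFamily_le_three`).

Part (3). For ℤ² every direction is invariant, so the centre meets at least two edges that split
off. If the dimension were at most 2, then Ext²(ℤ[centre], N) would vanish (`ext_centre_eq_zero`).
For N = ℤ this says that every invariant 2-cochain on the plane is a coboundary. The indicator of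
one face of the torus is not, by pairing with the fundamental class (`not_cd_le_two`). -/

namespace Bredon
open Limits ZeroObject

/-! ### Projective resolutions and projective dimension. -/

section Homological

universe v w

theorem projective_sigma {A : Type*} [Category* A] {I : Type*} (M : I → A) [HasCoproduct M]
    (h : ∀ i, Projective (M i)) :
    Projective (∐ M) where
  factors f e _ := ⟨Sigma.desc fun i => Projective.factorThru (Sigma.ι M i ≫ f) e, by
    ext i; simp⟩

variable {A : Type w} [Category.{v} A] [Abelian A]

/-- `ε` is kept as a separate variable so that its target is `M` itself rather than the degree-zero
term of a single complex. -/
theorem exact_resolution_zero {M : A} (Q : ProjectiveResolution M) (ε : Q.complex.X 0 ⟶ M)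
    (hε : ε = Q.π.f 0) (w : Q.complex.d 1 0 ≫ ε = 0) :
    (ShortComplex.mk _ _ w).Exact := by
  subst hε
  exact ShortComplex.exact_of_g_is_cokernel _ Q.isColimitCokernelCofork

/-- Splicing a projective resolution of `K` with a short exact sequence `0 ⟶ K ⟶ P ⟶ M ⟶ 0`. -/
theorem exists_resolution_of_shortExact {S : ShortComplex A} (hS : S.ShortExact)
    [Projective S.X₂] (Q : ProjectiveResolution S.X₁) :
    ∃ P : ProjectiveResolution S.X₃, ∀ i, P.complex.X (i + 1) = Q.complex.X i := by
  have hm : Mono S.f := hS.mono_f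
  have he : Epi S.g := hS.epi_g
  obtain ⟨ε, hε⟩ : ∃ ε : Q.complex.X 0 ⟶ S.X₁, ε = Q.π.f 0 := ⟨_, rfl⟩
  have hε0 : Q.complex.d 1 0 ≫ ε = 0 := by rw [hε]; exact Q.complex_d_comp_π_f_zero
  have hεe : Epi ε := by rw [hε]; exact inferInstanceAs (Epi (Q.π.f 0))
  have w : Q.complex.d 1 0 ≫ (ε ≫ S.f) = 0 := by rw [← Category.assoc, hε0, zero_comp]
  let K := Q.complex.augment (X := S.X₂) (ε ≫ S.f) w
  have hK' : (ε ≫ S.f) ≫ S.g = 0 := by rw [Category.assoc, S.zero, comp_zero]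
  have hK : K.d 1 0 ≫ S.g = 0 := hK'
  have ex0 : (ShortComplex.mk (ε ≫ S.f) S.g hK').Exact := by
    -- Precomposing with the epimorphism `ε` does not change the image of `S.f`; below, composing
    -- `ε` with the monomorphism `S.f` does not change its kernel.
    let α : ShortComplex.mk (ε ≫ S.f) S.g hK' ⟶ S :=
      { τ₁ := ε
        τ₂ := 𝟙 _
        τ₃ := 𝟙 _ }
    exact (ShortComplex.exact_iff_of_epi_of_isIso_of_mono α).2 hS.exact
  have ex1 : (ShortComplex.mk (Q.complex.d 1 0) (ε ≫ S.f) w).Exact := by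
    let α : ShortComplex.mk (Q.complex.d 1 0) ε hε0 ⟶
        ShortComplex.mk (Q.complex.d 1 0) (ε ≫ S.f) w :=
      { τ₁ := 𝟙 _
        τ₂ := 𝟙 _
        τ₃ := S.f }
    exact (ShortComplex.exact_iff_of_epi_of_isIso_of_mono α).1 (exact_resolution_zero Q ε hε hε0)
  refine ⟨{ complex := K, projective := ?_,
            π := (ChainComplex.toSingle₀Equiv _ _).symm ⟨S.g, hK⟩, quasiIso := ⟨fun n => ?_⟩ },
    fun i => rfl⟩
  · intro n
    cases n with
    | zero => change Projective S.X₂; infer_instance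
    | succ n => exact Q.projective n
  · cases n with
    | zero =>
      rw [ChainComplex.quasiIsoAt₀_iff, ShortComplex.quasiIso_iff_of_zeros']
      · have hπ := ChainComplex.toSingle₀Equiv_symm_apply_f_zero (C := K) S.g hK
        refine (ShortComplex.exact_and_epi_g_iff_of_iso
          (S₂ := ShortComplex.mk (ε ≫ S.f) S.g hK') ?_).2 ⟨ex0, he⟩
        exact ShortComplex.isoMk (Iso.refl _) (Iso.refl _) (Iso.refl _)
          ((Category.id_comp _).trans (Category.comp_id _).symm)
          ((Category.id_comp S.g).trans (hπ.symm.trans (Category.comp_id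
            (((ChainComplex.toSingle₀Equiv K S.X₃).symm ⟨S.g, hK⟩).f 0)).symm))
      all_goals rfl
    | succ n =>
      rw [quasiIsoAt_iff_exactAt']
      · rw [HomologicalComplex.exactAt_iff' _ (n + 1 + 1) (n + 1) n (by simp) (by simp)]
        cases n with
        | zero => exact ex1
        | succ n => exact Q.exact_succ n
      · apply ChainComplex.exactAt_succ_single_obj

/-- A class in Ext of degree i is represented by a cocycle on the i-th term of the resolution, which
is zero for i > n. Dimension at most n is written `HasProjectiveDimensionLT` with n + 1 throughout.
-/
theorem hasProjectiveDimensionLT_of_resolution {M : A} (P : ProjectiveResolution M) (n : ℕ)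
    (h : ∀ i, n < i → IsZero (P.complex.X i)) : HasProjectiveDimensionLT M (n + 1) := by
  let := HasExt.standard A
  rw [hasProjectiveDimensionLT_iff]
  intro i hi Y e
  obtain ⟨f, hf, rfl⟩ := P.extMk_surjective e (i + 1) rfl
  obtain rfl : f = 0 := (h i (by lia)).eq_of_src _ _
  exact P.extMk_zero _ _

/-- Dimension shifting: the kernel of a projective cover has smaller dimension, and its resolution
is spliced with the cover. -/
theorem exists_resolution_of_hasProjectiveDimensionLT [EnoughProjectives A] (n : ℕ) :
    ∀ (M : A), HasProjectiveDimensionLT M (n + 1) →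
      ∃ P : ProjectiveResolution M, ∀ i, n < i → IsZero (P.complex.X i) := by
  induction n with
  | zero =>
    intro M hM
    have : Projective M := projective_iff_hasProjectiveDimensionLT_one.2 hM
    refine ⟨ProjectiveResolution.self M, fun i hi => ?_⟩
    obtain ⟨i, rfl⟩ := Nat.exists_eq_succ_of_ne_zero hi.ne'
    exact HomologicalComplex.isZero_single_obj_X _ _ _ _ (by simp)
  | succ n ih =>
    intro M hM
    have hS : (ShortComplex.mk _ _ (kernel.condition (Projective.π M))).ShortExact :=
      { exact := ShortComplex.exact_kernel _ }
    obtain ⟨Q, hQ⟩ := ih _ (hS.hasProjectiveDimensionLT_X₁ (n + 1)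
      (hasProjectiveDimensionLT_of_ge _ 1 _ (by lia)) hM)
    obtain ⟨P, hP⟩ := exists_resolution_of_shortExact hS Q
    refine ⟨P, fun i hi => ?_⟩
    obtain ⟨i, rfl⟩ := Nat.exists_eq_succ_of_ne_zero (Nat.ne_zero_of_lt hi)
    rw [hP]
    exact hQ i (by lia)

theorem exists_resolution_iff [EnoughProjectives A] (M : A) (n : ℕ) :
    (∃ P : ProjectiveResolution M, ∀ i, n < i → IsZero (P.complex.X i)) ↔
      HasProjectiveDimensionLT M (n + 1) :=
  ⟨fun ⟨P, hP⟩ => hasProjectiveDimensionLT_of_resolution P n hP,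
    exists_resolution_of_hasProjectiveDimensionLT n M⟩

/-- An exact functor that sends projectives to objects of projective dimension at most `k`
raises projective dimensions by at most `k`. -/
theorem hasProjectiveDimensionLT_map {B : Type*} [Category* B] [Abelian B]
    [EnoughProjectives A] (F : A ⥤ B) [F.Additive] [PreservesFiniteLimits F]
    [PreservesFiniteColimits F] (k : ℕ)
    (hF : ∀ P : A, Projective P → HasProjectiveDimensionLT (F.obj P) (k + 1)) (n : ℕ) :
    ∀ M : A, HasProjectiveDimensionLT M (n + 1) →
      HasProjectiveDimensionLT (F.obj M) (n + k + 1) := by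
  induction n with
  | zero =>
    intro M hM
    rw [zero_add]
    exact hF _ (projective_iff_hasProjectiveDimensionLT_one.2 hM)
  | succ n ih =>
    intro M hM
    have hS : (ShortComplex.mk _ _ (kernel.condition (Projective.π M))).ShortExact :=
      { exact := ShortComplex.exact_kernel _ }
    have hK := ih _ (hS.hasProjectiveDimensionLT_X₁ (n + 1)
      (hasProjectiveDimensionLT_of_ge _ 1 _ (by lia)) hM)
    have hP := hF (Projective.over M) inferInstance
    have := (hS.map_of_exact F).hasProjectiveDimensionLT_X₃ (n + k + 1) hK
      (have := hP; hasProjectiveDimensionLT_of_ge (F.obj (Projective.over M)) (k + 1) _ (by lia))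
    rwa [show n + 1 + k + 1 = n + k + 1 + 1 by lia]

theorem shortExact_of_evaluation {J : Type*} [Category* J] (S : ShortComplex (J ⥤ A))
    (h : ∀ j, (S.map ((evaluation J A).obj j)).ShortExact) : S.ShortExact where
  exact := by
    rw [ShortComplex.exact_iff_isZero_homology, Functor.isZero_iff]
    intro j
    exact ((ShortComplex.exact_iff_isZero_homology _).1 (h j).exact).of_iso
      (S.mapHomologyIso ((evaluation J A).obj j)).symm
  mono_f := by
    rw [NatTrans.mono_iff_mono_app]
    exact fun j => (h j).mono_f
  epi_g := by
    rw [NatTrans.epi_iff_epi_app]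
    exact fun j => (h j).epi_g

/-- Projective covers of all the `M i` are taken at once. Exactness of coproducts keeps the sequence
of kernels, covers and `M i` short exact after summation, and the induction runs on the kernels. -/
theorem hasProjectiveDimensionLT_sigma [EnoughProjectives A] {I : Type*}
    [HasColimitsOfShape (Discrete I) A] [HasExactColimitsOfShape (Discrete I) A] (n : ℕ) :
    ∀ M : I → A, (∀ i, HasProjectiveDimensionLT (M i) (n + 1)) →
      HasProjectiveDimensionLT (∐ M) (n + 1) := by
  induction n with
  | zero =>
    intro M hM
    have : ∀ i, Projective (M i) := fun i => projective_iff_hasProjectiveDimensionLT_one.2 (hM i)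
    exact projective_iff_hasProjectiveDimensionLT_one.1 (projective_sigma M this)
  | succ n ih =>
    intro M hM
    let T : ShortComplex (Discrete I ⥤ A) :=
      { X₁ := Discrete.functor fun i => kernel (Projective.π (M i))
        X₂ := Discrete.functor fun i => Projective.over (M i)
        X₃ := Discrete.functor M
        f := Discrete.natTrans fun i => kernel.ι (Projective.π (M i.as))
        g := Discrete.natTrans fun i => Projective.π (M i.as)
        zero := by ext i; simp }
    have hi (i : I) : (ShortComplex.mk _ _ (kernel.condition (Projective.π (M i)))).ShortExact :=
      { exact := ShortComplex.exact_kernel _ }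
    have hT : T.ShortExact := shortExact_of_evaluation T fun i => hi i.as
    have hK := ih (fun i => kernel (Projective.π (M i)))
      fun i => (hi i).hasProjectiveDimensionLT_X₁ (n + 1)
        (hasProjectiveDimensionLT_of_ge _ 1 _ (by lia)) (hM i)
    have : PreservesFiniteLimits (colim : (Discrete I ⥤ A) ⥤ A) := inferInstance
    have : (colim : (Discrete I ⥤ A) ⥤ A).Additive := Functor.additive_of_preserves_binary_products _
    have hP : HasProjectiveDimensionLT (∐ fun i => Projective.over (M i)) 1 :=
      projective_iff_hasProjectiveDimensionLT_one.1 (projective_sigma _ fun i => inferInstance)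
    exact (hT.map_of_exact colim).hasProjectiveDimensionLT_X₃ (n + 1) hK
      (hasProjectiveDimensionLT_of_ge (∐ fun i => Projective.over (M i)) 1 _ (by lia))

end Homological
end Bredon

namespace Bredon
open Limits Opposite

/-! ### Free modules on set-valued functors. -/

section FreeModules

/-- The free abelian group functor, with values in `ℤ`-modules. -/
noncomputable def freeZ : Type u ⥤ ModuleCat.{u} ℤ where
  obj X := ModuleCat.of ℤ (X →₀ ℤ)
  map f := ModuleCat.ofHom (Finsupp.lmapDomain ℤ ℤ f)

/-- The basis element of a free abelian group. -/
noncomputable def freeMk {X : Type u} (x : X) : freeZ.obj X :=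
  (Finsupp.single x 1 : X →₀ ℤ)

theorem free_hom_ext {X : Type u} {M : ModuleCat.{u} ℤ} {f g : freeZ.obj X ⟶ M}
    (h : ∀ x : X, f (freeMk x) = g (freeMk x)) : f = g :=
  ModuleCat.hom_ext (Finsupp.lhom_ext' fun x => LinearMap.ext_ring (h x))

/-- The morphism out of a free abelian group given by the images of the basis. -/
noncomputable def freeDesc {X : Type u} {M : ModuleCat.{u} ℤ} (φ : X → M) : freeZ.obj X ⟶ M :=
  ModuleCat.ofHom (Finsupp.lift M ℤ X φ)

theorem lift_single_one {R : Type*} [Semiring R] {X M : Type*} [AddCommMonoid M] [Module R M]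
    (φ : X → M) (x : X) : Finsupp.lift M R X φ (Finsupp.single x 1) = φ x := by
  simp

@[simp]
theorem freeDesc_apply {X : Type u} {M : ModuleCat.{u} ℤ} (φ : X → M) (x : X) :
    freeDesc φ (freeMk x) = φ x :=
  lift_single_one (R := ℤ) φ x

@[simp]
theorem freeZ_map_apply {X Y : Type u} (f : X ⟶ Y) (x : X) :
    freeZ.map f (freeMk x) = freeMk (f x) :=
  Finsupp.mapDomain_single

variable {D : Type u} [SmallCategory D]

/-- The free module on a `Type`-valued functor. -/
noncomputable abbrev freeMod : (D ⥤ Type u) ⥤ (D ⥤ ModuleCat.{u} ℤ) :=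
  (Functor.whiskeringRight D (Type u) (ModuleCat.{u} ℤ)).obj freeZ

theorem freeMod_hom_ext {S : D ⥤ Type u} {M : D ⥤ ModuleCat.{u} ℤ} {f g : freeMod.obj S ⟶ M}
    (h : ∀ (d : D) (s : S.obj d), f.app d (freeMk s) = g.app d (freeMk s)) :
    f = g := by
  ext d : 2
  exact free_hom_ext (h d)

/-- The morphism out of a free module given by a natural family of elements. -/
noncomputable def freeModDesc {S : D ⥤ Type u} {M : D ⥤ ModuleCat.{u} ℤ}
    (φ : ∀ d, S.obj d → M.obj d)
    (hφ : ∀ {d d' : D} (f : d ⟶ d') (s : S.obj d), φ d' (S.map f s) = M.map f (φ d s)) :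
    freeMod.obj S ⟶ M where
  app d := freeDesc (φ d)
  naturality d d' f := by
    refine free_hom_ext fun s => ?_
    simp [hφ]

@[simp]
theorem freeModDesc_app {S : D ⥤ Type u} {M : D ⥤ ModuleCat.{u} ℤ}
    (φ : ∀ d, S.obj d → M.obj d)
    (hφ : ∀ {d d' : D} (f : d ⟶ d') (s : S.obj d), φ d' (S.map f s) = M.map f (φ d s))
    (d : D) (s : S.obj d) :
    (freeModDesc φ hφ).app d (freeMk s) = φ d s := by
  simp [freeModDesc]

theorem freeMod_naturality {S : D ⥤ Type u} {M : D ⥤ ModuleCat.{u} ℤ} (f : freeMod.obj S ⟶ M)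
    {d d' : D} (g : d ⟶ d') (s : S.obj d) :
    f.app d' (freeMk (S.map g s)) = M.map g (f.app d (freeMk s)) := by
  have := NatTrans.naturality_apply f g (freeMk s)
  rw [← this]
  simp

/-- Yoneda: a morphism out of this module is an element of the value at `d`, and epimorphisms are
surjective on values. -/
instance projective_freeMod_coyoneda (d : D) :
    Projective (freeMod.obj (coyoneda.obj (op d))) where
  factors {E X} f e he := by
    have : Epi (e.app d) := (NatTrans.epi_iff_epi_app e).1 he d
    obtain ⟨x, hx⟩ := (ModuleCat.epi_iff_surjective _).1 this (f.app d (freeMk (𝟙 d)))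
    refine ⟨freeModDesc (fun d' (g : d ⟶ d') => E.map g x) ?_, ?_⟩
    · intro d' d'' g s
      simp
    · refine freeMod_hom_ext fun d' (g : d ⟶ d') => ?_
      have h1 := freeMod_naturality f g (𝟙 d : (coyoneda.obj (op d)).obj d)
      have h2 := NatTrans.naturality_apply e g x
      simp only [NatTrans.comp_app, ModuleCat.comp_apply, freeModDesc_app]
      rw [h2, hx, ← h1]
      simp

/-- The disjoint union of a family of `Type`-valued functors. -/
@[simps]
def sigmaFunctor {I : Type u} (S : I → D ⥤ Type u) : D ⥤ Type u where
  obj d := Σ i, (S i).obj d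
  map f := ↾fun s => ⟨s.1, (S s.1).map f s.2⟩

/-- The inclusion of a summand of a disjoint union. -/
@[simps]
def sigmaInclusion {I : Type u} (S : I → D ⥤ Type u) (i : I) : S i ⟶ sigmaFunctor S where
  app d := ↾fun s => ⟨i, s⟩

/-- The free module on a disjoint union is the coproduct of the free modules. -/
noncomputable def freeModSigmaIso {I : Type u} (S : I → D ⥤ Type u) :
    (∐ fun i => freeMod.obj (S i)) ≅ freeMod.obj (sigmaFunctor S) where
  hom := Sigma.desc fun i => freeMod.map (sigmaInclusion S i)
  inv := freeModDesc (fun d s => (Sigma.ι (fun i => freeMod.obj (S i)) s.1).app d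
      (freeMk s.2)) fun f s => by
    exact freeMod_naturality (Sigma.ι (fun i => freeMod.obj (S i)) s.1) f s.2
  hom_inv_id := by
    refine Sigma.hom_ext _ _ fun i => ?_
    rw [Sigma.ι_desc_assoc, Category.comp_id]
    refine freeMod_hom_ext fun d s => ?_
    rw [NatTrans.comp_app, ModuleCat.comp_apply]
    exact (congrArg _ (freeZ_map_apply _ _)).trans (freeModDesc_app _ _ d _)
  inv_hom_id := by
    refine freeMod_hom_ext fun d s => ?_
    rw [NatTrans.comp_app, ModuleCat.comp_apply]
    refine (congrArg _ (freeModDesc_app _ _ d s)).trans ?_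
    rw [← ModuleCat.comp_apply, ← NatTrans.comp_app, Sigma.ι_desc]
    exact freeZ_map_apply _ _

/-- The index set of the canonical free cover of a module. -/
abbrev coverIndex (M : D ⥤ ModuleCat.{u} ℤ) : Type u := Σ d : D, M.obj d

/-- The disjoint union of corepresentable functors that covers a module. -/
abbrev coverFunctor (M : D ⥤ ModuleCat.{u} ℤ) : D ⥤ Type u :=
  sigmaFunctor fun p : coverIndex M => coyoneda.obj (op p.1)

theorem coverMap_naturality (M : D ⥤ ModuleCat.{u} ℤ) {d d' : D} (f : d ⟶ d')
    (s : (coverFunctor M).obj d) :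
    M.map (show s.1.1 ⟶ d' from ((coverFunctor M).map f s).2) s.1.2 =
      M.map f (M.map (show s.1.1 ⟶ d from s.2) s.1.2) := by
  change M.map ((show s.1.1 ⟶ d from s.2) ≫ f) s.1.2 = _
  simp

/-- The canonical free cover of a module. -/
noncomputable def coverMap (M : D ⥤ ModuleCat.{u} ℤ) : freeMod.obj (coverFunctor M) ⟶ M :=
  freeModDesc (fun d s => M.map (show s.1.1 ⟶ d from s.2) s.1.2) (coverMap_naturality M)

theorem coverMap_app (M : D ⥤ ModuleCat.{u} ℤ) (d : D) (s : (coverFunctor M).obj d) :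
    (coverMap M).app d (freeMk s) = M.map (show s.1.1 ⟶ d from s.2) s.1.2 :=
  freeModDesc_app _ (coverMap_naturality M) d s

instance (M : D ⥤ ModuleCat.{u} ℤ) : Epi (coverMap M) := by
  rw [NatTrans.epi_iff_epi_app]
  intro d
  rw [ModuleCat.epi_iff_surjective]
  intro m
  exact ⟨freeMk ⟨⟨d, m⟩, 𝟙 d⟩, (coverMap_app M d ⟨⟨d, m⟩, 𝟙 d⟩).trans (by simp)⟩

instance projective_cover (M : D ⥤ ModuleCat.{u} ℤ) : Projective (freeMod.obj (coverFunctor M)) :=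
  Projective.of_iso (freeModSigmaIso _)
    (projective_sigma _ fun _ => projective_freeMod_coyoneda _)

instance : EnoughProjectives (D ⥤ ModuleCat.{u} ℤ) where
  presentation M := ⟨{ p := freeMod.obj (coverFunctor M), f := coverMap M }⟩

/-- A projective module is a retract of its canonical free cover. -/
noncomputable def retractCover (M : D ⥤ ModuleCat.{u} ℤ) [Projective M] :
    Retract M (freeMod.obj (coverFunctor M)) where
  i := Projective.factorThru (𝟙 M) (coverMap M)
  r := coverMap M
  retract := Projective.factorThru_comp _ _

theorem hasProjectiveDimensionLT_freeMod_sigma {I : Type u} (S : I → D ⥤ Type u) (n : ℕ)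
    (h : ∀ i, HasProjectiveDimensionLT (freeMod.obj (S i)) (n + 1)) :
    HasProjectiveDimensionLT (freeMod.obj (sigmaFunctor S)) (n + 1) := by
  -- Exactness of coproducts is inherited from abelian groups.
  have : HasExactColimitsOfShape (Discrete I) (ModuleCat.{u} ℤ) :=
    HasExactColimitsOfShape.domain_of_functor _ (forget₂ (ModuleCat.{u} ℤ) AddCommGrpCat.{u})
  have := hasProjectiveDimensionLT_sigma n (fun i => freeMod.obj (S i)) h
  exact hasProjectiveDimensionLT_of_iso (freeModSigmaIso S) _

end FreeModules

end Bredon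

namespace Bredon
open Limits Opposite

/-! ### Pushing modules forward from a category of elements. -/

section Elements

variable {R : Type*} [Ring R] {D : Type u} [SmallCategory D] (S : D ⥤ Type u)

open Classical in
/-- The transition map of `elementsSum`. -/
noncomputable def elementsSumMap (M : S.Elements ⥤ ModuleCat.{u} R) {d d' : D} (f : d ⟶ d') :
    (DirectSum (S.obj d) fun s => M.obj ⟨d, s⟩) →ₗ[R]
      DirectSum (S.obj d') fun s => M.obj ⟨d', s⟩ :=
  DirectSum.toModule R _ _ fun s =>
    (DirectSum.lof R (S.obj d') (fun s' => M.obj ⟨d', s'⟩) (S.map f s)).comp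
      (M.map (CategoryOfElements.homMk ⟨d, s⟩ ⟨d', S.map f s⟩ f rfl)).hom

variable {S} in
open Classical in
theorem elementsSumMap_lof_homMk (M : S.Elements ⥤ ModuleCat.{u} R) {d d' : D} (f : d ⟶ d')
    (s : S.obj d) (s' : S.obj d') (h : S.map f s = s') (m : M.obj ⟨d, s⟩) :
    elementsSumMap S M f (DirectSum.lof R (S.obj d) (fun s => M.obj ⟨d, s⟩) s m) =
      DirectSum.lof R (S.obj d') (fun s => M.obj ⟨d', s⟩) s'
        (M.map (CategoryOfElements.homMk ⟨d, s⟩ ⟨d', s'⟩ f h) m) := by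
  subst h
  simp only [elementsSumMap]
  rw [DirectSum.toModule_lof]
  rfl

variable {S} in
open Classical in
theorem elementsSumMap_lof (M : S.Elements ⥤ ModuleCat.{u} R) {x y : S.Elements} (φ : x ⟶ y)
    (m : M.obj x) :
    elementsSumMap S M φ.val (DirectSum.lof R (S.obj x.1) (fun s => M.obj ⟨x.1, s⟩) x.2 m) =
      DirectSum.lof R (S.obj y.1) (fun s => M.obj ⟨y.1, s⟩) y.2 (M.map φ m) :=
  elementsSumMap_lof_homMk M φ.val x.2 y.2 φ.property m

open Classical in
/-- The left adjoint of the pullback along `S.Elements ⥤ D`, on objects: the value at `d` is the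
direct sum over `S d`. -/
noncomputable def elementsSumObj (M : S.Elements ⥤ ModuleCat.{u} R) : D ⥤ ModuleCat.{u} R where
  obj d := ModuleCat.of R (DirectSum (S.obj d) fun s => M.obj ⟨d, s⟩)
  map f := ModuleCat.ofHom (elementsSumMap S M f)
  map_id d := by
    refine ModuleCat.hom_ext (DirectSum.linearMap_ext R fun s => LinearMap.ext fun m => ?_)
    have h := elementsSumMap_lof M (𝟙 (show S.Elements from ⟨d, s⟩)) m
    exact h.trans (congrArg _ (ConcreteCategory.congr_hom (M.map_id _) m))
  map_comp {d d' d''} f g := by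
    refine ModuleCat.hom_ext (DirectSum.linearMap_ext R fun s => LinearMap.ext fun m => ?_)
    let φ := CategoryOfElements.homMk (F := S) ⟨d, s⟩ ⟨d', S.map f s⟩ f rfl
    let ψ := CategoryOfElements.homMk (F := S) ⟨d', S.map f s⟩ ⟨d'', S.map g (S.map f s)⟩ g rfl
    have h := elementsSumMap_lof M (φ ≫ ψ) m
    have h1 := elementsSumMap_lof M φ m
    have h2 := elementsSumMap_lof M ψ (M.map φ m)
    refine h.trans (Eq.trans ?_ (h2.symm.trans (congrArg _ h1.symm)))
    exact congrArg _ (ConcreteCategory.congr_hom (M.map_comp φ ψ) m)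

variable (R)

/-- The left adjoint of the pullback along `S.Elements ⥤ D`. -/
noncomputable def elementsSum : (S.Elements ⥤ ModuleCat.{u} R) ⥤ (D ⥤ ModuleCat.{u} R) where
  obj M := elementsSumObj S M
  map {M N} α :=
    { app d := ModuleCat.ofHom (DirectSum.lmap fun s => (α.app ⟨d, s⟩).hom)
      naturality d d' f := by
        classical
        refine ModuleCat.hom_ext (DirectSum.linearMap_ext R fun s => LinearMap.ext fun m => ?_)
        change DirectSum.lmap (fun s => (α.app ⟨d', s⟩).hom) (elementsSumMap S M f
            (DirectSum.lof R (S.obj d) (fun s => M.obj ⟨d, s⟩) s m)) =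
          elementsSumMap S N f (DirectSum.lmap (fun s => (α.app ⟨d, s⟩).hom)
            (DirectSum.lof R (S.obj d) (fun s => M.obj ⟨d, s⟩) s m))
        rw [elementsSumMap_lof_homMk M f s _ rfl, DirectSum.lmap_lof, DirectSum.lmap_lof]
        refine Eq.trans ?_ (elementsSumMap_lof_homMk N f s _ rfl _).symm
        exact congrArg _ (NatTrans.naturality_apply α
          (CategoryOfElements.homMk (F := S) ⟨d, s⟩ ⟨d', S.map f s⟩ f rfl) m) }
  map_id M := by
    ext d : 2
    exact ModuleCat.hom_ext DirectSum.lmap_id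
  map_comp α β := by
    ext d : 2
    exact ModuleCat.hom_ext (DirectSum.lmap_comp _ _)

/-- Pullback of modules along the projection `S.Elements ⥤ D`. -/
abbrev elementsPullback : (D ⥤ ModuleCat.{u} R) ⥤ (S.Elements ⥤ ModuleCat.{u} R) :=
  (Functor.whiskeringLeft S.Elements D (ModuleCat.{u} R)).obj (CategoryOfElements.π S)

open Classical in
/-- The adjunction between `elementsSum` and `elementsPullback`. -/
noncomputable def elementsAdjunction : elementsSum R S ⊣ elementsPullback R S :=
  Adjunction.mkOfUnitCounit
    { unit :=
        { app M :=
            { app x := ModuleCat.ofHom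
                (DirectSum.lof R (S.obj x.1) (fun s => M.obj ⟨x.1, s⟩) x.2)
              naturality x y φ := ModuleCat.hom_ext <| LinearMap.ext fun m =>
                (elementsSumMap_lof M φ m).symm }
          naturality M N α := by
            ext x : 2
            exact ModuleCat.hom_ext <| LinearMap.ext fun m =>
              (DirectSum.lmap_lof (fun s => (α.app ⟨x.1, s⟩).hom) x.2 m).symm }
      counit :=
        { app N :=
            { app d := ModuleCat.ofHom (DirectSum.toModule R _ _ fun s => LinearMap.id)
              naturality d d' f := by
                refine ModuleCat.hom_ext
                  (DirectSum.linearMap_ext R fun s => LinearMap.ext fun m => ?_)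
                change DirectSum.toModule R (S.obj d') (N.obj d') (fun s => LinearMap.id)
                    (elementsSumMap S ((elementsPullback R S).obj N) f
                      (DirectSum.lof R (S.obj d) (fun _ => N.obj d) s m)) =
                  N.map f (DirectSum.toModule R (S.obj d) (N.obj d) (fun s => LinearMap.id)
                    (DirectSum.lof R (S.obj d) (fun _ => N.obj d) s m))
                refine (congrArg (DirectSum.toModule R (S.obj d') (N.obj d') fun s => LinearMap.id)
                  (elementsSumMap_lof_homMk ((elementsPullback R S).obj N) f s _ rfl m)).trans
                  ((DirectSum.toModule_lof R _ _).trans ?_)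
                exact (congrArg (N.map f) (DirectSum.toModule_lof R (M := fun _ => N.obj d)
                  (φ := fun _ => LinearMap.id) s m)).symm }
          naturality N N' α := by
            ext d : 2
            refine ModuleCat.hom_ext
              (DirectSum.linearMap_ext R fun s => LinearMap.ext fun (m : N.obj d) => ?_)
            change DirectSum.toModule R (S.obj d) (N'.obj d) (fun _ => LinearMap.id)
                (DirectSum.lmap (fun _ => (α.app d).hom)
                  (DirectSum.lof R (S.obj d) (fun _ => N.obj d) s m)) =
              α.app d (DirectSum.toModule R (S.obj d) (N.obj d) (fun _ => LinearMap.id)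
                (DirectSum.lof R (S.obj d) (fun _ => N.obj d) s m))
            rw [DirectSum.lmap_lof, DirectSum.toModule_lof, DirectSum.toModule_lof]
            rfl }
      left_triangle := by
        ext M d : 4
        refine ModuleCat.hom_ext
          (DirectSum.linearMap_ext R fun s => LinearMap.ext fun m => ?_)
        change DirectSum.toModule R (S.obj d) _ (fun _ => LinearMap.id)
          (DirectSum.lmap (fun s => DirectSum.lof R (S.obj d) (fun s => M.obj ⟨d, s⟩) s)
            (DirectSum.lof R (S.obj d) (fun s => M.obj ⟨d, s⟩) s m)) =
          DirectSum.lof R (S.obj d) (fun s => M.obj ⟨d, s⟩) s m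
        rw [DirectSum.lmap_lof, DirectSum.toModule_lof]
        rfl
      right_triangle := by
        ext N x : 4
        refine ModuleCat.hom_ext <| LinearMap.ext fun m => ?_
        exact DirectSum.toModule_lof R (M := fun _ => N.obj x.1) (φ := fun _ => LinearMap.id) x.2 m }

instance : (elementsSum R S).Additive where
  map_add {M N α β} := by
    classical
    ext d : 2
    refine ModuleCat.hom_ext (DirectSum.linearMap_ext R fun s => LinearMap.ext fun m => ?_)
    change DirectSum.lmap (fun s => ((α + β).app ⟨d, s⟩).hom)
        (DirectSum.lof R (S.obj d) (fun s => M.obj ⟨d, s⟩) s m) =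
      DirectSum.lmap (fun s => (α.app ⟨d, s⟩).hom)
        (DirectSum.lof R (S.obj d) (fun s => M.obj ⟨d, s⟩) s m) +
      DirectSum.lmap (fun s => (β.app ⟨d, s⟩).hom)
        (DirectSum.lof R (S.obj d) (fun s => M.obj ⟨d, s⟩) s m)
    rw [DirectSum.lmap_lof, DirectSum.lmap_lof, DirectSum.lmap_lof, ← map_add]
    rfl

instance : PreservesFiniteColimits (elementsSum R S) :=
  have := (elementsAdjunction R S).leftAdjoint_preservesColimits
  inferInstance

/-- Each value is a direct sum of values, and a direct sum of injective maps is injective; right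
exactness comes from the adjunction. -/
instance : PreservesFiniteLimits (elementsSum R S) := by
  rw [Functor.preservesFiniteLimits_iff_forall_exact_map_and_mono]
  intro T hT
  refine ⟨((Functor.preservesFiniteColimits_iff_forall_exact_map_and_epi _).1
    inferInstance T hT).1, ?_⟩
  rw [NatTrans.mono_iff_mono_app]
  intro d
  rw [ModuleCat.mono_iff_injective]
  refine (DirectSum.lmap_injective (fun s => (T.f.app ⟨d, s⟩).hom)).2 fun s => ?_
  exact (ModuleCat.mono_iff_injective _).1 ((NatTrans.mono_iff_mono_app T.f).1 hT.mono_f ⟨d, s⟩)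

theorem projective_elementsSum (P : S.Elements ⥤ ModuleCat.{u} R) (hP : Projective P) :
    Projective ((elementsSum R S).obj P) :=
  (elementsAdjunction R S).map_projective P hP

end Elements


end Bredon

namespace Bredon
open Limits Opposite

/-! ### Free modules as pushforwards of constant modules. -/

section ElementsInt

variable {D : Type u} [SmallCategory D] (S : D ⥤ Type u)

/-- The constant module `ℤ`. -/
noncomputable abbrev constZ (D : Type u) [SmallCategory D] : D ⥤ ModuleCat.{u} ℤ :=
  (Functor.const D).obj (ModuleCat.of ℤ (ULift.{u} ℤ))

/-- The morphism from `ℤ` determined by an element. -/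
noncomputable def ofElement {M : ModuleCat.{u} ℤ} (m : M) : ModuleCat.of ℤ (ULift.{u} ℤ) ⟶ M :=
  ModuleCat.ofHom ((LinearMap.toSpanSingleton ℤ M m).comp
    (ULift.moduleEquiv (R := ℤ) (M := ℤ)).toLinearMap)

theorem toSpanSingleton_comp_up {R M : Type*} [CommRing R] [AddCommGroup M] [Module R M] (m : M) :
    (LinearMap.toSpanSingleton R M m).comp (ULift.moduleEquiv (R := R) (M := R)).toLinearMap
      (ULift.up.{u} 1) = m := by
  simp

@[simp]
theorem ofElement_one {M : ModuleCat.{u} ℤ} (m : M) : ofElement m (ULift.up.{u} (1 : ℤ)) = m :=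
  toSpanSingleton_comp_up.{u} (R := ℤ) m

theorem ulift_hom_ext {M : ModuleCat.{u} ℤ} {f g : ModuleCat.of ℤ (ULift.{u} ℤ) ⟶ M}
    (h : f (ULift.up.{u} (1 : ℤ)) = g (ULift.up.{u} (1 : ℤ))) : f = g := by
  refine ModuleCat.hom_ext (LinearMap.ext fun z => ?_)
  have hz : z = z.down • (ULift.up.{u} (1 : ℤ)) := by ext; simp
  rw [hz, map_zsmul, map_zsmul]
  exact congrArg _ h

/-- The basis elements of a direct sum of copies of `ℤ`. -/
noncomputable def elementsSumBasis (d : D) (s : S.obj d) :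
    ((elementsSum ℤ S).obj (constZ S.Elements)).obj d :=
  ((elementsAdjunction ℤ S).unit.app (constZ S.Elements)).app ⟨d, s⟩ (ULift.up.{u} (1 : ℤ))

theorem elementsSumBasis_naturality {d d' : D} (f : d ⟶ d') (s : S.obj d) :
    elementsSumBasis S d' (S.map f s) =
      ((elementsSum ℤ S).obj (constZ S.Elements)).map f (elementsSumBasis S d s) :=
  NatTrans.naturality_apply ((elementsAdjunction ℤ S).unit.app (constZ S.Elements))
    (CategoryOfElements.homMk (F := S) ⟨d, s⟩ ⟨d', S.map f s⟩ f rfl) (ULift.up.{u} (1 : ℤ))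

theorem elementsSumConst_hom_ext {N : D ⥤ ModuleCat.{u} ℤ}
    {f g : (elementsSum ℤ S).obj (constZ S.Elements) ⟶ N}
    (h : ∀ d s, f.app d (elementsSumBasis S d s) = g.app d (elementsSumBasis S d s)) : f = g := by
  apply ((elementsAdjunction ℤ S).homEquiv _ _).injective
  ext x : 2
  refine ulift_hom_ext ?_
  rw [Adjunction.homEquiv_unit, Adjunction.homEquiv_unit]
  exact h x.1 x.2

/-- The natural family of basis elements, as a morphism over the category of elements. -/
noncomputable def freeMkHom : constZ S.Elements ⟶ (elementsPullback ℤ S).obj (freeMod.obj S) where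
  app x := ofElement (freeMk x.2)
  naturality x y φ := ulift_hom_ext <| by
    have h := (freeZ_map_apply (S.map φ.val) x.2).trans (congrArg freeMk φ.property)
    refine (ofElement_one _).trans (h.symm.trans ?_)
    exact congrArg (freeZ.map (S.map φ.val)) (ofElement_one _).symm

/-- The comparison from a direct sum of copies of `ℤ` to a free module. -/
noncomputable def elementsSumConstHom :
    (elementsSum ℤ S).obj (constZ S.Elements) ⟶ freeMod.obj S :=
  ((elementsAdjunction ℤ S).homEquiv _ _).symm (freeMkHom S)

theorem elementsSumConstHom_app (d : D) (s : S.obj d) :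
    (elementsSumConstHom S).app d (elementsSumBasis S d s) = freeMk s := by
  have h := (elementsAdjunction ℤ S).homEquiv_unit (f := elementsSumConstHom S)
  rw [elementsSumConstHom, Equiv.apply_symm_apply] at h
  have h2 := congrArg (fun k => k.app ⟨d, s⟩ (ULift.up.{u} (1 : ℤ))) h
  exact h2.symm.trans (ofElement_one _)

/-- The direct sum over `S` of constant modules is the free module on `S`. -/
noncomputable def elementsSumConstIso :
    (elementsSum ℤ S).obj (constZ S.Elements) ≅ freeMod.obj S where
  hom := elementsSumConstHom S
  inv := freeModDesc (elementsSumBasis S) (elementsSumBasis_naturality S)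
  hom_inv_id := by
    refine elementsSumConst_hom_ext S fun d s => ?_
    rw [NatTrans.comp_app, ModuleCat.comp_apply]
    exact (congrArg _ (elementsSumConstHom_app S d s)).trans
      (freeModDesc_app _ (elementsSumBasis_naturality S) d s)
  inv_hom_id := by
    refine freeMod_hom_ext fun d s => ?_
    rw [NatTrans.comp_app, ModuleCat.comp_apply]
    exact (congrArg _ (freeModDesc_app _ (elementsSumBasis_naturality S) d s)).trans
      (elementsSumConstHom_app S d s)

/-- `elementsSum` is exact, preserves projectives and sends the constant module to the free module
on `S`, so it cannot raise the dimension. -/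
theorem hasProjectiveDimensionLT_freeMod (n : ℕ)
    (h : HasProjectiveDimensionLT (constZ S.Elements) (n + 1)) :
    HasProjectiveDimensionLT (freeMod.obj S) (n + 1) := by
  have := hasProjectiveDimensionLT_map (elementsSum ℤ S) 0
    (fun P hP => projective_iff_hasProjectiveDimensionLT_one.1 (projective_elementsSum ℤ S P hP))
    n _ h
  exact hasProjectiveDimensionLT_of_iso (elementsSumConstIso S) (n + 1)

end ElementsInt

end Bredon

namespace Bredon
open Limits Opposite

/-! ### Fixed point presheaves of G-sets and their orbit decomposition. -/

section GSets

variable {G : Type u} [Group G]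

theorem quotient_hom_ext {L : Subgroup G} {X : Type*} [MulAction G X] {φ ψ : G ⧸ L →[G] X}
    (h : φ ((1 : G) : G ⧸ L) = ψ ((1 : G) : G ⧸ L)) : φ = ψ := by
  ext y
  obtain ⟨g, rfl⟩ := QuotientGroup.mk_surjective y
  have : (g : G ⧸ L) = g • ((1 : G) : G ⧸ L) := by
    rw [MulAction.Quotient.smul_coe, smul_eq_mul, mul_one]
  rw [this, map_smul, map_smul, h]

theorem smul_one_quotient {L : Subgroup G} {l : G} (hl : l ∈ L) :
    l • ((1 : G) : G ⧸ L) = ((1 : G) : G ⧸ L) := by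
  rw [MulAction.Quotient.smul_coe, smul_eq_mul, mul_one]
  exact (QuotientGroup.eq).2 (by simpa using hl)

theorem smul_hom_one {L : Subgroup G} {X : Type*} [MulAction G X] (φ : G ⧸ L →[G] X) {l : G}
    (hl : l ∈ L) : l • φ ((1 : G) : G ⧸ L) = φ ((1 : G) : G ⧸ L) := by
  rw [← map_smul, smul_one_quotient hl]

/-- The equivariant map out of an orbit `G ⧸ L` determined by a point fixed by `L`. -/
def ofFixed (L : Subgroup G) {X : Type*} [MulAction G X] (x : X) (h : ∀ l ∈ L, l • x = x) :
    G ⧸ L →[G] X where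
  toFun := Quotient.lift (fun g : G => g • x) fun a b hab => by
    have : a⁻¹ * b ∈ L := QuotientGroup.leftRel_apply.1 hab
    have h1 := h _ this
    rw [mul_smul, inv_smul_eq_iff] at h1
    exact h1.symm
  map_smul' g y := by
    obtain ⟨a, rfl⟩ := QuotientGroup.mk_surjective y
    exact mul_smul g a x

theorem ofFixed_one (L : Subgroup G) {X : Type*} [MulAction G X] (x : X)
    (h : ∀ l ∈ L, l • x = x) : ofFixed L x h ((1 : G) : G ⧸ L) = x := one_smul G x

variable (F : Set (Subgroup G))

variable {F} in
/-- A morphism of the orbit category, as an equivariant map. -/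
def toEquivariant {c d : OrbitCategory F} (f : c ⟶ d) : G ⧸ c.subgroup →[G] G ⧸ d.subgroup := f

/-- The presheaf of fixed points of a `G`-set on the orbit category. -/
def homPresheaf (X : Type u) [MulAction G X] : (OrbitCategory F)ᵒᵖ ⥤ Type u where
  obj c := G ⧸ c.unop.subgroup →[G] X
  map f := ↾fun φ => MulActionHom.comp φ (toEquivariant f.unop)

/-- The map of fixed point presheaves induced by an equivariant map. -/
def homPresheafMap {X Y : Type u} [MulAction G X] [MulAction G Y] (α : X →[G] Y) :
    homPresheaf F X ⟶ homPresheaf F Y where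
  app c := ↾fun φ => MulActionHom.comp α φ

end GSets

theorem isIso_of_bijective {D : Type u} [SmallCategory D] {S T : D ⥤ Type u} (α : S ⟶ T)
    (h : ∀ d, Function.Bijective (α.app d)) : IsIso α := by
  rw [NatTrans.isIso_iff_isIso_app]
  exact fun d => (isIso_iff_bijective _).2 (h d)

theorem hasProjectiveDimensionLT_freeMod_of_bijective {D : Type u} [SmallCategory D]
    {S T : D ⥤ Type u} (α : S ⟶ T) (h : ∀ d, Function.Bijective (α.app d)) (n : ℕ)
    (hS : HasProjectiveDimensionLT (freeMod.obj S) n) :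
    HasProjectiveDimensionLT (freeMod.obj T) n :=
  have := isIso_of_bijective α h
  hasProjectiveDimensionLT_of_iso (freeMod.mapIso (asIso α)) n

section Orbits

variable {G : Type u} [Group G] (F : Set (Subgroup G))

/-- The equivariant map from the orbit of a point. -/
def orbitHom {X : Type u} [MulAction G X] (x : X) : G ⧸ MulAction.stabilizer G x →[G] X :=
  ofFixed _ x fun _ h => h

theorem orbitHom_injective {X : Type u} [MulAction G X] (x : X) :
    Function.Injective (orbitHom (G := G) x) :=
  MulAction.injective_ofQuotientStabilizer G x

/-- The decomposition of a `G`-set into orbits, on fixed point presheaves. -/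
noncomputable def orbitDecomposition (X : Type u) [MulAction G X] :
    sigmaFunctor (fun i : MulAction.orbitRel.Quotient G X =>
      homPresheaf F (G ⧸ MulAction.stabilizer G i.out)) ⟶ homPresheaf F X where
  app c := ↾fun s => MulActionHom.comp (orbitHom s.1.out) s.2

theorem mk_orbitHom {X : Type u} [MulAction G X] (i : MulAction.orbitRel.Quotient G X)
    (y : G ⧸ MulAction.stabilizer G i.out) :
    (Quotient.mk'' (orbitHom i.out y) : MulAction.orbitRel.Quotient G X) = i := by
  obtain ⟨g, rfl⟩ := QuotientGroup.mk_surjective y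
  conv_rhs => rw [← Quotient.out_eq' i]
  exact Quotient.sound' ⟨g, rfl⟩

/-- The value at the base coset determines both the orbit, since orbits are disjoint, and the map
into it. -/
theorem orbitHom_comp_injective {X : Type u} [MulAction G X] (L : Subgroup G)
    {i j : MulAction.orbitRel.Quotient G X} (φ : G ⧸ L →[G] G ⧸ MulAction.stabilizer G i.out)
    (ψ : G ⧸ L →[G] G ⧸ MulAction.stabilizer G j.out)
    (h : MulActionHom.comp (orbitHom i.out) φ = MulActionHom.comp (orbitHom j.out) ψ) :
    (⟨i, φ⟩ : Σ i : MulAction.orbitRel.Quotient G X,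
      G ⧸ L →[G] G ⧸ MulAction.stabilizer G i.out) = ⟨j, ψ⟩ := by
  have h1 : orbitHom i.out (φ ((1 : G) : G ⧸ L)) = orbitHom j.out (ψ ((1 : G) : G ⧸ L)) :=
    congrArg (fun k => k ((1 : G) : G ⧸ L)) h
  obtain rfl : i = j := by rw [← mk_orbitHom i (φ ((1 : G) : G ⧸ L)), h1, mk_orbitHom]
  obtain rfl : φ = ψ := quotient_hom_ext (orbitHom_injective _ h1)
  rfl

theorem orbitHom_comp_surjective {X : Type u} [MulAction G X] (L : Subgroup G) (φ : G ⧸ L →[G] X) :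
    ∃ (i : MulAction.orbitRel.Quotient G X) (ψ : G ⧸ L →[G] G ⧸ MulAction.stabilizer G i.out),
      MulActionHom.comp (orbitHom i.out) ψ = φ := by
  obtain ⟨i, hi⟩ : ∃ i : MulAction.orbitRel.Quotient G X,
      φ ((1 : G) : G ⧸ L) ∈ MulAction.orbit G i.out :=
    ⟨Quotient.mk'' (φ ((1 : G) : G ⧸ L)), MulAction.orbitRel_apply.1
      (Quotient.exact' (Quotient.out_eq' (Quotient.mk'' (φ ((1 : G) : G ⧸ L)))).symm)⟩
  obtain ⟨g, hg⟩ := MulAction.mem_orbit_iff.1 hi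
  have hg' : orbitHom i.out (QuotientGroup.mk g) = φ ((1 : G) : G ⧸ L) := hg
  have hfix : ∀ l ∈ L, l • (QuotientGroup.mk g : G ⧸ MulAction.stabilizer G i.out) =
      QuotientGroup.mk g := fun l hl => orbitHom_injective i.out <|
    (map_smul (orbitHom i.out) l _).trans
      ((congrArg (l • ·) hg').trans ((smul_hom_one φ hl).trans hg'.symm))
  refine ⟨i, ofFixed L _ hfix, ?_⟩
  apply quotient_hom_ext
  rw [MulActionHom.comp_apply, ofFixed_one, hg']

theorem orbitDecomposition_bijective (X : Type u) [MulAction G X] (c : (OrbitCategory F)ᵒᵖ) :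
    Function.Bijective ((orbitDecomposition F X).app c) := by
  refine ⟨fun s t h => orbitHom_comp_injective _ s.2 t.2 h, fun φ => ?_⟩
  obtain ⟨i, ψ, h⟩ := orbitHom_comp_surjective _ φ
  exact ⟨⟨i, ψ⟩, h⟩

theorem hasProjectiveDimensionLT_homPresheaf_of_orbits (X : Type u) [MulAction G X] (n : ℕ)
    (h : ∀ x : X, HasProjectiveDimensionLT
      (freeMod.obj (homPresheaf F (G ⧸ MulAction.stabilizer G x))) (n + 1)) :
    HasProjectiveDimensionLT (freeMod.obj (homPresheaf F X)) (n + 1) :=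
  hasProjectiveDimensionLT_freeMod_of_bijective _ (orbitDecomposition_bijective F X) _
    (hasProjectiveDimensionLT_freeMod_sigma _ _ fun i => h i.out)

end Orbits

/-! ### Bredon dimension as a projective dimension. -/

section Dimension

variable {G : Type u} [Group G] (F : Set (Subgroup G))

theorem hasProjectiveResolutionOfLength_iff (n : ℕ) :
    HasProjectiveResolutionOfLength F n ↔
      HasProjectiveDimensionLT (constZ (OrbitCategory F)ᵒᵖ) (n + 1) :=
  exists_resolution_iff _ n

theorem cd_le_iff (n : ℕ) :
    cd F ≤ n ↔ HasProjectiveDimensionLT (constZ (OrbitCategory F)ᵒᵖ) (n + 1) := by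
  constructor
  · intro h
    -- The strict bound makes some index of the infimum satisfy it, so an actual resolution of
    -- length at most n exists.
    have h' : cd F < ((n + 1 : ℕ) : ℕ∞) := h.trans_lt (by exact_mod_cast Nat.lt_succ_self n)
    simp only [cd, iInf_lt_iff] at h'
    obtain ⟨m, hm, hmn⟩ := h'
    have := (hasProjectiveResolutionOfLength_iff F m).1 hm
    exact hasProjectiveDimensionLT_of_ge _ (m + 1) _ (by exact_mod_cast hmn)
  · intro h
    exact iInf₂_le n ((hasProjectiveResolutionOfLength_iff F n).2 h)

end Dimension

end Bredon

namespace Bredon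
open Limits Opposite

/-! ### The orbit category of a subgroup as a category of elements. -/

section Induction

/-- An equivariant map, as a morphism of the orbit category. -/
def ofEquivariant {G : Type u} [Group G] {F : Set (Subgroup G)} {c d : OrbitCategory F}
    (φ : G ⧸ c.subgroup →[G] G ⧸ d.subgroup) : c ⟶ d := φ

variable {G : Type u} [Group G]

/-- The inclusion of orbits `K ⧸ L ⟶ G ⧸ L` for `L ≤ K ≤ G`. -/
def orbitInclusion {K : Subgroup G} (L : Subgroup K) : K ⧸ L → G ⧸ L.map K.subtype :=
  Quotient.lift (fun k : K => ((k : G) : G ⧸ L.map K.subtype)) fun a b hab => by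
    have : a⁻¹ * b ∈ L := QuotientGroup.leftRel_apply.1 hab
    exact QuotientGroup.eq.2 ⟨_, this, by simp⟩

theorem orbitInclusion_injective {K : Subgroup G} (L : Subgroup K) :
    Function.Injective (orbitInclusion L) := by
  intro x y h
  obtain ⟨a, rfl⟩ := QuotientGroup.mk_surjective x
  obtain ⟨b, rfl⟩ := QuotientGroup.mk_surjective y
  obtain ⟨c, hc, h⟩ := QuotientGroup.eq.1 h
  refine QuotientGroup.eq.2 ?_
  have : c = a⁻¹ * b := Subtype.ext h
  rwa [← this]

theorem orbitInclusion_smul {K : Subgroup G} (L : Subgroup K) (k : K) (x : K ⧸ L) :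
    orbitInclusion L (k • x) = (k : G) • orbitInclusion L x := by
  obtain ⟨a, rfl⟩ := QuotientGroup.mk_surjective x
  rfl

/-- The `G`-map induced by a `K`-map of orbits. -/
def inducedHom {K : Subgroup G} {L M : Subgroup K} (φ : K ⧸ L →[K] K ⧸ M) :
    G ⧸ L.map K.subtype →[G] G ⧸ M.map K.subtype :=
  ofFixed _ (orbitInclusion M (φ ((1 : K) : K ⧸ L))) (by
    rintro _ ⟨l, hl, rfl⟩
    exact (orbitInclusion_smul M l _).symm.trans (congrArg _ (smul_hom_one φ hl)))

theorem inducedHom_orbitInclusion {K : Subgroup G} {L M : Subgroup K} (φ : K ⧸ L →[K] K ⧸ M)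
    (x : K ⧸ L) : inducedHom φ (orbitInclusion L x) = orbitInclusion M (φ x) := by
  obtain ⟨a, rfl⟩ := QuotientGroup.mk_surjective x
  have h : (a : K ⧸ L) = a • ((1 : K) : K ⧸ L) := by
    rw [MulAction.Quotient.smul_coe, smul_eq_mul, mul_one]
  conv_rhs => rw [h, map_smul, orbitInclusion_smul]
  rfl

theorem inducedHom_one {K : Subgroup G} {L M : Subgroup K} (φ : K ⧸ L →[K] K ⧸ M) :
    inducedHom φ ((1 : G) : G ⧸ L.map K.subtype) = orbitInclusion M (φ ((1 : K) : K ⧸ L)) :=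
  ofFixed_one _ _ _

/-- The projection `G ⧸ L ⟶ G ⧸ K` for `L ≤ K`. -/
def orbitProjection {K : Subgroup G} (L : Subgroup K) : G ⧸ L.map K.subtype →[G] G ⧸ K :=
  ofFixed _ ((1 : G) : G ⧸ K) (by
    rintro _ ⟨l, _, rfl⟩
    exact smul_one_quotient l.2)

theorem orbitProjection_orbitInclusion {K : Subgroup G} (L : Subgroup K) (x : K ⧸ L) :
    orbitProjection L (orbitInclusion L x) = ((1 : G) : G ⧸ K) := by
  obtain ⟨a, rfl⟩ := QuotientGroup.mk_surjective x
  exact smul_one_quotient a.2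

theorem orbitProjection_comp_inducedHom {K : Subgroup G} {L M : Subgroup K}
    (φ : K ⧸ L →[K] K ⧸ M) :
    MulActionHom.comp (orbitProjection M) (inducedHom φ) = orbitProjection L := by
  apply quotient_hom_ext
  rw [MulActionHom.comp_apply, inducedHom_one, orbitProjection_orbitInclusion]
  exact (ofFixed_one _ _ _).symm

theorem inducedHom_injective {K : Subgroup G} {L M : Subgroup K} {φ ψ : K ⧸ L →[K] K ⧸ M}
    (h : inducedHom φ = inducedHom ψ) : φ = ψ := by
  apply quotient_hom_ext
  apply orbitInclusion_injective
  rw [← inducedHom_one, ← inducedHom_one, h]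

/-- Compatibility with the projections to G/K forces the image of the base coset to have a
representative in K, and this representative defines the K-map. -/
theorem exists_inducedHom {K : Subgroup G} {L M : Subgroup K}
    (ψ : G ⧸ L.map K.subtype →[G] G ⧸ M.map K.subtype)
    (h : MulActionHom.comp (orbitProjection M) ψ = orbitProjection L) :
    ∃ φ : K ⧸ L →[K] K ⧸ M, inducedHom φ = ψ := by
  obtain ⟨g, hg⟩ := QuotientGroup.mk_surjective (ψ ((1 : G) : G ⧸ L.map K.subtype))
  have h1 : orbitProjection M (ψ ((1 : G) : G ⧸ L.map K.subtype)) = ((1 : G) : G ⧸ K) :=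
    (congrArg (fun k => k ((1 : G) : G ⧸ L.map K.subtype)) h).trans (ofFixed_one _ _ _)
  have hgK : g ∈ K := by
    rw [← hg] at h1
    have h2 : ((g * 1 : G) : G ⧸ K) = ((1 : G) : G ⧸ K) := h1
    simpa using QuotientGroup.eq.1 h2
  have hg' : orbitInclusion M (QuotientGroup.mk ⟨g, hgK⟩) =
    ψ ((1 : G) : G ⧸ L.map K.subtype) := hg
  refine ⟨ofFixed L (QuotientGroup.mk ⟨g, hgK⟩) fun l hl => orbitInclusion_injective M ?_, ?_⟩
  · rw [orbitInclusion_smul, hg']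
    exact smul_hom_one ψ ⟨l, hl, rfl⟩
  · apply quotient_hom_ext
    rw [inducedHom_one, ofFixed_one, hg']

theorem inducedHom_id {K : Subgroup G} (L : Subgroup K) :
    inducedHom (MulActionHom.id K : K ⧸ L →[K] K ⧸ L) = MulActionHom.id G := by
  apply quotient_hom_ext
  rw [inducedHom_one]
  rfl

theorem inducedHom_comp {K : Subgroup G} {L M N : Subgroup K} (φ : K ⧸ L →[K] K ⧸ M)
    (ψ : K ⧸ M →[K] K ⧸ N) :
    inducedHom (MulActionHom.comp ψ φ) = MulActionHom.comp (inducedHom ψ) (inducedHom φ) := by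
  apply quotient_hom_ext
  rw [inducedHom_one, MulActionHom.comp_apply, MulActionHom.comp_apply, inducedHom_one,
    inducedHom_orbitInclusion]

variable {F : Set (Subgroup G)} (hF : IsFullFamily F) (K : Subgroup G)

include hF in
theorem map_mem_of_mem_restrictFamily {L : Subgroup K} (hL : L ∈ restrictFamily F K) :
    L.map K.subtype ∈ F := by
  obtain ⟨H, hH, rfl⟩ := hL
  exact hF.mem_of_le H hH _ (by rw [Subgroup.subgroupOf_map_subtype]; exact inf_le_left)

/-- Induction of orbits from a subgroup. -/
def inducedFunctor : OrbitCategory (restrictFamily F K) ⥤ OrbitCategory F where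
  obj c := ⟨c.subgroup.map K.subtype, map_mem_of_mem_restrictFamily hF K c.mem⟩
  map f := ofEquivariant (inducedHom (toEquivariant f))
  map_id c := inducedHom_id c.subgroup
  map_comp f g := inducedHom_comp (toEquivariant f) (toEquivariant g)

/-- The comparison from the orbit category of a subgroup `K` to the category of elements of the
orbit `G ⧸ K`. -/
def orbitToElements :
    (OrbitCategory (restrictFamily F K))ᵒᵖ ⥤ (homPresheaf F (G ⧸ K)).Elements where
  obj c := ⟨op ((inducedFunctor hF K).obj c.unop), orbitProjection c.unop.subgroup⟩
  map f := ⟨((inducedFunctor hF K).map f.unop).op,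
    orbitProjection_comp_inducedHom (toEquivariant f.unop)⟩
  map_id c := Subtype.ext (congrArg Quiver.Hom.op ((inducedFunctor hF K).map_id c.unop))
  map_comp f g :=
    Subtype.ext (congrArg Quiver.Hom.op ((inducedFunctor hF K).map_comp g.unop f.unop))

instance : (orbitToElements hF K).Faithful where
  map_injective {c d f g} h := by
    have h1 := congrArg Subtype.val h
    have h2 : inducedHom (toEquivariant f.unop) = inducedHom (toEquivariant g.unop) :=
      congrArg Quiver.Hom.unop h1
    exact Quiver.Hom.unop_inj (inducedHom_injective h2)

instance : (orbitToElements hF K).Full where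
  map_surjective {c d} f := by
    obtain ⟨⟨φ⟩, hf⟩ := f
    obtain ⟨ψ, hψ⟩ := exists_inducedHom (L := d.unop.subgroup) (M := c.unop.subgroup) φ hf
    subst hψ
    exact ⟨Quiver.Hom.op (ofEquivariant ψ), rfl⟩

/-- If a map G/L → G/K sends the base coset to xK, then H = x⁻¹Lx lies in K. Right multiplication by
x gives G/L ≅ G/H over G/K, and H is in F by closure under conjugation. -/
instance : (orbitToElements hF K).EssSurj where
  mem_essImage := by
    rintro ⟨⟨L, hL⟩, φ⟩
    change G ⧸ L →[G] G ⧸ K at φ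
    obtain ⟨x, hx⟩ := QuotientGroup.mk_surjective (φ ((1 : G) : G ⧸ L))
    have hLK : ∀ l ∈ L, x⁻¹ * l * x ∈ K := by
      intro l hl
      have h := smul_hom_one φ hl
      rw [← hx] at h
      have h2 := QuotientGroup.eq.1 h.symm
      simpa [mul_assoc] using h2
    let H : Subgroup G := L.map (MulAut.conj x⁻¹).toMonoidHom
    have hH : H ∈ F := hF.conj_mem L hL x⁻¹
    have hHK : H ≤ K := by
      rintro _ ⟨l, hl, rfl⟩
      simpa using hLK l hl
    have hmap : (H.subgroupOf K).map K.subtype = H := Subgroup.map_subgroupOf_eq_of_le hHK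
    have hmem : ∀ g, g ∈ (H.subgroupOf K).map K.subtype ↔ x * g * x⁻¹ ∈ L := by
      intro g
      rw [hmap]
      constructor
      · rintro ⟨l, hl, rfl⟩
        simpa [mul_assoc] using hl
      · intro h
        exact ⟨_, h, by simp [mul_assoc]⟩
    let c : OrbitCategory (restrictFamily F K) := ⟨H.subgroupOf K, H, hH, rfl⟩
    let a : G ⧸ L →[G] G ⧸ (H.subgroupOf K).map K.subtype :=
      ofFixed L (QuotientGroup.mk x) fun l hl => by
        refine (QuotientGroup.eq).2 ((hmem _).2 ?_)
        simpa [mul_assoc] using hl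
    let b : G ⧸ (H.subgroupOf K).map K.subtype →[G] G ⧸ L :=
      ofFixed _ (QuotientGroup.mk x⁻¹) fun l hl => by
        refine (QuotientGroup.eq).2 ?_
        have := (hmem _).1 hl
        rw [← L.inv_mem_iff]
        simpa [mul_assoc] using this
    have hab : MulActionHom.comp b a = MulActionHom.id G := quotient_hom_ext (by
      rw [MulActionHom.comp_apply]
      refine (congrArg b (ofFixed_one _ _ _)).trans ?_
      exact congrArg QuotientGroup.mk (mul_inv_cancel x))
    have hba : MulActionHom.comp a b = MulActionHom.id G := quotient_hom_ext (by
      rw [MulActionHom.comp_apply]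
      refine (congrArg a (ofFixed_one _ _ _)).trans ?_
      exact congrArg QuotientGroup.mk (inv_mul_cancel x))
    have hpr : MulActionHom.comp (orbitProjection (H.subgroupOf K)) a = φ := quotient_hom_ext (by
      rw [MulActionHom.comp_apply, ← hx]
      refine (congrArg (orbitProjection _) (ofFixed_one _ _ _)).trans ?_
      exact congrArg QuotientGroup.mk (mul_one x))
    let e : ((orbitToElements hF K).obj (op c)).1 ≅ op ⟨L, hL⟩ :=
      { hom := Quiver.Hom.op (ofEquivariant (d := (inducedFunctor hF K).obj c) a)
        inv := Quiver.Hom.op (ofEquivariant (c := (inducedFunctor hF K).obj c) b)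
        hom_inv_id := Quiver.Hom.unop_inj hba
        inv_hom_id := Quiver.Hom.unop_inj hab }
    exact ⟨op c, ⟨CategoryOfElements.isoMk _ _ e hpr⟩⟩

instance : (orbitToElements hF K).IsEquivalence where

end Induction

theorem hasProjectiveDimensionLT_constZ_of_isEquivalence {C D : Type u} [SmallCategory C]
    [SmallCategory D] (E : C ⥤ D) [E.IsEquivalence] (n : ℕ)
    (h : HasProjectiveDimensionLT (constZ C) (n + 1)) :
    HasProjectiveDimensionLT (constZ D) (n + 1) := by
  let e : (C ⥤ ModuleCat.{u} ℤ) ≌ (D ⥤ ModuleCat.{u} ℤ) := E.asEquivalence.congrLeft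
  have : e.functor.Additive := ⟨rfl⟩
  exact hasProjectiveDimensionLT_map e.functor 0 (fun P hP =>
    projective_iff_hasProjectiveDimensionLT_one.1 ((e.map_projective_iff P).2 hP)) n _ h

section Cd

variable {G : Type u} [Group G] {F : Set (Subgroup G)} (hF : IsFullFamily F) (K : Subgroup G)

-- The free module on G/K is induced from the constant module over the orbit category of K. No
-- assumption that K lies in F is needed.
include hF in
theorem hasProjectiveDimensionLT_orbit (n : ℕ) (h : cd (restrictFamily F K) ≤ n) :
    HasProjectiveDimensionLT (freeMod.obj (homPresheaf F (G ⧸ K))) (n + 1) :=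
  hasProjectiveDimensionLT_freeMod _ n <|
    hasProjectiveDimensionLT_constZ_of_isEquivalence (orbitToElements hF K) n
      ((cd_le_iff _ _).1 h)

include hF in
theorem hasProjectiveDimensionLT_homPresheaf (X : Type u) [MulAction G X] (n : ℕ)
    (h : ∀ x : X, cd (restrictFamily F (MulAction.stabilizer G x)) ≤ n) :
    HasProjectiveDimensionLT (freeMod.obj (homPresheaf F X)) (n + 1) :=
  hasProjectiveDimensionLT_homPresheaf_of_orbits F X n fun x =>
    hasProjectiveDimensionLT_orbit hF _ n (h x)

end Cd

end Bredon

namespace Bredon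
open Limits Opposite

/-! ### Restriction of Bredon modules along a group homomorphism. -/

section Restriction

variable {G Q : Type u} [Group G] [Group Q]

/-- A `Q`-set regarded as a `G`-set through a homomorphism `G →* Q`. -/
def Pulled (_ : G →* Q) (X : Type u) : Type u := X

instance (f : G →* Q) (X : Type u) [MulAction Q X] : MulAction G (Pulled f X) :=
  MulAction.compHom (M := Q) X f

theorem stabilizer_pulled (f : G →* Q) {X : Type u} [MulAction Q X] (x : X) :
    MulAction.stabilizer G (show Pulled f X from x) = (MulAction.stabilizer Q x).comap f := rfl

/-- The map of orbits `G ⧸ L ⟶ Q ⧸ f L` induced by a homomorphism `f`. -/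
def mapOrbit (f : G →* Q) (L : Subgroup G) : G ⧸ L →[G] Pulled f (Q ⧸ L.map f) :=
  ofFixed L (show Pulled f (Q ⧸ L.map f) from ((1 : Q) : Q ⧸ L.map f)) fun l hl =>
    smul_one_quotient (L := L.map f) ⟨l, hl, rfl⟩

theorem mapOrbit_one (f : G →* Q) (L : Subgroup G) :
    mapOrbit f L ((1 : G) : G ⧸ L) = ((1 : Q) : Q ⧸ L.map f) :=
  ofFixed_one L _ _

/-- An equivariant map, regarded as equivariant through a homomorphism. -/
def pulledHom (f : G →* Q) {X Y : Type u} [MulAction Q X] [MulAction Q Y] (φ : X →[Q] Y) :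
    Pulled f X →[G] Pulled f Y where
  toFun := φ
  map_smul' g x := φ.map_smul' (f g) (show X from x)

/-- The adjoint of an equivariant map to a restricted `Q`-set. -/
def transposeHom (f : G →* Q) {L : Subgroup G} {X : Type u} [MulAction Q X]
    (ψ : G ⧸ L →[G] Pulled f X) : Q ⧸ L.map f →[Q] X :=
  ofFixed _ (show X from ψ ((1 : G) : G ⧸ L)) (by
    rintro _ ⟨l, hl, rfl⟩
    exact smul_hom_one ψ hl)

theorem transposeHom_one (f : G →* Q) {L : Subgroup G} {X : Type u} [MulAction Q X]
    (ψ : G ⧸ L →[G] Pulled f X) :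
    transposeHom f ψ ((1 : Q) : Q ⧸ L.map f) = ψ ((1 : G) : G ⧸ L) :=
  ofFixed_one _ _ _

theorem pulledHom_transposeHom (f : G →* Q) {L : Subgroup G} {X : Type u} [MulAction Q X]
    (ψ : G ⧸ L →[G] Pulled f X) :
    MulActionHom.comp (pulledHom f (transposeHom f ψ)) (mapOrbit f L) = ψ :=
  quotient_hom_ext ((congrArg (transposeHom f ψ) (mapOrbit_one f L)).trans (transposeHom_one f ψ))

theorem pulledHom_mapOrbit_injective (f : G →* Q) {L : Subgroup G} {X : Type u} [MulAction Q X]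
    {φ ψ : Q ⧸ L.map f →[Q] X}
    (h : MulActionHom.comp (pulledHom f φ) (mapOrbit f L) =
      MulActionHom.comp (pulledHom f ψ) (mapOrbit f L)) : φ = ψ := by
  have h1 : φ (mapOrbit f L ((1 : G) : G ⧸ L)) = ψ (mapOrbit f L ((1 : G) : G ⧸ L)) :=
    congrArg (fun k => k ((1 : G) : G ⧸ L)) h
  exact quotient_hom_ext ((congrArg φ (mapOrbit_one f L)).symm.trans
    (h1.trans (congrArg ψ (mapOrbit_one f L))))

/-- The map of `Q`-orbits induced by a map of `G`-orbits. -/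
def pushHom (f : G →* Q) {L M : Subgroup G} (φ : G ⧸ L →[G] G ⧸ M) :
    Q ⧸ L.map f →[Q] Q ⧸ M.map f :=
  transposeHom f (MulActionHom.comp (mapOrbit f M) φ)

theorem pulledHom_pushHom (f : G →* Q) {L M : Subgroup G} (φ : G ⧸ L →[G] G ⧸ M) :
    MulActionHom.comp (pulledHom f (pushHom f φ)) (mapOrbit f L) =
      MulActionHom.comp (mapOrbit f M) φ :=
  pulledHom_transposeHom f _

theorem pulledHom_pushHom_apply (f : G →* Q) {L M : Subgroup G} (φ : G ⧸ L →[G] G ⧸ M)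
    (x : G ⧸ L) : pushHom f φ (mapOrbit f L x) = mapOrbit f M (φ x) :=
  congrArg (fun k => k x) (pulledHom_pushHom f φ)

theorem pushHom_id (f : G →* Q) (L : Subgroup G) :
    pushHom f (MulActionHom.id G : G ⧸ L →[G] G ⧸ L) = MulActionHom.id Q :=
  pulledHom_mapOrbit_injective f (pulledHom_pushHom f _)

theorem pushHom_comp (f : G →* Q) {L M N : Subgroup G} (φ : G ⧸ L →[G] G ⧸ M)
    (ψ : G ⧸ M →[G] G ⧸ N) :
    pushHom f (MulActionHom.comp ψ φ) = MulActionHom.comp (pushHom f ψ) (pushHom f φ) := by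
  refine pulledHom_mapOrbit_injective f (MulActionHom.ext fun x => ?_)
  exact (pulledHom_pushHom_apply f _ x).trans <| Eq.symm <|
    (congrArg (pushHom f ψ) (pulledHom_pushHom_apply f φ x)).trans (pulledHom_pushHom_apply f ψ _)

variable {𝔊 : Set (Subgroup G)} {F : Set (Subgroup Q)} (f : G →* Q)
  (hf : ∀ L ∈ 𝔊, L.map f ∈ F)

/-- The functor of orbit categories induced by a homomorphism. -/
def pushFunctor : OrbitCategory 𝔊 ⥤ OrbitCategory F where
  obj c := ⟨c.subgroup.map f, hf _ c.mem⟩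
  map φ := ofEquivariant (pushHom f (toEquivariant φ))
  map_id c := pushHom_id f c.subgroup
  map_comp φ ψ := pushHom_comp f (toEquivariant φ) (toEquivariant ψ)

/-- The restriction of a fixed point presheaf along a homomorphism. -/
def restrictedPresheaf (c : (OrbitCategory F)ᵒᵖ) :
    (pushFunctor f hf).op ⋙ coyoneda.obj (op c) ⟶
      homPresheaf 𝔊 (Pulled f (Q ⧸ c.unop.subgroup)) where
  app d := ↾fun φ => MulActionHom.comp
    (pulledHom f (toEquivariant (Quiver.Hom.unop φ))) (mapOrbit f d.unop.subgroup)
  naturality d d' φ := by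
    ext ψ
    refine MulActionHom.ext fun x => ?_
    exact congrArg (toEquivariant (Quiver.Hom.unop ψ))
      (pulledHom_pushHom_apply f (toEquivariant φ.unop) x)

/-- Both sides are the points of Q/K fixed by f(L): Q-maps from Q/f(L) on the left, G-maps from G/L
to the pulled back set on the right. -/
theorem restrictedPresheaf_bijective (c : (OrbitCategory F)ᵒᵖ) (d : (OrbitCategory 𝔊)ᵒᵖ) :
    Function.Bijective ((restrictedPresheaf f hf c).app d) := by
  refine ⟨fun φ ψ h => ?_, fun ψ => ?_⟩
  · exact Quiver.Hom.unop_inj (pulledHom_mapOrbit_injective (X := Q ⧸ c.unop.subgroup) f h)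
  · exact ⟨Quiver.Hom.op (ofEquivariant (F := F) (c := ((pushFunctor f hf).op.obj d).unop)
      (transposeHom f ψ)), pulledHom_transposeHom f ψ⟩

theorem stabilizer_mk_eq (K : Subgroup Q) (q : Q) :
    MulAction.stabilizer Q (q : Q ⧸ K) = K.map (MulAut.conj q).toMonoidHom := by
  ext x
  rw [MulAction.mem_stabilizer_iff, MulAction.Quotient.smul_coe, smul_eq_mul]
  constructor
  · intro h
    have := QuotientGroup.eq.1 h.symm
    exact ⟨_, this, by simp [mul_assoc]⟩
  · rintro ⟨k, hk, rfl⟩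
    refine (QuotientGroup.eq.2 ?_).symm
    simpa [mul_assoc] using hk

-- A projective is a retract of a sum of representables. The restriction of a representable is the
-- free module on Q/K as a G-set, and its stabilisers are preimages of conjugates of K, which again
-- lie in F.
include hf in
theorem hasProjectiveDimensionLT_restriction (h𝔊 : IsFullFamily 𝔊) (hF : IsFamily F) (k : ℕ)
    (h : ∀ K ∈ F, cd (restrictFamily 𝔊 (K.comap f)) ≤ k) (P : RightModule F) (hP : Projective P) :
    HasProjectiveDimensionLT ((pushFunctor f hf).op ⋙ P) (k + 1) := by
  let Ψ := (Functor.whiskeringLeft _ _ (ModuleCat.{u} ℤ)).obj (pushFunctor f hf).op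
  have h1 : HasProjectiveDimensionLT (Ψ.obj (freeMod.obj (coverFunctor P))) (k + 1) := by
    refine hasProjectiveDimensionLT_freeMod_sigma (fun p : coverIndex P =>
      (pushFunctor f hf).op ⋙ coyoneda.obj (op p.1)) k fun p => ?_
    have := isIso_of_bijective _ (restrictedPresheaf_bijective f hf p.1)
    have h2 : HasProjectiveDimensionLT (freeMod.obj
        (homPresheaf 𝔊 (Pulled f (Q ⧸ p.1.unop.subgroup)))) (k + 1) := by
      refine hasProjectiveDimensionLT_homPresheaf h𝔊 _ k fun x => ?_
      obtain ⟨q, rfl⟩ := QuotientGroup.mk_surjective (show Q ⧸ p.1.unop.subgroup from x)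
      rw [stabilizer_pulled, stabilizer_mk_eq]
      exact h _ (hF.conj_mem _ p.1.unop.mem q)
    exact hasProjectiveDimensionLT_of_iso (freeMod.mapIso
      (asIso (restrictedPresheaf f hf p.1))).symm _
  -- Restriction is a functor, so it preserves the retract.
  exact ((retractCover P).map Ψ).hasProjectiveDimensionLT _

include hf in
/-- A bound for the Bredon dimension of a group from a homomorphism to another group. -/
theorem cd_le_of_hom (h𝔊 : IsFullFamily 𝔊) (hF : IsFamily F) (n k : ℕ)
    (h : ∀ K ∈ F, cd (restrictFamily 𝔊 (K.comap f)) ≤ k) (hn : cd F ≤ n) :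
    cd 𝔊 ≤ (n + k : ℕ) := by
  let Ψ := (Functor.whiskeringLeft _ _ (ModuleCat.{u} ℤ)).obj (pushFunctor f hf).op
  have : Ψ.Additive := ⟨rfl⟩
  exact (cd_le_iff _ _).2 (hasProjectiveDimensionLT_map Ψ k
    (hasProjectiveDimensionLT_restriction f hf h𝔊 hF k h) n _ ((cd_le_iff _ _).1 hn))

end Restriction

section Terminal

variable {D : Type u} [SmallCategory D]

/-- The free module on a functor with one-point values is the constant module. -/
noncomputable def freeModUniqueIso (S : D ⥤ Type u) (s : ∀ d, S.obj d)
    (h : ∀ d (x : S.obj d), x = s d) : freeMod.obj S ≅ constZ D where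
  hom := freeModDesc (fun _ _ => ULift.up.{u} (1 : ℤ)) fun _ _ => rfl
  inv :=
    { app := fun d => ofElement (freeMk (s d))
      naturality := fun d d' f => ulift_hom_ext (by
        change ofElement (freeMk (s d')) (ULift.up.{u} (1 : ℤ)) =
          (freeMod.obj S).map f (ofElement (freeMk (s d)) (ULift.up.{u} (1 : ℤ)))
        rw [ofElement_one, ofElement_one]
        exact ((freeZ_map_apply _ _).trans (congrArg freeMk (h _ _))).symm) }
  hom_inv_id := freeMod_hom_ext fun d x => by
    rw [NatTrans.comp_app, ModuleCat.comp_apply]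
    refine (congrArg (ofElement (freeMk (s d))) (freeModDesc_app _ _ d x)).trans ?_
    rw [ofElement_one, h d x]
    rfl
  inv_hom_id := by
    ext d : 2
    refine ulift_hom_ext ?_
    rw [NatTrans.comp_app, ModuleCat.comp_apply]
    refine (congrArg _ (ofElement_one _)).trans ?_
    exact freeModDesc_app _ _ d _

end Terminal

/-! ### Families with a largest member, and invariance under isomorphism. -/

section Families

variable {G : Type u} [Group G] {F : Set (Subgroup G)}

theorem IsFullFamily.restrictFamily_iff (hF : IsFullFamily F) {K : Subgroup G} {L : Subgroup K} :
    L ∈ restrictFamily F K ↔ L.map K.subtype ∈ F := by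
  constructor
  · exact map_mem_of_mem_restrictFamily hF K
  · exact fun h => ⟨_, h, (Subgroup.comap_map_eq_self_of_injective K.subtype_injective L).symm⟩

theorem IsFullFamily.restrict (hF : IsFullFamily F) (K : Subgroup G) :
    IsFullFamily (restrictFamily F K) where
  nonempty := by
    obtain ⟨H, hH⟩ := hF.nonempty
    exact ⟨_, H, hH, rfl⟩
  conj_mem L hL g := by
    rw [hF.restrictFamily_iff] at hL ⊢
    have := hF.conj_mem _ hL g
    rw [Subgroup.map_map] at this ⊢
    exact this
  mem_of_le L hL M hM := by
    rw [hF.restrictFamily_iff] at hL ⊢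
    exact hF.mem_of_le _ hL _ (Subgroup.map_mono hM)

/-- The orbit G/G is terminal in the orbit category, so the constant module is the free module on a
representable functor. -/
theorem cd_eq_zero_of_top_mem (hF : ⊤ ∈ F) : cd F = 0 := by
  let c : (OrbitCategory F)ᵒᵖ := op ⟨⊤, hF⟩
  have hsub : ∀ x y : G ⧸ (⊤ : Subgroup G), x = y :=
    fun x y => (QuotientGroup.subsingleton_quotient_top (G := G)).elim x y
  have hc : ∀ d : (OrbitCategory F)ᵒᵖ, ∀ x y : G ⧸ d.unop.subgroup →[G] G ⧸ (⊤ : Subgroup G),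
      x = y := fun _ _ _ => MulActionHom.ext fun _ => hsub _ _
  have e := freeModUniqueIso (coyoneda.obj (op c))
    (fun d => Quiver.Hom.op (ofEquivariant (c := d.unop) (d := ⟨⊤, hF⟩)
      (ofFixed _ ((1 : G) : G ⧸ (⊤ : Subgroup G)) fun _ _ => hsub _ _)))
    fun d x => Quiver.Hom.unop_inj (hc d _ _)
  have h1 : Projective (constZ (OrbitCategory F)ᵒᵖ) := Projective.of_iso e inferInstance
  exact nonpos_iff_eq_zero.1 ((cd_le_iff F 0).2 (projective_iff_hasProjectiveDimensionLT_one.1 h1))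

/-- `cd_le_of_hom` with k = 0: the preimage of a member of F' is in F, so the family restricted to
it contains the whole group. -/
theorem cd_le_of_mulEquiv {G' : Type u} [Group G'] {F' : Set (Subgroup G')} (hF : IsFullFamily F)
    (hF' : IsFullFamily F') (e : G ≃* G') (h : ∀ L, L ∈ F ↔ L.map e.toMonoidHom ∈ F') (n : ℕ)
    (hn : cd F' ≤ n) : cd F ≤ n := by
  refine cd_le_of_hom (k := 0) e.toMonoidHom (fun L => (h L).1) hF hF'.toIsFamily n
    (fun K hK => ?_) hn
  have hK' : K.comap e.toMonoidHom ∈ F := by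
    rw [h, Subgroup.map_comap_eq_self_of_surjective e.surjective]
    exact hK
  exact (cd_eq_zero_of_top_mem (F := restrictFamily F (K.comap e.toMonoidHom))
    ⟨_, hK', (Subgroup.subgroupOf_self _).symm⟩).le

end Families

/-! ### The bound for a direct product with general families. -/

section Products

variable {G₁ G₂ : Type u} [Group G₁] [Group G₂] {F₁ : Set (Subgroup G₁)} {F₂ : Set (Subgroup G₂)}
  {𝔊 : Set (Subgroup (G₁ × G₂))}

theorem prod_mem_of_subset_completion (h𝔊 : 𝔊 ⊆ completion (prodFamily F₁ F₂))
    {L : Subgroup (G₁ × G₂)} (hL : L ∈ 𝔊) : ∃ H₁ ∈ F₁, ∃ H₂ ∈ F₂, L ≤ H₁.prod H₂ := by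
  obtain ⟨_, ⟨H₁, h₁, H₂, h₂, rfl⟩, hle⟩ := h𝔊 hL
  exact ⟨H₁, h₁, H₂, h₂, hle⟩

theorem restrictFamily_restrictFamily_iff {G : Type u} [Group G] {F : Set (Subgroup G)}
    (hF : IsFullFamily F) {A B : Subgroup G} {C : Subgroup A}
    (e : C ≃* B) (he : ∀ c, ((e c : B) : G) = ((c : A) : G)) (L : Subgroup C) :
    L ∈ restrictFamily (restrictFamily F A) C ↔ L.map e.toMonoidHom ∈ restrictFamily F B := by
  rw [(hF.restrict A).restrictFamily_iff, hF.restrictFamily_iff, hF.restrictFamily_iff,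
    Subgroup.map_map, Subgroup.map_map]
  have : A.subtype.comp C.subtype = B.subtype.comp e.toMonoidHom :=
    MonoidHom.ext fun c => (he c).symm
  rw [this]

/-- The bound for the Bredon dimension of a direct product. -/
theorem cd_prod_le (hF₁ : IsFullFamily F₁) (hF₂ : IsFullFamily F₂) (hG : IsFullFamily 𝔊)
    (h𝔊 : 𝔊 ⊆ completion (prodFamily F₁ F₂)) (n₁ n₂ k : ℕ)
    (hk : ∀ K ∈ prodFamily F₁ F₂, cd (restrictFamily 𝔊 K) ≤ k)
    (h₁ : cd F₁ ≤ n₁) (h₂ : cd F₂ ≤ n₂) : cd 𝔊 ≤ (n₁ + n₂ + k : ℕ) := by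
  -- The first projection contributes n₁ and leaves n₂ + k for its fibres, the subgroups K₁ × G₂.
  rw [add_assoc]
  refine cd_le_of_hom (MonoidHom.fst G₁ G₂) (fun L hL => ?_) hG hF₁.toIsFamily n₁ (n₂ + k)
    (fun K₁ hK₁ => ?_) h₁
  · obtain ⟨H₁, h₁, H₂, h₂, hle⟩ := prod_mem_of_subset_completion h𝔊 hL
    refine hF₁.mem_of_le H₁ h₁ _ ?_
    rintro _ ⟨x, hx, rfl⟩
    exact (Subgroup.mem_prod.1 (hle hx)).1
  -- `A` is K₁ × G₂; the second projection is applied to it with bound n₂, and its fibres are the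
  -- subgroups K₁ × K₂.
  let A : Subgroup (G₁ × G₂) := K₁.comap (MonoidHom.fst G₁ G₂)
  refine cd_le_of_hom ((MonoidHom.snd G₁ G₂).comp A.subtype) (fun L hL => ?_) (hG.restrict A)
    hF₂.toIsFamily n₂ k (fun K₂ hK₂ => ?_) h₂
  · rw [hG.restrictFamily_iff] at hL
    obtain ⟨H₁, h₁, H₂, h₂, hle⟩ := prod_mem_of_subset_completion h𝔊 hL
    refine hF₂.mem_of_le H₂ h₂ _ ?_
    rintro _ ⟨x, hx, rfl⟩
    exact (Subgroup.mem_prod.1 (hle ⟨x, hx, rfl⟩)).2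
  let C : Subgroup A := K₂.comap ((MonoidHom.snd G₁ G₂).comp A.subtype)
  have hC : C.map A.subtype = K₁.prod K₂ := by
    ext x
    rw [Subgroup.mem_prod]
    constructor
    · rintro ⟨a, ha, rfl⟩
      exact ⟨a.2, ha⟩
    · rintro ⟨hx1, hx2⟩
      exact ⟨⟨x, hx1⟩, hx2, rfl⟩
  -- K₁ × K₂ occurs here as a subgroup of the subgroup `A`, while `hk` speaks of it as a subgroup of
  -- G₁ × G₂.
  let e : C ≃* K₁.prod K₂ :=
    (C.equivMapOfInjective A.subtype A.subtype_injective).trans (MulEquiv.subgroupCongr hC)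
  exact cd_le_of_mulEquiv ((hG.restrict A).restrict C) (hG.restrict _) e
    (restrictFamily_restrictFamily_iff hG e fun _ => rfl) k (hk _ ⟨K₁, hK₁, K₂, hK₂, rfl⟩)

theorem cd_prod_le_add (hF₁ : IsFullFamily F₁) (hF₂ : IsFullFamily F₂) (hG : IsFullFamily 𝔊)
    (h𝔊 : 𝔊 ⊆ completion (prodFamily F₁ F₂)) (k : ℕ)
    (hk : ∀ K ∈ prodFamily F₁ F₂, cd (restrictFamily 𝔊 K) ≤ k) :
    cd 𝔊 ≤ cd F₁ + cd F₂ + k := by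
  rcases eq_or_ne (cd F₁) ⊤ with h₁ | h₁
  · simp [h₁]
  rcases eq_or_ne (cd F₂) ⊤ with h₂ | h₂
  · simp [h₂]
  obtain ⟨n₁, hn₁⟩ := ENat.ne_top_iff_exists.1 h₁
  obtain ⟨n₂, hn₂⟩ := ENat.ne_top_iff_exists.1 h₂
  rw [← hn₁, ← hn₂]
  exact_mod_cast cd_prod_le hF₁ hF₂ hG h𝔊 n₁ n₂ k hk hn₁.ge hn₂.ge

end Products

end Bredon

namespace Bredon

/-! ### Permanence properties of virtually cyclic groups. -/

section VirtuallyCyclic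

theorem IsVirtuallyCyclic.of_injective {G H : Type u} [Group G] [Group H]
    (hH : IsVirtuallyCyclic H) (f : G →* H) (hf : Function.Injective f) : IsVirtuallyCyclic G := by
  obtain ⟨C, hC, hfin⟩ := hH
  refine ⟨C.comap f, isCyclic_of_injective ((f.comp (C.comap f).subtype).codRestrict C fun x => x.2)
    fun x y h => Subtype.ext (hf (congrArg Subtype.val h)), ⟨?_⟩⟩
  rw [Subgroup.index_comap]
  exact fun h => hfin.index_ne_zero (Subgroup.index_eq_zero_of_relIndex_eq_zero h)

theorem IsVirtuallyCyclic.of_surjective {G H : Type u} [Group G] [Group H]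
    (hG : IsVirtuallyCyclic G) (f : G →* H) (hf : Function.Surjective f) :
    IsVirtuallyCyclic H := by
  obtain ⟨C, hC, hfin⟩ := hG
  refine ⟨C.map f, isCyclic_of_surjective _ (f.subgroupMap_surjective C), ⟨?_⟩⟩
  exact fun h => hfin.index_ne_zero (Nat.eq_zero_of_zero_dvd (h ▸ C.index_map_dvd hf))

theorem IsVirtuallyCyclic.of_finiteIndex {G : Type u} [Group G] (T : Subgroup G)
    (hT : T.FiniteIndex) (h : IsVirtuallyCyclic T) : IsVirtuallyCyclic G := by
  obtain ⟨C, hC, hfin⟩ := h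
  refine ⟨C.map T.subtype, isCyclic_of_surjective _ (T.subtype.subgroupMap_surjective C), ⟨?_⟩⟩
  rw [Subgroup.index_map_subtype]
  exact mul_ne_zero hfin.index_ne_zero hT.index_ne_zero

theorem isVirtuallyCyclic_of_finite (G : Type u) [Group G] [Finite G] : IsVirtuallyCyclic G :=
  ⟨⊥, inferInstance, inferInstance⟩

theorem isVirtuallyCyclic_of_isCyclic (G : Type u) [Group G] [hG : IsCyclic G] :
    IsVirtuallyCyclic G :=
  ⟨⊤, inferInstance, inferInstance⟩

theorem isVirtuallyCyclic_of_hom {G : Type u} [Group G] (f : G →* Multiplicative ℤ)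
    (hf : Finite f.ker) : IsVirtuallyCyclic G := by
  -- `c` lifts a generator of the image, so every coset of its powers meets the finite kernel.
  obtain ⟨⟨_, c, rfl⟩, hx⟩ := IsCyclic.exists_generator (α := f.range)
  refine ⟨Subgroup.zpowers c, inferInstance, ?_⟩
  rw [Subgroup.finiteIndex_iff_finite_quotient]
  refine Finite.of_surjective (fun k : f.ker => ((k : G) : G ⧸ Subgroup.zpowers c)) fun y => ?_
  obtain ⟨g, rfl⟩ := QuotientGroup.mk_surjective y
  obtain ⟨n, hn⟩ := Subgroup.mem_zpowers_iff.1 (hx ⟨f g, g, rfl⟩)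
  have hn' : f c ^ n = f g := congrArg Subtype.val hn
  refine ⟨⟨g * (c ^ n)⁻¹, ?_⟩, ?_⟩
  · rw [MonoidHom.mem_ker, map_mul, map_inv, map_zpow, hn', mul_inv_cancel]
  · refine QuotientGroup.eq.2 ?_
    simp

theorem mem_vcFamily_of_le {G : Type u} [Group G] {H K : Subgroup G} (h : K ≤ H)
    (hH : H ∈ vcFamily G) : K ∈ vcFamily G :=
  IsVirtuallyCyclic.of_injective hH (Subgroup.inclusion h) (Subgroup.inclusion_injective h)

theorem map_mem_vcFamily {G H : Type u} [Group G] [Group H] (f : G →* H) {L : Subgroup G}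
    (hL : L ∈ vcFamily G) : L.map f ∈ vcFamily H :=
  IsVirtuallyCyclic.of_surjective hL (f.subgroupMap L) (f.subgroupMap_surjective L)

theorem mem_vcFamily_of_map {G H : Type u} [Group G] [Group H] (f : G →* H)
    (hf : Function.Injective f) {L : Subgroup G} (hL : L.map f ∈ vcFamily H) : L ∈ vcFamily G :=
  IsVirtuallyCyclic.of_injective hL (f.subgroupMap L) fun _ _ h =>
    Subtype.ext (hf (congrArg Subtype.val h))

theorem isFullFamily_vcFamily (G : Type u) [Group G] : IsFullFamily (vcFamily G) where
  nonempty := ⟨⊥, isVirtuallyCyclic_of_finite _⟩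
  conj_mem _ hH _ := map_mem_vcFamily _ hH
  mem_of_le _ hH _ h := mem_vcFamily_of_le h hH

theorem restrictFamily_vcFamily {G : Type u} [Group G] (K : Subgroup G) :
    restrictFamily (vcFamily G) K = vcFamily K := by
  ext L
  rw [(isFullFamily_vcFamily G).restrictFamily_iff]
  exact ⟨mem_vcFamily_of_map _ K.subtype_injective, map_mem_vcFamily _⟩

/-- A subgroup lies in the product of its two projections, which are quotients of it. -/
theorem vcFamily_prod_subset (G₁ G₂ : Type u) [Group G₁] [Group G₂] :
    vcFamily (G₁ × G₂) ⊆ completion (prodFamily (vcFamily G₁) (vcFamily G₂)) := fun _ hL =>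
  ⟨_, ⟨_, map_mem_vcFamily (MonoidHom.fst G₁ G₂) hL, _, map_mem_vcFamily (MonoidHom.snd G₁ G₂) hL,
    rfl⟩, fun x hx => ⟨⟨x, hx, rfl⟩, ⟨x, hx, rfl⟩⟩⟩

end VirtuallyCyclic

/-! ### Actions of virtually cyclic groups on a line. -/

section Lines

/-- An action of a group on the integers by affine transformations
`x ↦ sign g * x + 4 * shift g`. -/
structure LineData (G : Type*) [Group G] where
  sign : G →* ℤˣ
  shift : G → ℤ
  shift_mul : ∀ g h, shift (g * h) = shift g + sign g * shift h

namespace LineData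

variable {G : Type*} [Group G] (ℓ : LineData G)

theorem shift_one : ℓ.shift 1 = 0 := by
  have h := ℓ.shift_mul 1 1
  rw [mul_one, map_one] at h
  simpa using h

theorem shift_mul_of_sign {g : G} (h : G) (hg : ℓ.sign g = 1) :
    ℓ.shift (g * h) = ℓ.shift g + ℓ.shift h := by
  rw [ℓ.shift_mul, hg, Units.val_one, one_mul]

/-- The subgroup that acts trivially. -/
def ker : Subgroup G where
  carrier := {g | ℓ.sign g = 1 ∧ ℓ.shift g = 0}
  one_mem' := ⟨map_one _, ℓ.shift_one⟩
  mul_mem' := fun ⟨h1, h2⟩ ⟨h3, h4⟩ => ⟨by rw [map_mul, h1, h3, one_mul], by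
    rw [ℓ.shift_mul, h2, h4, mul_zero, add_zero]⟩
  inv_mem' := fun {g} ⟨h1, h2⟩ => ⟨by rw [map_inv, h1, inv_one], by
    have h := ℓ.shift_mul_of_sign g⁻¹ h1
    rw [mul_inv_cancel, ℓ.shift_one, h2, zero_add] at h
    exact h.symm⟩

theorem mem_ker {g : G} : g ∈ ℓ.ker ↔ ℓ.sign g = 1 ∧ ℓ.shift g = 0 := Iff.rfl

/-- The shift, on the subgroup that preserves the orientation. -/
def shiftHom : ℓ.sign.ker →* Multiplicative ℤ where
  toFun g := Multiplicative.ofAdd (ℓ.shift g)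
  map_one' := congrArg Multiplicative.ofAdd ℓ.shift_one
  map_mul' g _ := congrArg Multiplicative.ofAdd (ℓ.shift_mul_of_sign _ g.2)

theorem shift_zpow {g : G} (hg : ℓ.sign g = 1) (n : ℤ) : ℓ.shift (g ^ n) = n * ℓ.shift g := by
  have h := congrArg Multiplicative.toAdd (map_zpow ℓ.shiftHom ⟨g, hg⟩ n)
  rw [toAdd_zpow, smul_eq_mul] at h
  exact h

theorem shift_conj (g : G) {x : G} (hx : ℓ.sign x = 1) :
    ℓ.shift (g * x * g⁻¹) = ℓ.sign g * ℓ.shift x := by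
  have h := ℓ.shift_mul g g⁻¹
  rw [mul_inv_cancel, ℓ.shift_one] at h
  rw [mul_assoc, ℓ.shift_mul, ℓ.shift_mul_of_sign _ hx]
  linarith

/-- Restriction along a homomorphism. -/
def comap {H : Type*} [Group H] (f : H →* G) : LineData H where
  sign := ℓ.sign.comp f
  shift h := ℓ.shift (f h)
  shift_mul g h := by rw [map_mul, ℓ.shift_mul]; rfl

end LineData

section Construction

variable {H : Type*} [Group H] (c : H)

open Classical in
/-- The exponent of a power of `c`. -/
noncomputable def exponent (x : H) : ℤ := if h : ∃ k : ℤ, c ^ k = x then h.choose else 0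

variable {c} (hc : Function.Injective fun n : ℤ => c ^ n)

include hc in
theorem exponent_zpow (n : ℤ) : exponent c (c ^ n) = n := by
  have h : ∃ k : ℤ, c ^ k = c ^ n := ⟨n, rfl⟩
  rw [exponent, dif_pos h]
  exact hc h.choose_spec

theorem zpow_exponent {x : H} (hx : x ∈ Subgroup.zpowers c) : c ^ exponent c x = x := by
  have h : ∃ k : ℤ, c ^ k = x := Subgroup.mem_zpowers_iff.1 hx
  rw [exponent, dif_pos h]
  exact h.choose_spec

include hc in
theorem exponent_mul {x y : H} (hx : x ∈ Subgroup.zpowers c) (hy : y ∈ Subgroup.zpowers c) :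
    exponent c (x * y) = exponent c x + exponent c y := by
  conv_lhs => rw [← zpow_exponent hx, ← zpow_exponent hy, ← zpow_add]
  exact exponent_zpow hc _

variable [hN : (Subgroup.zpowers c).Normal]

include hN in
theorem conj_zpow_mem (g : H) : g * c * g⁻¹ ∈ Subgroup.zpowers c :=
  hN.conj_mem c (Subgroup.mem_zpowers c) g

include hc in
theorem exponent_conj (g : H) {x : H} (hx : x ∈ Subgroup.zpowers c) :
    exponent c (g * x * g⁻¹) = exponent c (g * c * g⁻¹) * exponent c x := by
  conv_lhs => rw [← zpow_exponent hx, ← conj_zpow, ← zpow_exponent (conj_zpow_mem (c := c) g),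
    ← zpow_mul]
  exact exponent_zpow hc _

/-- The conjugation action on an infinite cyclic normal subgroup. -/
noncomputable def conjSign : H →* ℤˣ :=
  MonoidHom.toHomUnits
    { toFun := fun g => exponent c (g * c * g⁻¹)
      map_one' := by
        have h := exponent_zpow hc 1
        simpa using h
      map_mul' := fun g h => by
        rw [← exponent_conj hc g (conj_zpow_mem h)]
        congr 1
        group }

theorem conjSign_val (g : H) : ((conjSign hc g : ℤˣ) : ℤ) = exponent c (g * c * g⁻¹) := rfl

theorem conjSign_of_mem {x : H} (hx : x ∈ Subgroup.zpowers c) : conjSign hc x = 1 := by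
  obtain ⟨n, rfl⟩ := Subgroup.mem_zpowers_iff.1 hx
  refine Units.ext ?_
  rw [conjSign_val]
  have h := exponent_zpow hc 1
  rw [zpow_one] at h
  rw [((Commute.refl c).zpow_left n).eq, mul_assoc, mul_inv_cancel, mul_one, h, Units.val_one]

/-- The cocycle of exponents with respect to the chosen coset representatives. -/
noncomputable def cosetShift (g : H) (q : H ⧸ Subgroup.zpowers c) : ℤ :=
  exponent c ((g • q).out⁻¹ * (g * q.out))

omit hN in
theorem coset_mem (g : H) (q : H ⧸ Subgroup.zpowers c) :
    (g • q).out⁻¹ * (g * q.out) ∈ Subgroup.zpowers c := by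
  refine QuotientGroup.eq.1 ?_
  rw [QuotientGroup.out_eq']
  conv_lhs => rw [← QuotientGroup.out_eq' q]
  rfl

omit hN in
include hc in
theorem cosetShift_mul (g h : H) (q : H ⧸ Subgroup.zpowers c) :
    cosetShift (g * h) q = cosetShift g (h • q) + cosetShift h q := by
  rw [cosetShift, cosetShift, cosetShift, ← exponent_mul hc (coset_mem g _) (coset_mem h q),
    mul_smul]
  congr 1
  group

theorem conjSign_out (g : H) (q : H ⧸ Subgroup.zpowers c) :
    conjSign hc (g • q).out = conjSign hc g * conjSign hc q.out := by
  have h := conjSign_of_mem hc (coset_mem g q)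
  rw [map_mul, map_inv, inv_mul_eq_one, map_mul] at h
  exact h

theorem cosetShift_self (q : H ⧸ Subgroup.zpowers c) :
    cosetShift c q = conjSign hc q.out := by
  have hq : c • q = q := by
    conv_lhs => rw [← QuotientGroup.out_eq' q]
    conv_rhs => rw [← QuotientGroup.out_eq' q]
    refine (QuotientGroup.eq.2 ?_).symm
    have := conj_zpow_mem (c := c) q.out⁻¹
    simpa [mul_assoc] using this
  have h1 : ((conjSign hc q.out)⁻¹ : ℤˣ) = conjSign hc q.out := Int.units_inv_eq_self _
  rw [cosetShift, hq, ← h1, ← map_inv, conjSign_val]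
  congr 1
  group

/-- The action on a line of a group with an infinite cyclic normal subgroup of finite index. -/
noncomputable def cosetLineData [Fintype (H ⧸ Subgroup.zpowers c)] : LineData H where
  sign := conjSign hc
  -- A transfer to ⟨c⟩ in which each summand is weighted by the orientation of its coset
  -- representative; the weights produce the factor `sign g` of the cocycle rule.
  shift g := ∑ q : H ⧸ Subgroup.zpowers c, conjSign hc (g • q).out * cosetShift g q
  shift_mul g h := by
    have h1 : ∑ q : H ⧸ Subgroup.zpowers c, (conjSign hc (g • q).out : ℤ) * cosetShift g q =
        ∑ q : H ⧸ Subgroup.zpowers c,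
          (conjSign hc (g • (h • q)).out : ℤ) * cosetShift g (h • q) :=
      (Equiv.sum_comp (MulAction.toPerm h)
        fun q : H ⧸ Subgroup.zpowers c => (conjSign hc (g • q).out : ℤ) * cosetShift g q).symm
    rw [h1, Finset.mul_sum, ← Finset.sum_add_distrib]
    refine Finset.sum_congr rfl fun q _ => ?_
    rw [cosetShift_mul hc, mul_smul, conjSign_out hc g (h • q), Units.val_mul]
    ring

/-- Every summand of the shift of c is the square of a sign, so this shift is the index of ⟨c⟩ and
nonzero. Hence the kernel meets ⟨c⟩ trivially and injects into the finite set of cosets. -/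
theorem finite_ker_cosetLineData [Fintype (H ⧸ Subgroup.zpowers c)] :
    Finite (cosetLineData hc).ker := by
  refine Finite.of_injective (fun k : (cosetLineData hc).ker => ((k : H) : H ⧸ Subgroup.zpowers c))
    fun x y hxy => Subtype.ext ?_
  have hz : (x : H)⁻¹ * y ∈ (cosetLineData hc).ker := (x⁻¹ * y).2
  have hzc : (x : H)⁻¹ * y ∈ Subgroup.zpowers c := QuotientGroup.eq.1 hxy
  obtain ⟨n, hn⟩ := Subgroup.mem_zpowers_iff.1 hzc
  have h1 := ((cosetLineData hc).mem_ker.1 hz).2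
  have hcs : (cosetLineData hc).sign c = 1 := conjSign_of_mem hc (Subgroup.mem_zpowers c)
  have hcc : (cosetLineData hc).shift c = Fintype.card (H ⧸ Subgroup.zpowers c) := by
    change ∑ q : H ⧸ Subgroup.zpowers c, (conjSign hc (c • q).out : ℤ) * cosetShift c q = _
    rw [Finset.sum_congr rfl (g := fun _ => (1 : ℤ))]
    · simp
    · intro q _
      rw [conjSign_out, cosetShift_self hc, conjSign_of_mem hc (Subgroup.mem_zpowers c), one_mul]
      exact congrArg Units.val (Int.units_mul_self (conjSign hc q.out))
  have h2 : (cosetLineData hc).shift (c ^ n) = 0 := by rw [hn]; exact h1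
  rw [LineData.shift_zpow _ hcs, hcc, mul_eq_zero] at h2
  have h3 : n = 0 := h2.resolve_right (by exact_mod_cast Fintype.card_ne_zero)
  rw [h3, zpow_zero] at hn
  exact (inv_mul_eq_one.1 hn.symm)

end Construction

/-- A virtually cyclic group acts on a line with finite kernel. -/
theorem IsVirtuallyCyclic.exists_lineData {H : Type u} [Group H] (h : IsVirtuallyCyclic H) :
    ∃ ℓ : LineData H, Finite ℓ.ker := by
  by_cases hfin : Finite H
  -- A finite group may act trivially.
  · exact ⟨⟨1, 0, fun _ _ => by simp⟩, inferInstance⟩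
  obtain ⟨C, hC, hCfin⟩ := h
  -- Passing to the normal core gives a cyclic subgroup that is normal and still of finite index; it
  -- is infinite because H is.
  have : IsCyclic C.normalCore := isCyclic_of_injective (Subgroup.inclusion C.normalCore_le)
    (Subgroup.inclusion_injective _)
  obtain ⟨c, hcN⟩ := (Subgroup.isCyclic_iff_exists_zpowers_eq_top C.normalCore).1 this
  have hN : (Subgroup.zpowers c).Normal := hcN ▸ C.normalCore_normal
  have hI : (Subgroup.zpowers c).FiniteIndex := hcN ▸ inferInstance
  have hc : Function.Injective fun n : ℤ => c ^ n := by
    rw [injective_zpow_iff_not_isOfFinOrder, ← finite_zpowers]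
    intro hf
    have : Finite (Subgroup.zpowers c) := hf
    exact hfin ((Subgroup.finite_iff_finite_and_finiteIndex (Subgroup.zpowers c)).2 ⟨this, hI⟩)
  have := Fintype.ofFinite (H ⧸ Subgroup.zpowers c)
  exact ⟨_, finite_ker_cosetLineData hc⟩

end Lines

end Bredon

namespace Bredon
open Limits Opposite

/-! ### Forests and the short exact sequences of their chain complexes. -/

section Forest

/-- A graph with edges `E`, vertices `V`, and endpoint maps `s` and `t` is a forest, and `γ`
identifies its set of components with `T`. -/
structure IsForest {E V T : Type*} (s t : E → V) (γ : V → T) : Prop where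
  surjective : Function.Surjective γ
  comm : ∀ e, γ (s e) = γ (t e)
  connected : ∀ v w, γ v = γ w → ∃ x : E →₀ ℤ,
    x.mapDomain t - x.mapDomain s = Finsupp.single v 1 - Finsupp.single w 1
  cut : ∀ e, ∃ χ : V → ℤ, χ (t e) ≠ χ (s e) ∧ ∀ e', e' ≠ e → χ (t e') = χ (s e')

namespace IsForest

variable {E V T : Type*} {s t : E → V} {γ : V → T} (h : IsForest s t γ)

-- Pairing the boundary of x with the cut function of e kills every term except the coefficient of
-- e.
include h in
theorem eq_zero (x : E →₀ ℤ) (hx : x.mapDomain t - x.mapDomain s = 0) : x = 0 := by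
  ext e
  obtain ⟨χ, h1, h2⟩ := h.cut e
  have key : ∀ f : E → V, (x.mapDomain f).sum (fun v n => n * χ v) = x.sum fun e n => n * χ (f e) :=
    fun f => Finsupp.sum_mapDomain_index (fun _ => zero_mul _) fun _ _ _ => add_mul _ _ _
  have h3 : (x.sum fun e n => n * (χ (t e) - χ (s e))) = 0 := by
    simp only [mul_sub]
    rw [Finsupp.sum_sub, ← key, ← key, sub_eq_zero.1 hx, sub_self]
  rw [Finsupp.sum_eq_single e (fun e' _ he' => by rw [h2 e' he', sub_self, mul_zero])
    fun _ => zero_mul _] at h3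
  exact (mul_eq_zero.1 h3).resolve_right (sub_ne_zero.2 h1)

-- For a section σ of γ, each v − σ(γ v) is a boundary by connectedness. By linearity y and the
-- chain obtained from it through σ ∘ γ differ by a boundary, and the latter vanishes when y maps to
-- zero.
include h in
theorem exists_boundary (y : V →₀ ℤ) (hy : y.mapDomain γ = 0) :
    ∃ x : E →₀ ℤ, x.mapDomain t - x.mapDomain s = y := by
  obtain ⟨σ, hσ⟩ := h.surjective.hasRightInverse
  have key : ∀ y : V →₀ ℤ, ∃ x : E →₀ ℤ,
      x.mapDomain t - x.mapDomain s = y - (y.mapDomain γ).mapDomain σ := by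
    intro y
    induction y using Finsupp.induction_linear with
    | zero => exact ⟨0, by simp⟩
    | add y z hy hz =>
      obtain ⟨a, ha⟩ := hy
      obtain ⟨b, hb⟩ := hz
      refine ⟨a + b, ?_⟩
      rw [Finsupp.mapDomain_add, Finsupp.mapDomain_add, Finsupp.mapDomain_add,
        Finsupp.mapDomain_add, add_sub_add_comm, ha, hb, add_sub_add_comm]
    | single v n =>
      obtain ⟨a, ha⟩ := h.connected v (σ (γ v)) (hσ _).symm
      refine ⟨n • a, ?_⟩
      rw [Finsupp.mapDomain_smul, Finsupp.mapDomain_smul, ← smul_sub, ha, smul_sub,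
        Finsupp.mapDomain_single, Finsupp.mapDomain_single]
      simp
  obtain ⟨x, hx⟩ := key y
  exact ⟨x, by rw [hx, hy, Finsupp.mapDomain_zero, sub_zero]⟩

end IsForest

variable {D : Type u} [SmallCategory D] {E V T : D ⥤ Type u}

/-- The boundary map of a graph of functors. -/
noncomputable abbrev boundary (s t : E ⟶ V) : freeMod.obj E ⟶ freeMod.obj V :=
  freeMod.map t - freeMod.map s

theorem boundary_comp (s t : E ⟶ V) (γ : V ⟶ T) (h : s ≫ γ = t ≫ γ) :
    boundary s t ≫ freeMod.map γ = 0 := by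
  rw [Preadditive.sub_comp, ← Functor.map_comp, ← Functor.map_comp, h, sub_self]

/-- The complex of free modules of a graph of functors. -/
noncomputable abbrev forestComplex (s t : E ⟶ V) (γ : V ⟶ T) (h : s ≫ γ = t ≫ γ) :
    ShortComplex (D ⥤ ModuleCat.{u} ℤ) :=
  ShortComplex.mk _ _ (boundary_comp s t γ h)

theorem boundary_app (s t : E ⟶ V) (d : D) (x : E.obj d →₀ ℤ) :
    (boundary s t).app d x = (x.mapDomain (t.app d) - x.mapDomain (s.app d) : V.obj d →₀ ℤ) := rfl

theorem forestComplex_shortExact (s t : E ⟶ V) (γ : V ⟶ T)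
    (hf : ∀ d, IsForest (s.app d) (t.app d) (γ.app d)) (h : s ≫ γ = t ≫ γ) :
    (forestComplex s t γ h).ShortExact := by
  refine shortExact_of_evaluation _ fun d => ?_
  have hm : Mono ((boundary s t).app d) := by
    rw [ModuleCat.mono_iff_injective, injective_iff_map_eq_zero]
    exact fun x hx => (hf d).eq_zero x hx
  have he : Epi ((freeMod.map γ).app d) := by
    rw [ModuleCat.epi_iff_surjective]
    exact Finsupp.mapDomain_surjective (hf d).surjective
  exact
    { exact := by
        rw [ShortComplex.moduleCat_exact_iff]
        exact fun y hy => (hf d).exists_boundary y hy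
      mono_f := hm
      epi_g := he }

theorem comp_eq_of_isForest (s t : E ⟶ V) (γ : V ⟶ T)
    (hf : ∀ d, IsForest (s.app d) (t.app d) (γ.app d)) : s ≫ γ = t ≫ γ := by
  ext d x
  exact (hf d).comm x

theorem hasProjectiveDimensionLT_of_isForest (s t : E ⟶ V) (γ : V ⟶ T)
    (hf : ∀ d, IsForest (s.app d) (t.app d) (γ.app d)) (n : ℕ)
    (hE : HasProjectiveDimensionLT (freeMod.obj E) n)
    (hV : HasProjectiveDimensionLT (freeMod.obj V) (n + 1)) :
    HasProjectiveDimensionLT (freeMod.obj T) (n + 1) :=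
  (forestComplex_shortExact s t γ hf (comp_eq_of_isForest s t γ hf)).hasProjectiveDimensionLT_X₃
    n hE hV

end Forest

/-! ### Subfunctors cut out by a stable predicate. -/

section Subfunctors

variable {D : Type u} [SmallCategory D]

/-- The subfunctor of a `Type`-valued functor cut out by a stable predicate. -/
def subFunctor (S : D ⥤ Type u) (p : ∀ d, S.obj d → Prop)
    (hp : ∀ {d d' : D} (f : d ⟶ d') (s : S.obj d), p d s → p d' (S.map f s)) : D ⥤ Type u where
  obj d := { s : S.obj d // p d s }
  map f := ↾fun s => ⟨S.map f s.1, hp f _ s.2⟩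
  map_id d := by
    ext s
    exact congrArg (fun k => k s.1) (S.map_id d)
  map_comp f g := by
    ext s
    exact congrArg (fun k => k s.1) (S.map_comp f g)

/-- A natural transformation that respects stable predicates. -/
def subFunctorMap {S T : D ⥤ Type u} {p : ∀ d, S.obj d → Prop} {q : ∀ d, T.obj d → Prop}
    (hp : ∀ {d d' : D} (f : d ⟶ d') (s : S.obj d), p d s → p d' (S.map f s))
    (hq : ∀ {d d' : D} (f : d ⟶ d') (s : T.obj d), q d s → q d' (T.map f s))
    (α : S ⟶ T) (h : ∀ d s, p d s → q d (α.app d s)) :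
    subFunctor S p hp ⟶ subFunctor T q hq where
  app d := ↾fun s => ⟨α.app d s.1, h d _ s.2⟩
  naturality d d' f := by
    ext s
    exact Subtype.ext (congrArg (fun k => k s.1) (α.naturality f))

theorem hasProjectiveDimensionLT_subFunctor_iff {S : D ⥤ Type u} {p q : ∀ d, S.obj d → Prop}
    (hp : ∀ {d d' : D} (f : d ⟶ d') (s : S.obj d), p d s → p d' (S.map f s))
    (hq : ∀ {d d' : D} (f : d ⟶ d') (s : S.obj d), q d s → q d' (S.map f s))
    (h : ∀ d s, p d s ↔ q d s) (n : ℕ) :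
    HasProjectiveDimensionLT (freeMod.obj (subFunctor S p hp)) n ↔
      HasProjectiveDimensionLT (freeMod.obj (subFunctor S q hq)) n := by
  obtain rfl : p = q := by
    funext d s
    exact propext (h d s)
  rfl

theorem hasProjectiveDimensionLT_subFunctor_of_forall {S : D ⥤ Type u} {p : ∀ d, S.obj d → Prop}
    (hp : ∀ {d d' : D} (f : d ⟶ d') (s : S.obj d), p d s → p d' (S.map f s))
    (h : ∀ d s, p d s) (n : ℕ) (hS : HasProjectiveDimensionLT (freeMod.obj S) n) :
    HasProjectiveDimensionLT (freeMod.obj (subFunctor S p hp)) n :=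
  hasProjectiveDimensionLT_freeMod_of_bijective
    (T := subFunctor S p hp) { app := fun d => ↾fun s => ⟨s, h d s⟩ } (fun d => ⟨fun _ _ hst => congrArg Subtype.val hst,
      fun s => ⟨s.1, rfl⟩⟩) n hS

end Subfunctors

end Bredon

namespace Bredon
open Limits Opposite

/-! ### Bundles of lines over a G-set and the forests of their fixed points. -/

section LineBundles

/-- An equivariant bundle of lines over a `G`-set. -/
structure LineBundle (G B : Type u) [Group G] [MulAction G B] where
  sign : G → B → ℤˣ
  shift : G → B → ℤ
  sign_mul : ∀ g h b, sign (g * h) b = sign g (h • b) * sign h b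
  shift_mul : ∀ g h b, shift (g * h) b = shift g (h • b) + sign g (h • b) * shift h b

namespace LineBundle

variable {G B : Type u} [Group G] [MulAction G B] (ℓ : LineBundle G B)

theorem sign_one (b : B) : ℓ.sign 1 b = 1 := by
  have h := ℓ.sign_mul 1 1 b
  rw [mul_one, one_smul] at h
  exact left_eq_mul.1 h

theorem shift_one (b : B) : ℓ.shift 1 b = 0 := by
  have h := ℓ.shift_mul 1 1 b
  rw [mul_one, one_smul, sign_one] at h
  simpa using h

/-- The affine action on the fibres. -/
def act (g : G) (b : B) (v : ℤ) : ℤ := ℓ.sign g b * v + 4 * ℓ.shift g b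

theorem act_one (b : B) (v : ℤ) : ℓ.act 1 b v = v := by
  simp [act, sign_one, shift_one]

theorem act_mul (g h : G) (b : B) (v : ℤ) :
    ℓ.act (g * h) b v = ℓ.act g (h • b) (ℓ.act h b v) := by
  simp only [act, sign_mul, shift_mul, Units.val_mul]
  ring

theorem act_eq (g : G) (b : B) (v : ℤ) :
    ℓ.act g b v = v + 4 * ℓ.shift g b ∨ ℓ.act g b v = -v + 4 * ℓ.shift g b := by
  rcases Int.units_eq_one_or (ℓ.sign g b) with h | h <;> simp [act, h]

theorem act_mod_two (g : G) (b : B) (v : ℤ) : ℓ.act g b v % 2 = v % 2 := by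
  rcases ℓ.act_eq g b v with h | h <;> omega

/-- A reflection fixes only one point, so an affine map with two fixed points is the identity. -/
theorem act_eq_self {g : G} {b : B} {v w : ℤ} (hvw : v ≠ w) (hv : ℓ.act g b v = v)
    (hw : ℓ.act g b w = w) (x : ℤ) : ℓ.act g b x = x := by
  unfold act at hv hw ⊢
  rcases Int.units_eq_one_or (ℓ.sign g b) with h | h <;>
    simp only [h, Units.val_neg, Units.val_one] at hv hw ⊢ <;> omega

/-- The integral points of given parity in the fibres. -/
def Point (_ : LineBundle G B) (r : ℤ) : Type u := { x : B × ℤ // x.2 % 2 = r }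

variable {ℓ} in
theorem Point.ext {r : ℤ} {x y : ℓ.Point r} (h1 : x.1.1 = y.1.1) (h2 : x.1.2 = y.1.2) : x = y :=
  Subtype.ext (Prod.ext h1 h2)

instance (r : ℤ) : MulAction G (ℓ.Point r) where
  smul g x := ⟨⟨g • x.1.1, ℓ.act g x.1.1 x.1.2⟩, (ℓ.act_mod_two _ _ _).trans x.2⟩
  one_smul _ := Point.ext (one_smul _ _) (ℓ.act_one _ _)
  mul_smul _ _ _ := Point.ext (mul_smul _ _ _) (ℓ.act_mul _ _ _ _)

/-- The projection to the base. -/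
def proj (r : ℤ) : ℓ.Point r →[G] B where
  toFun x := x.1.1
  map_smul' _ _ := rfl

/-- The direction of an edge, which points from `0` to `2` modulo `4`. -/
def direction (v : ℤ) : ℤ := if v % 4 = 1 then 1 else -1

/-- Even integers are vertices and odd ones are edges. Translations by multiples of 4 and
reflections v ↦ −v + 4s keep the classes 0 and 2 modulo 4 apart, so orienting edges from 0 to 2 is
invariant, and reflections fix vertices only. -/
theorem act_direction (g : G) (b : B) {v : ℤ} (hv : v % 2 = 1) (σ : ℤ) :
    ℓ.act g b v + σ * direction (ℓ.act g b v) = ℓ.act g b (v + σ * direction v) := by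
  unfold act direction
  rcases Int.units_eq_one_or (ℓ.sign g b) with h | h <;> rw [h] <;> push_cast <;>
    split_ifs <;> omega

/-- The endpoints of the edges. -/
def endpoint (σ : ℤˣ) : ℓ.Point 1 →[G] ℓ.Point 0 where
  toFun x := ⟨⟨x.1.1, x.1.2 + σ * direction x.1.2⟩, by
    have h := x.2
    unfold direction
    rcases Int.units_eq_one_or σ with h | h <;> rw [h] <;> push_cast <;> split_ifs <;> omega⟩
  map_smul' g x := Point.ext rfl (ℓ.act_direction g x.1.1 x.2 σ)

theorem endpoint_fst (σ : ℤˣ) (x : ℓ.Point 1) : (ℓ.endpoint σ x).1.1 = x.1.1 := rfl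

theorem endpoint_snd (σ : ℤˣ) (x : ℓ.Point 1) :
    (ℓ.endpoint σ x).1.2 = x.1.2 + σ * direction x.1.2 := rfl

variable (L : Subgroup G) (p : Prop)

/-- The equivariant maps from an orbit, under a condition. -/
abbrev CondHom (X : Type u) [MulAction G X] : Type u := { _φ : G ⧸ L →[G] X // p }

variable {L p} in
/-- The endpoints of the edges fixed by a subgroup. -/
def condEndpoint (σ : ℤˣ) (φ : CondHom L p (ℓ.Point 1)) : CondHom L p (ℓ.Point 0) :=
  ⟨MulActionHom.comp (ℓ.endpoint σ) φ.1, φ.2⟩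

/-- The value at the base point. -/
def base {L : Subgroup G} {X : Type u} [MulAction G X] (φ : G ⧸ L →[G] X) : X :=
  φ ((1 : G) : G ⧸ L)

/-- Induction along the segment from v to w. A subgroup that fixes two distinct vertices of a fibre
fixes the whole fibre pointwise, so the intermediate cells are fixed too. -/
theorem exists_boundary_nat (n : ℕ) : ∀ v w : CondHom L p (ℓ.Point 0),
    (base v.1).1.1 = (base w.1).1.1 → (base w.1).1.2 = (base v.1).1.2 + 2 * n →
    ∃ x : CondHom L p (ℓ.Point 1) →₀ ℤ,
      x.mapDomain (ℓ.condEndpoint 1) - x.mapDomain (ℓ.condEndpoint (-1)) =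
        Finsupp.single v 1 - Finsupp.single w 1 := by
  induction n with
  | zero =>
    intro v w h1 h2
    obtain rfl : v = w := Subtype.ext (quotient_hom_ext (Point.ext h1 (by
      have : (base w.1).1.2 = (base v.1).1.2 := by simpa using h2
      exact this.symm)))
    exact ⟨0, by simp⟩
  | succ n ih =>
    intro v w h1 h2
    have hfix : ∀ l ∈ L, l • (base v.1).1.1 = (base v.1).1.1 ∧
        ∀ z, ℓ.act l (base v.1).1.1 z = z := by
      intro l hl
      have hv : l • base v.1 = base v.1 := smul_hom_one v.1 hl
      have hw : l • base w.1 = base w.1 := smul_hom_one w.1 hl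
      refine ⟨congrArg (fun x => x.1.1) hv, ℓ.act_eq_self (v := (base v.1).1.2)
        (w := (base w.1).1.2) (by push_cast at h2; omega) (congrArg (fun x => x.1.2) hv) ?_⟩
      rw [h1]
      exact congrArg (fun x => x.1.2) hw
    have hpar := (base v.1).2
    let ev : ℓ.Point 1 := ⟨⟨(base v.1).1.1, (base v.1).1.2 + 1⟩, by dsimp only; omega⟩
    let vv : ℓ.Point 0 := ⟨⟨(base v.1).1.1, (base v.1).1.2 + 2⟩, by dsimp only; omega⟩
    have hev : ∀ l ∈ L, l • ev = ev := fun l hl => Point.ext (hfix l hl).1 ((hfix l hl).2 _)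
    have hvv : ∀ l ∈ L, l • vv = vv := fun l hl => Point.ext (hfix l hl).1 ((hfix l hl).2 _)
    let e : CondHom L p (ℓ.Point 1) := ⟨ofFixed L ev hev, v.2⟩
    let v' : CondHom L p (ℓ.Point 0) := ⟨ofFixed L vv hvv, v.2⟩
    have he : base e.1 = ev := ofFixed_one L ev hev
    have hv' : base v'.1 = vv := ofFixed_one L vv hvv
    obtain ⟨x, hx⟩ := ih v' w (by rw [hv']; exact h1) (by
      rw [hv', h2]; push_cast; ring)
    have hend : ∀ (σ : ℤˣ) (y : CondHom L p (ℓ.Point 0)), (base y.1).1.1 = (base v.1).1.1 →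
        (base y.1).1.2 = (base v.1).1.2 + 1 + σ * direction ((base v.1).1.2 + 1) →
        ℓ.condEndpoint σ e = y := by
      intro σ y hy1 hy2
      have h3 : base (ℓ.condEndpoint σ e).1 = ℓ.endpoint σ (base e.1) := rfl
      refine Subtype.ext (quotient_hom_ext (Point.ext ?_ ?_))
      · refine Eq.trans ?_ hy1.symm
        refine (congrArg (fun x => x.1.1) h3).trans ?_
        rw [he]
        rfl
      · refine Eq.trans ?_ hy2.symm
        refine (congrArg (fun x => x.1.2) h3).trans ?_
        rw [he]
        rfl
    -- The first edge of the segment points away from v or towards it according to its residue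
    -- modulo 4, and enters the chain with the corresponding sign.
    by_cases hmod : ((base v.1).1.2 + 1) % 4 = 1
    · have hd : direction ((base v.1).1.2 + 1) = 1 := if_pos hmod
      refine ⟨x - Finsupp.single e 1, ?_⟩
      have h4 : ℓ.condEndpoint 1 e = v' := hend 1 v' (by rw [hv']) (by
        rw [hv', hd]; push_cast; ring)
      have h5 : ℓ.condEndpoint (-1) e = v := hend (-1) v rfl (by
        rw [hd]; push_cast; ring)
      rw [sub_eq_add_neg x, ← Finsupp.single_neg, Finsupp.mapDomain_add, Finsupp.mapDomain_add,
        Finsupp.mapDomain_single, Finsupp.mapDomain_single, add_sub_add_comm, hx, h4, h5,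
        Finsupp.single_neg, Finsupp.single_neg]
      abel
    · have hd : direction ((base v.1).1.2 + 1) = -1 := if_neg hmod
      refine ⟨x + Finsupp.single e 1, ?_⟩
      have h4 : ℓ.condEndpoint (-1) e = v' := hend (-1) v' (by rw [hv']) (by
        rw [hv', hd]; push_cast; ring)
      have h5 : ℓ.condEndpoint 1 e = v := hend 1 v rfl (by
        rw [hd]; push_cast; ring)
      rw [Finsupp.mapDomain_add, Finsupp.mapDomain_add,
        Finsupp.mapDomain_single, Finsupp.mapDomain_single, add_sub_add_comm, hx, h4, h5]
      abel

theorem exists_boundary (v w : CondHom L p (ℓ.Point 0))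
    (h : (base v.1).1.1 = (base w.1).1.1) :
    ∃ x : CondHom L p (ℓ.Point 1) →₀ ℤ,
      x.mapDomain (ℓ.condEndpoint 1) - x.mapDomain (ℓ.condEndpoint (-1)) =
        Finsupp.single v 1 - Finsupp.single w 1 := by
  have hv := (base v.1).2
  have hw := (base w.1).2
  rcases le_total (base v.1).1.2 (base w.1).1.2 with hle | hle
  · exact ℓ.exists_boundary_nat L p (((base w.1).1.2 - (base v.1).1.2) / 2).toNat v w h (by omega)
  · obtain ⟨x, hx⟩ := ℓ.exists_boundary_nat L p (((base v.1).1.2 - (base w.1).1.2) / 2).toNat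
      w v h.symm (by omega)
    refine ⟨-x, ?_⟩
    have hneg : ∀ f : CondHom L p (ℓ.Point 1) → CondHom L p (ℓ.Point 0),
        (-x).mapDomain f = -x.mapDomain f := fun f => map_neg (Finsupp.mapDomain.addMonoidHom f) x
    rw [hneg, hneg, neg_sub_neg, ← neg_sub, hx, neg_sub]

-- The cut is the indicator of the half-line above e in the fibre of e.
open Classical in
theorem exists_cut (e : CondHom L p (ℓ.Point 1)) : ∃ χ : CondHom L p (ℓ.Point 0) → ℤ,
    χ (ℓ.condEndpoint 1 e) ≠ χ (ℓ.condEndpoint (-1) e) ∧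
      ∀ e', e' ≠ e → χ (ℓ.condEndpoint 1 e') = χ (ℓ.condEndpoint (-1) e') := by
  have hend : ∀ (σ : ℤˣ) (e' : CondHom L p (ℓ.Point 1)),
      base (ℓ.condEndpoint σ e').1 = ℓ.endpoint σ (base e'.1) := fun _ _ => rfl
  refine ⟨fun v => if (base v.1).1.1 = (base e.1).1.1 ∧ (base e.1).1.2 < (base v.1).1.2 then 1
    else 0, ?_, fun e' he' => ?_⟩
  · simp only [hend, endpoint_fst, endpoint_snd, true_and]
    unfold direction
    push_cast
    split_ifs <;> omega
  · simp only [hend, endpoint_fst, endpoint_snd]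
    by_cases hb : (base e'.1).1.1 = (base e.1).1.1
    · have hne : (base e'.1).1.2 ≠ (base e.1).1.2 := fun h2 =>
        he' (Subtype.ext (quotient_hom_ext (Point.ext hb h2)))
      have h1 := (base e'.1).2
      have h2 := (base e.1).2
      simp only [hb, true_and]
      unfold direction
      push_cast
      split_ifs <;> omega
    · simp [hb]

variable {F : Set (Subgroup G)}

/-- The fixed point presheaf of the points of given parity, restricted to a sieve. -/
def pointPresheaf (r : ℤ) (R : (OrbitCategory F)ᵒᵖ → Prop)
    (hR : ∀ {c d : (OrbitCategory F)ᵒᵖ}, (c ⟶ d) → R c → R d) : (OrbitCategory F)ᵒᵖ ⥤ Type u :=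
  subFunctor (homPresheaf F (ℓ.Point r)) (fun c _ => R c) fun f _ => hR f

/-- The condition that a point of the base lifts to a fixed vertex. -/
def Lifts {X : Type u} [MulAction G X] {L : Subgroup G} (π : X →[G] B) (φ : G ⧸ L →[G] B) : Prop :=
  ∃ ψ : G ⧸ L →[G] X, MulActionHom.comp π ψ = φ

theorem lifts_map {X : Type u} [MulAction G X] (π : X →[G] B) {c d : (OrbitCategory F)ᵒᵖ}
    (f : c ⟶ d) (φ : G ⧸ c.unop.subgroup →[G] B) (h : Lifts π φ) :
    Lifts π (MulActionHom.comp φ (toEquivariant f.unop)) := by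
  obtain ⟨ψ, rfl⟩ := h
  exact ⟨MulActionHom.comp ψ (toEquivariant f.unop), rfl⟩

/-- The presheaf of fixed points of the base, on a sieve, that lift to fixed vertices. -/
def componentPresheaf (R : (OrbitCategory F)ᵒᵖ → Prop)
    (hR : ∀ {c d : (OrbitCategory F)ᵒᵖ}, (c ⟶ d) → R c → R d) : (OrbitCategory F)ᵒᵖ ⥤ Type u :=
  subFunctor (homPresheaf F B) (fun _ φ => R _ ∧ Lifts (ℓ.proj 0) φ)
    fun f φ h => ⟨hR f h.1, lifts_map _ f φ h.2⟩

variable (R : (OrbitCategory F)ᵒᵖ → Prop)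
    (hR : ∀ {c d : (OrbitCategory F)ᵒᵖ}, (c ⟶ d) → R c → R d)

/-- The endpoint maps on presheaves of fixed points. -/
def endpointMap (σ : ℤˣ) : ℓ.pointPresheaf 1 R hR ⟶ ℓ.pointPresheaf 0 R hR :=
  subFunctorMap _ _ (homPresheafMap F (ℓ.endpoint σ)) fun _ _ => id

/-- The map from fixed vertices to components. -/
def componentMap : ℓ.pointPresheaf 0 R hR ⟶ ℓ.componentPresheaf R hR :=
  subFunctorMap (fun f _ => hR f) (fun f φ h => ⟨hR f h.1, lifts_map _ f φ h.2⟩)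
    (homPresheafMap F (ℓ.proj 0)) fun _ φ h => ⟨h, φ, rfl⟩

/-- Over a fixed point of the base, the fixed set in the fibre is the whole line, one vertex or
empty. So the components of the fixed graph are the base points that lift to a fixed vertex. -/
theorem isForest_componentMap (c : (OrbitCategory F)ᵒᵖ) :
    IsForest ((ℓ.endpointMap R hR (-1)).app c) ((ℓ.endpointMap R hR 1).app c)
      ((ℓ.componentMap R hR).app c) := by
  refine ⟨?_, fun x => ?_, fun v w hvw => ?_, fun e => ?_⟩
  · rintro ⟨_, h1, ψ, rfl⟩
    exact ⟨⟨ψ, h1⟩, rfl⟩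
  · refine Subtype.ext ?_
    change MulActionHom.comp (ℓ.proj 0) (ℓ.condEndpoint (-1) x).1 =
      MulActionHom.comp (ℓ.proj 0) (ℓ.condEndpoint 1 x).1
    rfl
  · exact ℓ.exists_boundary c.unop.subgroup (R c) v w
      (congrArg (fun k : (ℓ.componentPresheaf R hR).obj c =>
        base (L := c.unop.subgroup) (X := B) k.1) hvw)
  · exact ℓ.exists_cut c.unop.subgroup (R c) e

theorem hasProjectiveDimensionLT_componentPresheaf (n : ℕ)
    (h : ∀ r, HasProjectiveDimensionLT (freeMod.obj (ℓ.pointPresheaf r R hR)) (n + 1)) :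
    HasProjectiveDimensionLT (freeMod.obj (ℓ.componentPresheaf R hR)) (n + 2) :=
  hasProjectiveDimensionLT_of_isForest _ _ _ (ℓ.isForest_componentMap R hR) (n + 1) (h 1)
    (have := h 0; hasProjectiveDimensionLT_of_ge _ (n + 1) _ (by lia))

end LineBundle

end LineBundles

end Bredon

namespace Bredon
open Limits Opposite

/-! ### Fixed vertices of subgroups acting on a line. -/

theorem units_sq (σ : ℤˣ) : (σ : ℤ) * σ = 1 := congrArg Units.val (Int.units_mul_self σ)

namespace LineData

variable {G : Type*} [Group G] (ℓ : LineData G)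

/-- A group acting on a line whose translations are torsion fixes a vertex. -/
theorem exists_fixed (h : ∀ g, ℓ.sign g = 1 → ∃ n : ℕ, 0 < n ∧ ℓ.shift (g ^ n) = 0) :
    ∃ v : ℤ, v % 2 = 0 ∧ ∀ g, ℓ.sign g * v + 4 * ℓ.shift g = v := by
  have h0 : ∀ g, ℓ.sign g = 1 → ℓ.shift g = 0 := by
    intro g hg
    obtain ⟨n, hn, h1⟩ := h g hg
    have h2 := ℓ.shift_zpow hg n
    rw [zpow_natCast, h1] at h2
    exact (mul_eq_zero.1 h2.symm).resolve_left (by exact_mod_cast hn.ne')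
  by_cases hs : ∀ g, ℓ.sign g = 1
  · exact ⟨0, rfl, fun g => by rw [h0 g (hs g)]; ring⟩
  push Not at hs
  obtain ⟨a, ha⟩ := hs
  have ha' : ℓ.sign a = -1 := (Int.units_eq_one_or _).resolve_left ha
  -- The fixed point of the reflection a. Any two orientation-reversing elements have the same
  -- shift, because their product is a trivial translation.
  refine ⟨2 * ℓ.shift a, by omega, fun g => ?_⟩
  rcases Int.units_eq_one_or (ℓ.sign g) with hg | hg
  · rw [hg, h0 g hg, Units.val_one]; ring
  · have h1 := h0 (g * a) (by rw [map_mul, hg, ha']; rfl)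
    rw [ℓ.shift_mul, hg] at h1
    rw [hg]
    push_cast at h1 ⊢
    linarith

end LineData

namespace LineBundle

variable {G B : Type u} [Group G] [MulAction G B] (ℓ : LineBundle G B)

/-- The action of a stabiliser on a fibre. -/
def fibre (b : B) (L : Subgroup G) (hL : ∀ l ∈ L, l • b = b) : LineData L where
  sign :=
    { toFun := fun g => ℓ.sign g b
      map_one' := ℓ.sign_one b
      map_mul' := fun g h => by
        rw [Subgroup.coe_mul, ℓ.sign_mul, hL h h.2] }
  shift g := ℓ.shift g b
  shift_mul g h := by
    rw [Subgroup.coe_mul, ℓ.shift_mul, hL h h.2]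
    rfl

theorem lifts_iff {L : Subgroup G} (φ : G ⧸ L →[G] B) :
    Lifts (ℓ.proj 0) φ ↔ ∃ v : ℤ, v % 2 = 0 ∧ ∀ l ∈ L, ℓ.act l (base φ) v = v := by
  constructor
  · rintro ⟨ψ, rfl⟩
    exact ⟨(base ψ).1.2, (base ψ).2, fun l hl => congrArg (fun x => x.1.2) (smul_hom_one ψ hl)⟩
  · rintro ⟨v, hv, h⟩
    let x : ℓ.Point 0 := ⟨⟨base φ, v⟩, hv⟩
    have hx : ∀ l ∈ L, l • x = x := fun l hl => Point.ext (smul_hom_one φ hl) (h l hl)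
    exact ⟨ofFixed L x hx, quotient_hom_ext (congrArg (ℓ.proj 0) (ofFixed_one L x hx))⟩

theorem lifts_of_torsion {L : Subgroup G} (φ : G ⧸ L →[G] B)
    (h : ∀ g ∈ L, ℓ.sign g (base φ) = 1 → ∃ n : ℕ, 0 < n ∧ ℓ.shift (g ^ n) (base φ) = 0) :
    Lifts (ℓ.proj 0) φ := by
  obtain ⟨v, hv, h1⟩ := (ℓ.fibre (base φ) L fun _ hl => smul_hom_one φ hl).exists_fixed
    fun g hg => h g g.2 hg
  exact (ℓ.lifts_iff φ).2 ⟨v, hv, fun l hl => h1 ⟨l, hl⟩⟩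

theorem lifts_of_finite {L : Subgroup G} [Finite L] (φ : G ⧸ L →[G] B) :
    Lifts (ℓ.proj 0) φ := by
  refine ℓ.lifts_of_torsion φ fun g hg _ => ?_
  obtain ⟨n, hn, h⟩ := (isOfFinOrder_iff_pow_eq_one (x := (⟨g, hg⟩ : L))).1 (isOfFinOrder_of_finite _)
  exact ⟨n, hn, by rw [show g ^ n = 1 from congrArg Subtype.val h, ℓ.shift_one]⟩

theorem shift_eq_zero_of_lifts {L : Subgroup G} {φ : G ⧸ L →[G] B} (h : Lifts (ℓ.proj 0) φ)
    {g : G} (hg : g ∈ L) (hs : ℓ.sign g (base φ) = 1) : ℓ.shift g (base φ) = 0 := by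
  obtain ⟨v, -, h⟩ := (ℓ.lifts_iff φ).1 h
  have := h g hg
  rw [act, hs, Units.val_one] at this
  omega

end LineBundle

/-! ### Two lines: the plane as a model for finite subgroups. -/

section Constant

variable {G : Type u} [Group G]

/-- The constant line bundle. -/
def LineData.bundle (ℓ : LineData G) (B : Type u) [MulAction G B] : LineBundle G B where
  sign g _ := ℓ.sign g
  shift g _ := ℓ.shift g
  sign_mul g h _ := map_mul ℓ.sign g h
  shift_mul g h _ := ℓ.shift_mul g h

/-- The one-point `G`-set. -/
def Pt (_ : Type u) : Type u := PUnit

instance : MulAction G (Pt G) where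
  smul _ x := x
  one_smul _ := rfl
  mul_smul _ _ _ := rfl

/-- The map to the point. -/
def toPt (L : Subgroup G) : G ⧸ L →[G] Pt G where
  toFun _ := PUnit.unit
  map_smul' _ _ := rfl

/-- A subgroup fixes a vertex of a line. -/
def LineData.FixesVertex (ℓ : LineData G) (L : Subgroup G) : Prop :=
  LineBundle.Lifts ((ℓ.bundle (Pt G)).proj 0) (toPt L)

/-- In a constant bundle the action on the fibre does not see the base, so lifting depends on L
alone. -/
theorem LineData.lifts_bundle_iff (ℓ : LineData G) {B : Type u} [MulAction G B] {L : Subgroup G}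
    (φ : G ⧸ L →[G] B) : LineBundle.Lifts ((ℓ.bundle B).proj 0) φ ↔ ℓ.FixesVertex L := by
  rw [LineData.FixesVertex, LineBundle.lifts_iff, LineBundle.lifts_iff]
  rfl

variable {F : Set (Subgroup G)}

theorem LineData.fixesVertex_map (ℓ : LineData G) {c d : (OrbitCategory F)ᵒᵖ} (f : c ⟶ d)
    (h : ℓ.FixesVertex c.unop.subgroup) : ℓ.FixesVertex d.unop.subgroup :=
  LineBundle.lifts_map _ f (toPt c.unop.subgroup) h

/-- The family restricted to a stabiliser contains the whole stabiliser, so each orbit has dimension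
zero and the free module is projective. -/
theorem hasProjectiveDimensionLT_of_stabilizer_mem (hF : IsFullFamily F) (X : Type u)
    [MulAction G X] (h : ∀ x : X, MulAction.stabilizer G x ∈ F) :
    HasProjectiveDimensionLT (freeMod.obj (homPresheaf F X)) 1 :=
  hasProjectiveDimensionLT_homPresheaf hF X 0 fun x =>
    (cd_eq_zero_of_top_mem (F := restrictFamily F (MulAction.stabilizer G x))
      ⟨_, h x, (Subgroup.subgroupOf_self _).symm⟩).le

theorem hasProjectiveDimensionLT_component_of_stabilizer_mem (hF : IsFullFamily F) {B : Type u}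
    [MulAction G B] (ℓ : LineBundle G B)
    (h : ∀ r (x : ℓ.Point r), MulAction.stabilizer G x ∈ F) :
    HasProjectiveDimensionLT
      (freeMod.obj (ℓ.componentPresheaf (F := F) (fun _ => True) fun _ => id)) 2 :=
  ℓ.hasProjectiveDimensionLT_componentPresheaf _ _ 0 fun r =>
    hasProjectiveDimensionLT_subFunctor_of_forall _ (fun _ _ => trivial) 1
      (hasProjectiveDimensionLT_of_stabilizer_mem hF _ (h r))

variable (ℓ₁ ℓ₂ : LineData G)

/-- The elements of L preserving both orientations have finite index, and they act on both lines as
translations with a fixed point, hence trivially. -/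
theorem finite_of_fixesVertex (hfin : Finite (ℓ₁.ker ⊓ ℓ₂.ker : Subgroup G)) {L : Subgroup G}
    (h₁ : ℓ₁.FixesVertex L) (h₂ : ℓ₂.FixesVertex L) : Finite L := by
  rw [((ℓ₁.sign.prod ℓ₂.sign).comp L.subtype).finite_iff_finite_ker_range]
  refine ⟨?_, inferInstance⟩
  refine Finite.of_injective (β := (ℓ₁.ker ⊓ ℓ₂.ker : Subgroup G)) (fun g => ⟨g.1, ?_⟩)
    fun x y h => Subtype.ext (Subtype.ext
      (congrArg (fun z : (ℓ₁.ker ⊓ ℓ₂.ker : Subgroup G) => (z : G)) h))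
  have hg := MonoidHom.mem_ker.1 g.2
  have hg₁ : ℓ₁.sign g.1 = 1 := congrArg Prod.fst hg
  have hg₂ : ℓ₂.sign g.1 = 1 := congrArg Prod.snd hg
  exact ⟨⟨hg₁, (ℓ₁.bundle (Pt G)).shift_eq_zero_of_lifts h₁ g.1.2 hg₁⟩,
    ⟨hg₂, (ℓ₂.bundle (Pt G)).shift_eq_zero_of_lifts h₂ g.1.2 hg₂⟩⟩

theorem fixesVertex_of_finite (ℓ : LineData G) (L : Subgroup G) [Finite L] : ℓ.FixesVertex L :=
  (ℓ.bundle (Pt G)).lifts_of_finite _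

theorem fixesVertex_stabilizer (ℓ : LineData G) {B : Type u} [MulAction G B] {r : ℤ}
    (x : (ℓ.bundle B).Point r) (L : Subgroup G) (hL : ∀ l ∈ L, l • x = x) : ℓ.FixesVertex L := by
  have hx : ∀ l ∈ L, (ℓ.bundle B).act l x.1.1 x.1.2 = x.1.2 := fun l hl =>
    congrArg (fun x => x.1.2) (hL l hl)
  refine ((ℓ.bundle (Pt G)).lifts_of_torsion _ fun g hg hs => ⟨1, one_pos, ?_⟩)
  have h := hx g hg
  rw [LineBundle.act, show (ℓ.bundle B).sign g x.1.1 = 1 from hs, Units.val_one] at h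
  rw [pow_one]
  have h2 : (ℓ.bundle B).shift g x.1.1 = 0 := by omega
  exact h2

theorem stabilizer_point_point_mem (hfin : Finite (ℓ₁.ker ⊓ ℓ₂.ker : Subgroup G)) {B : Type u}
    [MulAction G B] {r r' : ℤ} (x : (ℓ₁.bundle ((ℓ₂.bundle B).Point r')).Point r) :
    MulAction.stabilizer G x ∈ vcFamily G := by
  have : Finite (MulAction.stabilizer G x) := finite_of_fixesVertex ℓ₁ ℓ₂ hfin
    (fixesVertex_stabilizer ℓ₁ x _ fun _ h => h)
    (fixesVertex_stabilizer ℓ₂ x.1.1 _ fun _ h => congrArg (fun x => x.1.1) h)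
  exact isVirtuallyCyclic_of_finite _

/-- The sieve of subgroups that fix a vertex of each of two lines. -/
def FixesBoth (c : (OrbitCategory F)ᵒᵖ) : Prop :=
  ℓ₁.FixesVertex c.unop.subgroup ∧ ℓ₂.FixesVertex c.unop.subgroup

theorem fixesBoth_map {c d : (OrbitCategory F)ᵒᵖ} (f : c ⟶ d) (h : FixesBoth ℓ₁ ℓ₂ c) :
    FixesBoth ℓ₁ ℓ₂ d :=
  ⟨ℓ₁.fixesVertex_map f h.1, ℓ₂.fixesVertex_map f h.2⟩

/-- The fixed point presheaf of a `G`-set, restricted to the sieve of subgroups that fix a vertex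
of each of two lines. -/
def bothPresheaf (F : Set (Subgroup G)) (B : Type u) [MulAction G B] :
    (OrbitCategory F)ᵒᵖ ⥤ Type u :=
  subFunctor (homPresheaf F B) (fun c _ => FixesBoth ℓ₁ ℓ₂ c) fun f _ => fixesBoth_map ℓ₁ ℓ₂ f

/-- The plane is collapsed one line at a time. Cells of the plane over B have finite stabilisers and
give projectives. Collapsing the first line leaves cells of the second, on the sieve of subgroups
fixing a vertex of the first, in dimension at most 1. Collapsing the second line gives dimension at
most 2. -/
theorem hasProjectiveDimensionLT_bothPresheaf (hfin : Finite (ℓ₁.ker ⊓ ℓ₂.ker : Subgroup G))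
    (B : Type u) [MulAction G B] :
    HasProjectiveDimensionLT (freeMod.obj (bothPresheaf ℓ₁ ℓ₂ (vcFamily G) B)) 3 := by
  have h1 : ∀ r, HasProjectiveDimensionLT (freeMod.obj ((ℓ₂.bundle B).pointPresheaf (F := vcFamily G)
      r (fun c => ℓ₁.FixesVertex c.unop.subgroup) ℓ₁.fixesVertex_map)) 2 := fun r =>
    (hasProjectiveDimensionLT_subFunctor_iff
      (fun f φ h => ⟨trivial, LineBundle.lifts_map _ f φ h.2⟩) _ (fun c φ => by
      rw [true_and]
      exact ℓ₁.lifts_bundle_iff _) 2).1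
      (hasProjectiveDimensionLT_component_of_stabilizer_mem (isFullFamily_vcFamily G)
        (ℓ₁.bundle ((ℓ₂.bundle B).Point r))
        fun _ x => stabilizer_point_point_mem ℓ₁ ℓ₂ hfin x)
  exact (hasProjectiveDimensionLT_subFunctor_iff
    (fun f φ h => ⟨ℓ₁.fixesVertex_map f h.1, LineBundle.lifts_map _ f φ h.2⟩) _
    (fun c φ => and_congr_right fun _ => ℓ₂.lifts_bundle_iff _) 3).1
    ((ℓ₂.bundle B).hasProjectiveDimensionLT_componentPresheaf _ _ 1 h1)

end Constant

/-! ### Rational directions in the plane. -/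

section Directions

/-- The linear form that vanishes on a line through the origin, given by its slope. -/
def slopeForm (d : Option ℚ) (x y : ℤ) : ℤ :=
  match d with
  | none => x
  | some r => r.num * x - r.den * y

theorem slopeForm_some_eq_zero {r : ℚ} {x y : ℤ} :
    slopeForm (some r) x y = 0 ↔ (y : ℚ) = r * x := by
  have h : (r.den : ℚ) ≠ 0 := by exact_mod_cast r.den_ne_zero
  unfold slopeForm
  rw [sub_eq_zero, ← @Int.cast_inj ℚ]
  push_cast
  conv_rhs => rw [← Rat.num_div_den r]
  constructor
  · intro h1
    field_simp
    linarith
  · intro h1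
    field_simp at h1
    linarith

theorem exists_slope {x y : ℤ} (h : x ≠ 0 ∨ y ≠ 0) :
    ∃ d, ∀ e, slopeForm e x y = 0 ↔ e = d := by
  by_cases hx : x = 0
  · refine ⟨none, fun e => ?_⟩
    cases e with
    | none => simp [slopeForm, hx]
    | some r =>
      rw [slopeForm_some_eq_zero, hx]
      have := h.resolve_left (not_not.2 hx)
      simpa using this
  · refine ⟨some (y / x), fun e => ?_⟩
    have hx' : (x : ℚ) ≠ 0 := by exact_mod_cast hx
    cases e with
    | none => simp [slopeForm, hx]
    | some r => rw [slopeForm_some_eq_zero, Option.some_inj, eq_div_iff hx', eq_comm]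

/-- The action of a pair of signs on slopes. -/
def slopeAct (σ : ℤˣ) (d : Option ℚ) : Option ℚ := d.map fun r => (σ : ℤ) * r

/-- The sign by which a pair of signs acts on the fibre over a slope. -/
def slopeSign (σ₁ σ₂ : ℤˣ) (d : Option ℚ) : ℤˣ :=
  match d with
  | none => σ₁
  | some _ => σ₂

theorem slopeForm_slopeAct (σ₁ σ₂ : ℤˣ) (d : Option ℚ) (x y : ℤ) :
    slopeForm (slopeAct (σ₁ * σ₂) d) (σ₁ * x) (σ₂ * y) = slopeSign σ₁ σ₂ d * slopeForm d x y := by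
  cases d with
  | none => rfl
  | some r =>
    rcases Int.units_eq_one_or σ₁ with h | h <;> rcases Int.units_eq_one_or σ₂ with h' | h' <;>
      simp [slopeForm, slopeAct, slopeSign, h, h'] <;> ring

theorem slopeForm_add (d : Option ℚ) (x y x' y' : ℤ) :
    slopeForm d (x + x') (y + y') = slopeForm d x y + slopeForm d x' y' := by
  cases d with
  | none => rfl
  | some r => simp only [slopeForm]; ring

theorem slopeForm_mul (d : Option ℚ) (n x y : ℤ) :
    slopeForm d (n * x) (n * y) = n * slopeForm d x y := by
  cases d with
  | none => rfl
  | some r => simp only [slopeForm]; ring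

variable {G : Type u} [Group G] (ℓ₁ ℓ₂ : LineData G)

/-- The directions in the plane spanned by two lines. -/
def Direction (_ _ : LineData G) : Type u := ULift.{u} (Option ℚ)

instance : MulAction G (Direction ℓ₁ ℓ₂) where
  smul g d := ULift.up (slopeAct (ℓ₁.sign g * ℓ₂.sign g) d.down)
  one_smul := by
    rintro ⟨d⟩
    refine congrArg ULift.up ?_
    cases d <;> simp [slopeAct]
  mul_smul g h := by
    rintro ⟨d⟩
    refine congrArg ULift.up ?_
    cases d with
    | none => rfl
    | some r =>
      refine congrArg some ?_
      simp only [map_mul, Units.val_mul]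
      push_cast
      ring

theorem direction_smul_down (g : G) (d : Direction ℓ₁ ℓ₂) :
    (g • d).down = slopeAct (ℓ₁.sign g * ℓ₂.sign g) d.down := rfl

/-- The bundle of the quotients of the plane by the lines through the origin. -/
def directionBundle : LineBundle G (Direction ℓ₁ ℓ₂) where
  sign g d := slopeSign (ℓ₁.sign g) (ℓ₂.sign g) d.down
  -- The translation part acts after the signs, so it is measured by the form of the new direction g
  -- • d.
  shift g d := slopeForm (g • d).down (ℓ₁.shift g) (ℓ₂.shift g)
  sign_mul g h := by
    rintro ⟨_ | r⟩
    · exact map_mul ℓ₁.sign g h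
    · exact map_mul ℓ₂.sign g h
  shift_mul g h d := by
    rw [ℓ₁.shift_mul, ℓ₂.shift_mul, slopeForm_add, mul_smul, direction_smul_down _ _ g (h • d),
      slopeForm_slopeAct]

theorem directionBundle_shift_of_fixed {g : G} {d : Direction ℓ₁ ℓ₂} (h : g • d = d) :
    (directionBundle ℓ₁ ℓ₂).shift g d = slopeForm d.down (ℓ₁.shift g) (ℓ₂.shift g) := by
  conv_rhs => rw [← h]
  rfl

theorem directionBundle_sign {g : G} (h₁ : ℓ₁.sign g = 1) (h₂ : ℓ₂.sign g = 1)
    (d : Direction ℓ₁ ℓ₂) : (directionBundle ℓ₁ ℓ₂).sign g d = 1 := by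
  obtain ⟨_ | r⟩ := d
  exacts [h₁, h₂]

theorem smul_direction {g : G} (h₁ : ℓ₁.sign g = 1) (h₂ : ℓ₂.sign g = 1)
    (d : Direction ℓ₁ ℓ₂) : g • d = d := by
  obtain ⟨_ | r⟩ := d
  · rfl
  · refine congrArg ULift.up (congrArg some ?_)
    rw [h₁, h₂]
    simp

/-- The subgroup preserving both orientations has finite index in the stabiliser, and its
translation vectors lie on the line of slope d. One coordinate then determines the vector and gives
a homomorphism to ℤ with finite kernel. -/
theorem stabilizer_direction_point_mem (hfin : Finite (ℓ₁.ker ⊓ ℓ₂.ker : Subgroup G)) {r : ℤ}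
    (x : (directionBundle ℓ₁ ℓ₂).Point r) : MulAction.stabilizer G x ∈ vcFamily G := by
  let S := MulAction.stabilizer G x
  let T : Subgroup S := ((ℓ₁.sign.prod ℓ₂.sign).comp S.subtype).ker
  have hT₁ : ∀ t : T, ℓ₁.sign t.1 = 1 := fun t => congrArg Prod.fst (MonoidHom.mem_ker.1 t.2)
  have hT₂ : ∀ t : T, ℓ₂.sign t.1 = 1 := fun t => congrArg Prod.snd (MonoidHom.mem_ker.1 t.2)
  have hT : ∀ t : T, slopeForm x.1.1.down (ℓ₁.shift t.1) (ℓ₂.shift t.1) = 0 := by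
    intro t
    have h1 : t.1.1 • x = x := t.1.2
    rw [← directionBundle_shift_of_fixed ℓ₁ ℓ₂ (congrArg (fun x => x.1.1) h1)]
    have h2 : (directionBundle ℓ₁ ℓ₂).act t.1 x.1.1 x.1.2 = x.1.2 := congrArg (fun x => x.1.2) h1
    rw [LineBundle.act, directionBundle_sign ℓ₁ ℓ₂ (hT₁ t) (hT₂ t), Units.val_one] at h2
    omega
  have key : ∃ ℓ : LineData G, (∀ t : T, ℓ.sign t.1 = 1) ∧
      ∀ t : T, ℓ.shift t.1 = 0 → t.1.1 ∈ ℓ₁.ker ⊓ ℓ₂.ker := by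
    obtain ⟨⟨⟨_ | q⟩, v⟩, hx⟩ := x
    -- For the vertical direction the second coordinate is faithful; for a finite slope it is the
    -- first.
    · exact ⟨ℓ₂, hT₂, fun t ht => ⟨⟨hT₁ t, hT t⟩, ⟨hT₂ t, ht⟩⟩⟩
    · refine ⟨ℓ₁, hT₁, fun t ht => ⟨⟨hT₁ t, ht⟩, ⟨hT₂ t, ?_⟩⟩⟩
      have h := slopeForm_some_eq_zero.1 (hT t)
      rw [ht] at h
      simpa using h
  obtain ⟨ℓ, hs, hk⟩ := key
  let f : T →* Multiplicative ℤ := ℓ.shiftHom.comp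
    ((S.subtype.comp T.subtype).codRestrict ℓ.sign.ker fun t => hs t)
  refine IsVirtuallyCyclic.of_finiteIndex T inferInstance (isVirtuallyCyclic_of_hom f ?_)
  exact Finite.of_injective (β := (ℓ₁.ker ⊓ ℓ₂.ker : Subgroup G))
    (fun t => ⟨t.1.1.1, hk t.1 (congrArg Multiplicative.toAdd (MonoidHom.mem_ker.1 t.2))⟩)
    fun x y h => Subtype.ext (Subtype.ext (Subtype.ext
      (congrArg (fun z : (ℓ₁.ker ⊓ ℓ₂.ker : Subgroup G) => (z : G)) h)))

/-- `c` is the square of a generator of a finite index cyclic subgroup, so that it preserves both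
orientations; every element of L has a power that is a power of it. -/
theorem exists_axis {L : Subgroup G} (hL : IsVirtuallyCyclic L) (hinf : ¬ Finite L) :
    ∃ c ∈ L, ¬ IsOfFinOrder c ∧ ℓ₁.sign c = 1 ∧ ℓ₂.sign c = 1 ∧
      ∀ g ∈ L, ∃ n : ℕ, 0 < n ∧ ∃ m : ℤ, g ^ n = c ^ m := by
  obtain ⟨C, hC, hfin⟩ := hL
  obtain ⟨c, rfl⟩ := (Subgroup.isCyclic_iff_exists_zpowers_eq_top C).1 hC
  have hc : ¬ IsOfFinOrder c := by
    intro hf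
    have : Finite (Subgroup.zpowers c) := finite_zpowers.2 hf
    exact hinf ((Subgroup.finite_iff_finite_and_finiteIndex (Subgroup.zpowers c)).2 ⟨this, hfin⟩)
  have hsq : ∀ ℓ : LineData G, ℓ.sign ((c : G) ^ 2) = 1 := fun ℓ => by
    rw [map_pow, Int.units_sq]
  refine ⟨(c : G) ^ 2, L.pow_mem c.2 2, ?_, hsq _, hsq _, fun g hg => ?_⟩
  · rw [isOfFinOrder_pow]
    rintro (h | h)
    · exact hc (Submonoid.isOfFinOrder_coe.1 h)
    · exact two_ne_zero h
  · obtain ⟨n, hn, -, h⟩ := Subgroup.exists_pow_mem_of_index_ne_zero hfin.index_ne_zero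
      (⟨g, hg⟩ : L)
    obtain ⟨m, hm⟩ := Subgroup.mem_zpowers_iff.1 h
    have hm' : (c : G) ^ m = g ^ n := congrArg Subtype.val hm
    refine ⟨n * 2, by omega, m, ?_⟩
    rw [pow_mul, ← hm', ← zpow_natCast, ← zpow_natCast, ← zpow_mul, ← zpow_mul, mul_comm]

/-- The direction is that of the translation vector of an axis c, which is nonzero because c has
infinite order and the common kernel is finite. L preserves it because conjugates of c share powers
with c. In the quotient line of another direction c would be a nontrivial translation, hence without
fixed vertex. -/
theorem existsUnique_direction (hfin : Finite (ℓ₁.ker ⊓ ℓ₂.ker : Subgroup G)) {L : Subgroup G}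
    (hL : IsVirtuallyCyclic L) (hinf : ¬ Finite L) :
    ∃! φ : G ⧸ L →[G] Direction ℓ₁ ℓ₂, LineBundle.Lifts ((directionBundle ℓ₁ ℓ₂).proj 0) φ := by
  obtain ⟨c, hcL, hc, hc₁, hc₂, hpow⟩ := exists_axis ℓ₁ ℓ₂ hL hinf
  have hne : ℓ₁.shift c ≠ 0 ∨ ℓ₂.shift c ≠ 0 := by
    by_contra! h
    let z : (ℓ₁.ker ⊓ ℓ₂.ker : Subgroup G) := ⟨c, ⟨hc₁, h.1⟩, ⟨hc₂, h.2⟩⟩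
    exact hc (Submonoid.isOfFinOrder_coe.2 (isOfFinOrder_of_finite z))
  obtain ⟨d, hd⟩ := exists_slope hne
  let δ : Direction ℓ₁ ℓ₂ := ULift.up d
  have hδ : ∀ g ∈ L, g • δ = δ := by
    intro g hg
    refine congrArg ULift.up ((hd _).1 ?_)
    obtain ⟨n, hn, m, hnm⟩ := hpow (g * c * g⁻¹) (L.mul_mem (L.mul_mem hg hcL) (L.inv_mem hg))
    have key : ∀ ℓ : LineData G, ℓ.sign c = 1 →
        (n : ℤ) * (ℓ.sign g * ℓ.shift c) = m * ℓ.shift c := by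
      intro ℓ hℓ
      have h1 : ℓ.sign (g * c * g⁻¹) = 1 := by
        rw [map_mul, map_mul, hℓ, mul_one, map_inv, mul_inv_cancel]
      rw [← ℓ.shift_conj g hℓ, ← ℓ.shift_zpow h1, zpow_natCast, hnm, ℓ.shift_zpow hℓ]
    have h3 : (n : ℤ) * slopeForm (slopeAct (ℓ₁.sign g * ℓ₂.sign g) d) (ℓ₁.shift c) (ℓ₂.shift c)
        = 0 := by
      have e₁ : ℓ₁.shift c = ℓ₁.sign g * (ℓ₁.sign g * ℓ₁.shift c) := by
        rw [← mul_assoc, units_sq, one_mul]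
      have e₂ : ℓ₂.shift c = ℓ₂.sign g * (ℓ₂.sign g * ℓ₂.shift c) := by
        rw [← mul_assoc, units_sq, one_mul]
      rw [e₁, e₂, slopeForm_slopeAct, mul_left_comm, ← slopeForm_mul, key ℓ₁ hc₁, key ℓ₂ hc₂,
        slopeForm_mul, (hd d).2 rfl, mul_zero, mul_zero]
    exact (mul_eq_zero.1 h3).resolve_left (by exact_mod_cast hn.ne')
  have hshift : (directionBundle ℓ₁ ℓ₂).shift c δ = 0 := by
    rw [directionBundle_shift_of_fixed ℓ₁ ℓ₂ (hδ c hcL)]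
    exact (hd _).2 rfl
  have hbase : LineBundle.base (ofFixed L δ hδ) = δ := ofFixed_one L δ hδ
  refine ⟨ofFixed L δ hδ, (directionBundle ℓ₁ ℓ₂).lifts_of_torsion _ fun g hg _ => ?_,
    fun φ hφ => quotient_hom_ext ?_⟩
  · obtain ⟨n, hn, m, hnm⟩ := hpow g hg
    refine ⟨n, hn, ?_⟩
    rw [hbase, hnm]
    have h1 := ((directionBundle ℓ₁ ℓ₂).fibre δ L hδ).shift_zpow (g := ⟨c, hcL⟩)
      (directionBundle_sign ℓ₁ ℓ₂ hc₁ hc₂ δ) m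
    have h2 : (directionBundle ℓ₁ ℓ₂).shift (c ^ m) δ = m * (directionBundle ℓ₁ ℓ₂).shift c δ := h1
    rw [h2, hshift, mul_zero]
  · refine Eq.trans ?_ (ofFixed_one L δ hδ).symm
    have h1 := LineBundle.shift_eq_zero_of_lifts _ hφ hcL (directionBundle_sign ℓ₁ ℓ₂ hc₁ hc₂ _)
    rw [directionBundle_shift_of_fixed ℓ₁ ℓ₂ (smul_direction ℓ₁ ℓ₂ hc₁ hc₂ _)] at h1
    exact congrArg ULift.up ((hd _).1 h1)

end Directions

end Bredon

namespace Bredon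
open Limits Opposite

/-! ### The star of directions and the upper bound 3. -/

theorem hasProjectiveDimensionLT_mono {A : Type*} [Category* A] [Abelian A] {M : A} {m n : ℕ}
    (h : HasProjectiveDimensionLT M m) (hmn : m ≤ n) : HasProjectiveDimensionLT M n :=
  hasProjectiveDimensionLT_of_ge M m n hmn

/-- `hV` covers a star with centre b, all of whose other vertices are leaves, and the degenerate
case of a single vertex. The cut of an edge is the indicator of its leaf. -/
theorem isForest_star {E V : Type u} (s t : E → V) (γ : V → PUnit.{u + 1})
    (ht : Function.Injective t) (hst : ∀ e e', t e ≠ s e') (hne : Nonempty V)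
    (hV : ∀ v w : V, v = w ∨ ∃ b, (∀ e, s e = b) ∧ ∀ v, v = b ∨ ∃ e, t e = v) :
    IsForest s t γ where
  surjective _ := hne.elim fun v => ⟨v, rfl⟩
  comm _ := rfl
  connected v w _ := by
    rcases hV v w with rfl | ⟨b, hb, h⟩
    · exact ⟨0, by simp⟩
    · have key : ∀ v, ∃ x : E →₀ ℤ,
          x.mapDomain t - x.mapDomain s = Finsupp.single v 1 - Finsupp.single b 1 := by
        intro v
        rcases h v with rfl | ⟨e, rfl⟩
        · exact ⟨0, by simp⟩
        · exact ⟨Finsupp.single e 1, by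
            rw [Finsupp.mapDomain_single, Finsupp.mapDomain_single, hb]⟩
      obtain ⟨x, hx⟩ := key v
      obtain ⟨y, hy⟩ := key w
      refine ⟨x - y, ?_⟩
      have hsub : ∀ f : E → V, (x - y).mapDomain f = x.mapDomain f - y.mapDomain f :=
        fun f => map_sub (Finsupp.mapDomain.addMonoidHom f) x y
      rw [hsub, hsub, sub_sub_sub_comm, hx, hy, sub_sub_sub_cancel_right]
  cut e := by
    classical
    refine ⟨fun v => if v = t e then 1 else 0, ?_, fun e' he' => ?_⟩
    · dsimp only
      rw [if_pos rfl, if_neg (hst e e).symm]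
      exact one_ne_zero
    · dsimp only
      rw [if_neg fun h => he' (ht h), if_neg (hst e e').symm]

/-- The two parts of a disjoint union. -/
def binaryFamily {D : Type u} [SmallCategory D] (S T : D ⥤ Type u) : ULift.{u} Bool → D ⥤ Type u
  | ⟨true⟩ => S
  | ⟨false⟩ => T

section Upper

variable {G : Type u} [Group G] (ℓ₁ ℓ₂ : LineData G)

/-- The directions that are fixed together with a vertex of the corresponding line. -/
abbrev directionPresheaf : (OrbitCategory (vcFamily G))ᵒᵖ ⥤ Type u :=
  (directionBundle ℓ₁ ℓ₂).componentPresheaf (F := vcFamily G) (fun _ => True) fun _ => id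

/-- The vertices of the star. -/
abbrev starVertices : (OrbitCategory (vcFamily G))ᵒᵖ ⥤ Type u :=
  sigmaFunctor (binaryFamily (directionPresheaf ℓ₁ ℓ₂) (bothPresheaf ℓ₁ ℓ₂ (vcFamily G) (Pt G)))

/-- The map from a `G`-set to the point. -/
def constPt (X : Type u) [MulAction G X] : X →[G] Pt G where
  toFun _ := PUnit.unit
  map_smul' _ _ := rfl

/-- The centres of the edges of the star. -/
def starSource : bothPresheaf ℓ₁ ℓ₂ (vcFamily G) (Direction ℓ₁ ℓ₂) ⟶ starVertices ℓ₁ ℓ₂ :=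
  subFunctorMap (fun f _ => fixesBoth_map ℓ₁ ℓ₂ f) (fun f _ => fixesBoth_map ℓ₁ ℓ₂ f)
    (homPresheafMap (vcFamily G) (constPt (Direction ℓ₁ ℓ₂))) (fun _ _ h => h) ≫
      sigmaInclusion (binaryFamily (directionPresheaf ℓ₁ ℓ₂)
        (bothPresheaf ℓ₁ ℓ₂ (vcFamily G) (Pt G))) ⟨false⟩

variable (hfin : Finite (ℓ₁.ker ⊓ ℓ₂.ker : Subgroup G))

include hfin in
theorem lifts_direction {c : (OrbitCategory (vcFamily G))ᵒᵖ} (h : FixesBoth ℓ₁ ℓ₂ c)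
    (φ : G ⧸ c.unop.subgroup →[G] Direction ℓ₁ ℓ₂) :
    LineBundle.Lifts ((directionBundle ℓ₁ ℓ₂).proj 0) φ :=
  have := finite_of_fixesVertex ℓ₁ ℓ₂ hfin h.1 h.2
  (directionBundle ℓ₁ ℓ₂).lifts_of_finite φ

/-- The leaves of the edges of the star. -/
def starTarget : bothPresheaf ℓ₁ ℓ₂ (vcFamily G) (Direction ℓ₁ ℓ₂) ⟶ starVertices ℓ₁ ℓ₂ :=
  subFunctorMap (fun f _ => fixesBoth_map ℓ₁ ℓ₂ f)
    (fun f φ h => ⟨trivial, LineBundle.lifts_map _ f φ h.2⟩) (𝟙 _)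
    (fun _ φ h => ⟨trivial, lifts_direction ℓ₁ ℓ₂ hfin h φ⟩) ≫
      sigmaInclusion (binaryFamily (directionPresheaf ℓ₁ ℓ₂)
        (bothPresheaf ℓ₁ ℓ₂ (vcFamily G) (Pt G))) ⟨true⟩

/-- The map to the terminal functor. -/
def toTerminal {D : Type u} [SmallCategory D] (S : D ⥤ Type u) :
    S ⟶ (Functor.const D).obj PUnit.{u + 1} where
  app _ := ↾fun _ => PUnit.unit

-- A subgroup fixing vertices of both lines is finite; it then lifts every direction that it fixes,
-- and the star is complete. Otherwise it is infinite, centre and edges are empty, and exactly one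
-- leaf remains.
include hfin in
theorem star_isForest (c : (OrbitCategory (vcFamily G))ᵒᵖ) :
    IsForest ((starSource ℓ₁ ℓ₂).app c) ((starTarget ℓ₁ ℓ₂ hfin).app c)
      ((toTerminal (starVertices ℓ₁ ℓ₂)).app c) := by
  have hpt : ∀ x y : (bothPresheaf ℓ₁ ℓ₂ (vcFamily G) (Pt G)).obj c, x = y := fun x y =>
    Subtype.ext (MulActionHom.ext (X := G ⧸ c.unop.subgroup) fun _ => rfl)
  by_cases h : FixesBoth ℓ₁ ℓ₂ c
  · let b : (starVertices ℓ₁ ℓ₂).obj c := ⟨⟨false⟩, ⟨toPt c.unop.subgroup, h⟩⟩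
    refine isForest_star _ _ _ ?_ ?_ ⟨b⟩ fun _ _ => Or.inr ⟨b, fun e => ?_, ?_⟩
    · intro x y hxy
      have h1 := sigma_mk_injective (β := fun i => (binaryFamily (directionPresheaf ℓ₁ ℓ₂)
        (bothPresheaf ℓ₁ ℓ₂ (vcFamily G) (Pt G)) i).obj c) (i := ⟨true⟩) hxy
      exact Subtype.ext (congrArg (fun z : (directionPresheaf ℓ₁ ℓ₂).obj c => z.1) h1)
    · intro x y hxy
      have := congrArg (fun z : (starVertices ℓ₁ ℓ₂).obj c => z.1.down) hxy
      exact Bool.noConfusion this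
    · rfl
    · rintro ⟨⟨_ | _⟩, x⟩
      · exact Or.inl (congrArg (Sigma.mk (ULift.up false)) (hpt _ _))
      · exact Or.inr ⟨⟨x.1, h⟩, rfl⟩
  · have hE : IsEmpty ((bothPresheaf ℓ₁ ℓ₂ (vcFamily G) (Direction ℓ₁ ℓ₂)).obj c) :=
      ⟨fun e => h e.2⟩
    have hinf : ¬ Finite c.unop.subgroup := fun hf =>
      h ⟨fixesVertex_of_finite ℓ₁ _, fixesVertex_of_finite ℓ₂ _⟩
    obtain ⟨φ, hφ, huniq⟩ := existsUnique_direction ℓ₁ ℓ₂ hfin c.unop.mem hinf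
    let b : (starVertices ℓ₁ ℓ₂).obj c := ⟨⟨true⟩, ⟨φ, trivial, hφ⟩⟩
    have hb : ∀ v : (starVertices ℓ₁ ℓ₂).obj c, v = b := by
      rintro ⟨⟨_ | _⟩, x⟩
      · exact absurd x.2 h
      · exact congrArg (Sigma.mk (ULift.up true)) (Subtype.ext (huniq x.1 x.2.2))
    exact isForest_star _ _ _ (fun x => (hE.false x).elim) (fun x => (hE.false x).elim) ⟨b⟩
      fun v w => Or.inl ((hb v).trans (hb w).symm)

-- Edges and centre have dimension at most 2 and leaves at most 1, so the quotient ℤ of the star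
-- sequence has dimension at most 3.
include hfin in
theorem cd_vcFamily_le_three : cd (vcFamily G) ≤ 3 := by
  refine (cd_le_iff _ 3).2 ?_
  have hT := hasProjectiveDimensionLT_component_of_stabilizer_mem (isFullFamily_vcFamily G)
    (directionBundle ℓ₁ ℓ₂) fun _ x => stabilizer_direction_point_mem ℓ₁ ℓ₂ hfin x
  have hV : HasProjectiveDimensionLT (freeMod.obj (starVertices ℓ₁ ℓ₂)) (3 + 1) := by
    refine hasProjectiveDimensionLT_freeMod_sigma _ 3 ?_
    rintro ⟨_ | _⟩
    · exact hasProjectiveDimensionLT_mono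
        (hasProjectiveDimensionLT_bothPresheaf ℓ₁ ℓ₂ hfin (Pt G)) (by lia)
    · exact hasProjectiveDimensionLT_mono hT (by lia)
  have := hasProjectiveDimensionLT_of_isForest _ _ _ (star_isForest ℓ₁ ℓ₂ hfin) 3
    (hasProjectiveDimensionLT_bothPresheaf ℓ₁ ℓ₂ hfin _) hV
  exact hasProjectiveDimensionLT_of_iso (freeModUniqueIso
    ((Functor.const _).obj PUnit.{u + 1}) (fun _ => PUnit.unit) fun _ _ => rfl) _

end Upper

/-! ### The bound for products and virtually cyclic subgroups. -/

section Products

variable {G₁ G₂ : Type u} [Group G₁] [Group G₂]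

theorem cd_vcFamily_prod_subgroup_le {H₁ : Subgroup G₁} {H₂ : Subgroup G₂}
    (h₁ : IsVirtuallyCyclic H₁) (h₂ : IsVirtuallyCyclic H₂) : cd (vcFamily (H₁.prod H₂)) ≤ 3 := by
  obtain ⟨ℓ₁, hℓ₁⟩ := h₁.exists_lineData
  obtain ⟨ℓ₂, hℓ₂⟩ := h₂.exists_lineData
  let f₁ : H₁.prod H₂ →* H₁ := ((MonoidHom.fst G₁ G₂).comp (H₁.prod H₂).subtype).codRestrict H₁
    fun x => (Subgroup.mem_prod.1 x.2).1
  let f₂ : H₁.prod H₂ →* H₂ := ((MonoidHom.snd G₁ G₂).comp (H₁.prod H₂).subtype).codRestrict H₂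
    fun x => (Subgroup.mem_prod.1 x.2).2
  refine cd_vcFamily_le_three (ℓ₁.comap f₁) (ℓ₂.comap f₂) ?_
  refine Finite.of_injective (β := ℓ₁.ker × ℓ₂.ker)
    (fun x => ⟨⟨f₁ x.1, x.2.1⟩, ⟨f₂ x.1, x.2.2⟩⟩) fun x y h => ?_
  have e₁ : f₁ x.1 = f₁ y.1 := congrArg (fun z => z.1.1) h
  have e₂ : f₂ x.1 = f₂ y.1 := congrArg (fun z => z.2.1) h
  exact Subtype.ext (Subtype.ext (Prod.ext (congrArg Subtype.val e₁) (congrArg Subtype.val e₂)))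

/-- The bound for the virtually cyclic dimension of a direct product. -/
theorem cd_vcFamily_prod_le (G₁ G₂ : Type u) [Group G₁] [Group G₂] :
    cd (vcFamily (G₁ × G₂)) ≤ cd (vcFamily G₁) + cd (vcFamily G₂) + 3 := by
  refine cd_prod_le_add (isFullFamily_vcFamily G₁) (isFullFamily_vcFamily G₂)
    (isFullFamily_vcFamily _) (vcFamily_prod_subset G₁ G₂) 3 ?_
  rintro _ ⟨H₁, h₁, H₂, h₂, rfl⟩
  rw [restrictFamily_vcFamily]
  exact cd_vcFamily_prod_subgroup_le h₁ h₂

end Products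

end Bredon

namespace Bredon
open Limits Opposite

/-! ### Two Ext arguments for the lower bound. -/

section ExtCriteria

universe v w

open Abelian

variable {A : Type w} [Category.{v} A] [Abelian A]

/-- A vanishing criterion for extension groups, from a complex shaped like a star with at least
two edges. -/
theorem ext_eq_zero_of_star [HasExt.{max v w} A] {S : ShortComplex A} (hS : S.ShortExact) {n : ℕ}
    (hZ : HasProjectiveDimensionLT S.X₃ (1 + n)) {J T N : A} (hT : HasProjectiveDimensionLT T n)
    (i₁ i₂ : J ⟶ S.X₁) (p : S.X₁ ⟶ J) (h₁ : i₁ ≫ p = 𝟙 J) (h₂ : i₂ ≫ p = 0)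
    (b : J ⟶ S.X₂) (w : T ⟶ S.X₂) (u₁ u₂ : J ⟶ T) (e₁ : i₁ ≫ S.f = u₁ ≫ w - b)
    (e₂ : i₂ ≫ S.f = u₂ ≫ w - b) (α : Ext J N n) : α = 0 := by
  -- The obstruction to extending p*α over `S.X₂` lies in Ext of degree 1 + n of `S.X₃`, which
  -- vanishes.
  obtain ⟨y, hy⟩ := Ext.contravariant_sequence_exact₁ hS N ((Ext.mk₀ p).comp α (zero_add n)) rfl
    (Ext.eq_zero_of_hasProjectiveDimensionLT _ (1 + n) le_rfl)
  -- Along either edge the leaf contributes nothing, as Extⁿ(T, N) = 0, so both pullbacks equal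
  -- −b*y. One of them is α and the other is zero.
  have key : ∀ (i : J ⟶ S.X₁) (u : J ⟶ T), i ≫ S.f = u ≫ w - b →
      (Ext.mk₀ (i ≫ p)).comp α (zero_add n) = -(Ext.mk₀ b).comp y (zero_add n) := by
    intro i u e
    rw [← Ext.mk₀_comp_mk₀_assoc, ← hy, Ext.mk₀_comp_mk₀_assoc, e]
    have h0 : (Ext.mk₀ w).comp y (zero_add n) = 0 :=
      Ext.eq_zero_of_hasProjectiveDimensionLT _ n le_rfl
    rw [sub_eq_add_neg, Ext.mk₀_add, Ext.add_comp, ← Ext.mk₀_comp_mk₀_assoc, h0, Ext.comp_zero,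
      zero_add, Ext.mk₀_neg, Ext.neg_comp]
  have k₁ := key i₁ u₁ e₁
  rw [← key i₂ u₂ e₂, h₁, h₂, Ext.mk₀_zero, Ext.zero_comp, Ext.mk₀_id_comp] at k₁
  exact k₁

/-- If a second extension group vanishes, then morphisms out of the second syzygy extend. -/
theorem exists_extension_of_ext_two_eq_zero [HasExt.{max v w} A] {S S' : ShortComplex A}
    (hS : S.ShortExact) (hS' : S'.ShortExact) (ρ : S ⟶ S') {J N : A} (q : S'.X₃ ⟶ J)
    (hq : ρ.τ₃ ≫ q = 0) (hJ : (ShortComplex.mk ρ.τ₃ q hq).ShortExact)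
    (hP : HasProjectiveDimensionLT S'.X₂ 1) (h : ∀ α : Ext J N 2, α = 0) (f : S.X₁ ⟶ N) :
    ∃ (a : S'.X₁ ⟶ N) (b : S.X₂ ⟶ N), f = ρ.τ₁ ≫ a + S.f ≫ b := by
  -- The pushout class f∗[S] has connecting image in Ext²(J, N) = 0, so it is the pullback of some β
  -- along `ρ.τ₃`.
  obtain ⟨β, hβ⟩ := Ext.contravariant_sequence_exact₁ hJ N
    (hS.extClass.comp (Ext.mk₀ f) (add_zero 1)) rfl (h _)
  -- β dies on the projective `S'.X₂`, so it is a∗[S'].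
  obtain ⟨a', ha'⟩ := Ext.contravariant_sequence_exact₃ hS' N β
    (Ext.eq_zero_of_hasProjectiveDimensionLT _ 1 le_rfl) (n₀ := 0) rfl
  obtain ⟨a, rfl⟩ := (Ext.mk₀_bijective _ _).2 a'
  -- By naturality of extension classes, f − ρ.τ₁ ≫ a annihilates [S], and therefore extends along
  -- `S.f`.
  have h1 : hS.extClass.comp (Ext.mk₀ (f - ρ.τ₁ ≫ a)) (add_zero 1) = 0 := by
    rw [sub_eq_add_neg, Ext.mk₀_add, Ext.mk₀_neg, Ext.comp_add, Ext.comp_neg, ← Ext.mk₀_comp_mk₀,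
      ← hβ, ← ha', ← Ext.comp_assoc_of_second_deg_zero, 
      ShortComplex.ShortExact.extClass_naturality hS hS' ρ, Ext.comp_assoc_of_third_deg_zero]
    exact add_neg_cancel _
  obtain ⟨b', hb'⟩ := Ext.contravariant_sequence_exact₁ hS N _ rfl h1
  obtain ⟨b, rfl⟩ := (Ext.mk₀_bijective _ _).2 b'
  rw [Ext.mk₀_comp_mk₀] at hb'
  refine ⟨a, b, ?_⟩
  rw [(Ext.mk₀_bijective _ _).1 hb', add_sub_cancel]

end ExtCriteria

end Bredon

namespace Bredon
open Limits Opposite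

theorem boundary_app_freeMk {D : Type u} [SmallCategory D] {E V : D ⥤ Type u} (s t : E ⟶ V)
    (d : D) (x : E.obj d) :
    (boundary s t).app d (freeMk x) = freeMk (t.app d x) - freeMk (s.app d x) := by
  refine (boundary_app s t d _).trans ?_
  exact congrArg₂ (fun a b : V.obj d →₀ ℤ => a - b) Finsupp.mapDomain_single
    Finsupp.mapDomain_single

theorem boundary_comp_boundary {D : Type u} [SmallCategory D] {E V E' V' : D ⥤ Type u}
    {s t : E ⟶ V} {s' t' : E' ⟶ V'} {a a' : E ⟶ E'} {b b' : V ⟶ V'} (h₁ : a ≫ s' = s ≫ b)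
    (h₂ : a ≫ t' = t ≫ b) (h₃ : a' ≫ s' = s ≫ b') (h₄ : a' ≫ t' = t ≫ b') :
    boundary a a' ≫ boundary s' t' = boundary s t ≫ boundary b b' := by
  simp only [boundary, Preadditive.sub_comp, Preadditive.comp_sub, ← Functor.map_comp, h₁, h₂, h₃,
    h₄]
  abel

theorem boundary_comp_map {D : Type u} [SmallCategory D] {E V E' V' : D ⥤ Type u}
    {s t : E ⟶ V} {s' t' : E' ⟶ V'} {a : E ⟶ E'} {b : V ⟶ V'} (h₁ : a ≫ s' = s ≫ b)
    (h₂ : a ≫ t' = t ≫ b) :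
    boundary s t ≫ freeMod.map b = freeMod.map a ≫ boundary s' t' := by
  simp only [boundary, Preadditive.sub_comp, Preadditive.comp_sub, ← Functor.map_comp, h₁, h₂]

/-! ### Invariant functions as morphisms to the constant module. -/

section Values

variable {G : Type u} [Group G] {F : Set (Subgroup G)}

theorem exists_base_comp {X : Type u} [MulAction G X] {L M : Subgroup G} (φ : G ⧸ M →[G] X)
    (f : G ⧸ L →[G] G ⧸ M) : ∃ g : G, LineBundle.base (MulActionHom.comp φ f) =
      g • LineBundle.base φ := by
  obtain ⟨g, hg⟩ := QuotientGroup.mk_surjective (f ((1 : G) : G ⧸ L))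
  refine ⟨g, ?_⟩
  change φ (f ((1 : G) : G ⧸ L)) = g • φ ((1 : G) : G ⧸ M)
  rw [← hg, ← map_smul, MulAction.Quotient.smul_coe, smul_eq_mul, mul_one]

section

variable {X : Type u} [MulAction G X] {p : ∀ c : (OrbitCategory F)ᵒᵖ, (homPresheaf F X).obj c → Prop}
  (hp : ∀ {c d : (OrbitCategory F)ᵒᵖ} (f : c ⟶ d) (φ : (homPresheaf F X).obj c),
    p c φ → p d ((homPresheaf F X).map f φ))
  (δ : X → ℤ) (hδ : ∀ (g : G) (x : X), δ (g • x) = δ x)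

include hδ in
theorem invariant_naturality {c d : (OrbitCategory F)ᵒᵖ} (f : c ⟶ d)
    (φ : (subFunctor (homPresheaf F X) p hp).obj c) :
    ULift.up.{u} (δ (LineBundle.base (L := d.unop.subgroup) (X := X)
        ((subFunctor (homPresheaf F X) p hp).map f φ).1)) =
      (constZ (OrbitCategory F)ᵒᵖ).map f
        (ULift.up.{u} (δ (LineBundle.base (L := c.unop.subgroup) (X := X) φ.1))) := by
  obtain ⟨g, hg⟩ := exists_base_comp (M := c.unop.subgroup) (X := X) φ.1 (toEquivariant f.unop)
  exact congrArg ULift.up ((congrArg δ hg).trans (hδ g _))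

/-- The morphism to `ℤ` given by an invariant function. -/
noncomputable def invariantHom :
    freeMod.obj (subFunctor (homPresheaf F X) p hp) ⟶ constZ (OrbitCategory F)ᵒᵖ :=
  freeModDesc (fun c φ => ULift.up (δ (LineBundle.base (L := c.unop.subgroup) (X := X) φ.1)))
    (invariant_naturality hp δ hδ)

theorem invariantHom_app (c : (OrbitCategory F)ᵒᵖ)
    (φ : (subFunctor (homPresheaf F X) p hp).obj c) :
    (invariantHom hp δ hδ).app c (freeMk φ) =
      ULift.up (δ (LineBundle.base (L := c.unop.subgroup) (X := X) φ.1)) :=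
  freeModDesc_app _ (invariant_naturality hp δ hδ) c φ

end

end Values

/-! ### Invariant directions split off edges of the star. -/

section Star

variable {G : Type u} [Group G] (ℓ₁ ℓ₂ : LineData G)

/-- The functor represented by the centre of the star. -/
abbrev centre : (OrbitCategory (vcFamily G))ᵒᵖ ⥤ Type u :=
  bothPresheaf ℓ₁ ℓ₂ (vcFamily G) (Pt G)

/-- The edges of the star. -/
abbrev starEdges : (OrbitCategory (vcFamily G))ᵒᵖ ⥤ Type u :=
  bothPresheaf ℓ₁ ℓ₂ (vcFamily G) (Direction ℓ₁ ℓ₂)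

/-- An invariant direction, as an equivariant map. -/
def directionHom (d : Direction ℓ₁ ℓ₂) (hd : ∀ g : G, g • d = d) : Pt G →[G] Direction ℓ₁ ℓ₂ where
  toFun _ := d
  map_smul' g _ := (hd g).symm

/-- The edge of the star in an invariant direction. -/
def starEdge (d : Direction ℓ₁ ℓ₂) (hd : ∀ g : G, g • d = d) : centre ℓ₁ ℓ₂ ⟶ starEdges ℓ₁ ℓ₂ :=
  subFunctorMap (fun f _ => fixesBoth_map ℓ₁ ℓ₂ f) (fun f _ => fixesBoth_map ℓ₁ ℓ₂ f)
    (homPresheafMap (vcFamily G) (directionHom ℓ₁ ℓ₂ d hd)) (fun _ _ h => h)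

theorem centre_ext {c : (OrbitCategory (vcFamily G))ᵒᵖ} (x y : (centre ℓ₁ ℓ₂).obj c) : x = y :=
  Subtype.ext (MulActionHom.ext (X := G ⧸ c.unop.subgroup) fun _ => rfl)

section

variable (d : Direction ℓ₁ ℓ₂) (hd : ∀ g : G, g • d = d)

open Classical in
/-- The values of the projection onto an edge of the star. -/
noncomputable def starValue (c : (OrbitCategory (vcFamily G))ᵒᵖ) (φ : (starEdges ℓ₁ ℓ₂).obj c) :
    (freeMod.obj (centre ℓ₁ ℓ₂)).obj c :=
  if LineBundle.base (L := c.unop.subgroup) (X := Direction ℓ₁ ℓ₂) φ.1 = d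
  then freeMk (X := (centre ℓ₁ ℓ₂).obj c) ⟨toPt c.unop.subgroup, φ.2⟩ else 0

-- Restriction moves the base value by a group element, and this cannot change whether it equals the
-- invariant direction d.
include hd in
theorem starValue_naturality {c c' : (OrbitCategory (vcFamily G))ᵒᵖ} (f : c ⟶ c')
    (φ : (starEdges ℓ₁ ℓ₂).obj c) : starValue ℓ₁ ℓ₂ d c' ((starEdges ℓ₁ ℓ₂).map f φ) =
      (freeMod.obj (centre ℓ₁ ℓ₂)).map f (starValue ℓ₁ ℓ₂ d c φ) := by
  obtain ⟨g, hg⟩ := exists_base_comp (M := c.unop.subgroup) (X := Direction ℓ₁ ℓ₂) φ.1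
    (toEquivariant f.unop)
  have hiff : LineBundle.base (L := c'.unop.subgroup) (X := Direction ℓ₁ ℓ₂)
      ((starEdges ℓ₁ ℓ₂).map f φ).1 = d ↔
      LineBundle.base (L := c.unop.subgroup) (X := Direction ℓ₁ ℓ₂) φ.1 = d := by
    refine (Eq.congr_left hg).trans ?_
    rw [smul_eq_iff_eq_inv_smul, hd]
  unfold starValue
  by_cases h : LineBundle.base (L := c.unop.subgroup) (X := Direction ℓ₁ ℓ₂) φ.1 = d
  · rw [if_pos h, if_pos (hiff.2 h)]
    exact ((freeZ_map_apply _ _).trans (congrArg freeMk (centre_ext _ _ _ _))).symm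
  · rw [if_neg h, if_neg (mt hiff.1 h), map_zero]

/-- The projection onto the edge of the star in an invariant direction. -/
noncomputable def starProjection :
    freeMod.obj (starEdges ℓ₁ ℓ₂) ⟶ freeMod.obj (centre ℓ₁ ℓ₂) :=
  freeModDesc (starValue ℓ₁ ℓ₂ d) (starValue_naturality ℓ₁ ℓ₂ d hd)

theorem starProjection_app (c : (OrbitCategory (vcFamily G))ᵒᵖ) (φ : (starEdges ℓ₁ ℓ₂).obj c) :
    (starProjection ℓ₁ ℓ₂ d hd).app c (freeMk φ) = starValue ℓ₁ ℓ₂ d c φ :=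
  freeModDesc_app _ (starValue_naturality ℓ₁ ℓ₂ d hd) c φ

end

theorem starEdge_projection (d d' : Direction ℓ₁ ℓ₂) (hd : ∀ g : G, g • d = d)
    (hd' : ∀ g : G, g • d' = d') :
    (d' = d → freeMod.map (starEdge ℓ₁ ℓ₂ d' hd') ≫ starProjection ℓ₁ ℓ₂ d hd = 𝟙 _) ∧
    (d' ≠ d → freeMod.map (starEdge ℓ₁ ℓ₂ d' hd') ≫ starProjection ℓ₁ ℓ₂ d hd = 0) := by
  have key : ∀ c (x : (centre ℓ₁ ℓ₂).obj c),
      (freeMod.map (starEdge ℓ₁ ℓ₂ d' hd') ≫ starProjection ℓ₁ ℓ₂ d hd).app c (freeMk x) = _ :=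
    fun c x => (congrArg ((starProjection ℓ₁ ℓ₂ d hd).app c) (freeZ_map_apply _ _)).trans
      (starProjection_app ℓ₁ ℓ₂ d hd c _)
  refine ⟨fun h => freeMod_hom_ext fun c x => (key c x).trans ?_,
    fun h => freeMod_hom_ext fun c x => (key c x).trans ?_⟩
  · refine (if_pos h).trans (congrArg freeMk (centre_ext _ _ _ _))
  · exact if_neg h

variable (hfin : Finite (ℓ₁.ker ⊓ ℓ₂.ker : Subgroup G))

-- Two invariant directions give two copies of the centre among the edges, both attached to the same
-- centre vertex; the projection onto the first retracts one copy and kills the other.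
open Abelian in
include hfin in
theorem ext_centre_eq_zero (hcd : cd (vcFamily G) ≤ 2) {d₁ d₂ : Direction ℓ₁ ℓ₂} (hd : d₂ ≠ d₁)
    (hd₁ : ∀ g : G, g • d₁ = d₁) (hd₂ : ∀ g : G, g • d₂ = d₂)
    [HasExt.{u + 1} (RightModule (vcFamily G))] (N : RightModule (vcFamily G))
    (α : Ext (freeMod.obj (centre ℓ₁ ℓ₂)) N 2) : α = 0 := by
  have hZ : HasProjectiveDimensionLT (freeMod.obj
      ((Functor.const (OrbitCategory (vcFamily G))ᵒᵖ).obj PUnit.{u + 1})) (1 + 2) :=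
    have := (cd_le_iff _ 2).1 hcd
    hasProjectiveDimensionLT_of_iso (freeModUniqueIso
      ((Functor.const _).obj PUnit.{u + 1}) (fun _ => PUnit.unit) fun _ _ => rfl).symm _
  have hT := hasProjectiveDimensionLT_component_of_stabilizer_mem (isFullFamily_vcFamily G)
    (directionBundle ℓ₁ ℓ₂) fun _ x => stabilizer_direction_point_mem ℓ₁ ℓ₂ hfin x
  have hS := forestComplex_shortExact _ _ _ (star_isForest ℓ₁ ℓ₂ hfin)
    (comp_eq_of_isForest _ _ _ (star_isForest ℓ₁ ℓ₂ hfin))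
  let b : centre ℓ₁ ℓ₂ ⟶ starVertices ℓ₁ ℓ₂ := sigmaInclusion (binaryFamily
    (directionPresheaf ℓ₁ ℓ₂) (bothPresheaf ℓ₁ ℓ₂ (vcFamily G) (Pt G))) ⟨false⟩
  let w : directionPresheaf ℓ₁ ℓ₂ ⟶ starVertices ℓ₁ ℓ₂ := sigmaInclusion (binaryFamily
    (directionPresheaf ℓ₁ ℓ₂) (bothPresheaf ℓ₁ ℓ₂ (vcFamily G) (Pt G))) ⟨true⟩
  let m : starEdges ℓ₁ ℓ₂ ⟶ directionPresheaf ℓ₁ ℓ₂ := subFunctorMap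
    (fun f _ => fixesBoth_map ℓ₁ ℓ₂ f) (fun f φ h => ⟨trivial, LineBundle.lifts_map _ f φ h.2⟩) (𝟙 _)
    (fun _ φ h => ⟨trivial, lifts_direction ℓ₁ ℓ₂ hfin h φ⟩)
  have hedge : ∀ d hd, freeMod.map (starEdge ℓ₁ ℓ₂ d hd) ≫
      boundary (starSource ℓ₁ ℓ₂) (starTarget ℓ₁ ℓ₂ hfin) =
      freeMod.map (starEdge ℓ₁ ℓ₂ d hd ≫ m) ≫ freeMod.map w - freeMod.map b := by
    intro d hd
    rw [boundary, Preadditive.comp_sub, ← Functor.map_comp, ← Functor.map_comp, ← Functor.map_comp]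
    rfl
  exact ext_eq_zero_of_star hS hZ hT _ _ (starProjection ℓ₁ ℓ₂ d₁ hd₁)
    ((starEdge_projection ℓ₁ ℓ₂ d₁ d₁ hd₁ hd₁).1 rfl)
    ((starEdge_projection ℓ₁ ℓ₂ d₁ d₂ hd₁ hd₂).2 hd) _ _ _ _ (hedge d₁ hd₁) (hedge d₂ hd₂) α

end Star

end Bredon

namespace Bredon
open Limits Opposite

/-- Two descriptions of the same forest by equivalent predicates give different subtypes, and
forests have to be carried across. -/
theorem IsForest.of_iff {E V T : Type*} {s t : E → V} {γ : V → T} {p p' : E → Prop}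
    {q q' : V → Prop} {r r' : T → Prop} (hp : ∀ x, p x ↔ p' x) (hq : ∀ x, q x ↔ q' x)
    (hr : ∀ x, r x ↔ r' x) {hs : ∀ x, p x → q (s x)} {ht : ∀ x, p x → q (t x)}
    {hγ : ∀ x, q x → r (γ x)} (h : IsForest (Subtype.map s hs) (Subtype.map t ht)
      (Subtype.map γ hγ)) (hs' : ∀ x, p' x → q' (s x)) (ht' : ∀ x, p' x → q' (t x))
    (hγ' : ∀ x, q' x → r' (γ x)) :
    IsForest (Subtype.map s hs') (Subtype.map t ht') (Subtype.map γ hγ') := by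
  obtain rfl : p = p' := funext fun x => propext (hp x)
  obtain rfl : q = q' := funext fun x => propext (hq x)
  obtain rfl : r = r' := funext fun x => propext (hr x)
  exact h

/-! ### The cellular resolution of the centre by the plane. -/

section Planes

variable {G : Type u} [Group G] (ℓ₁ ℓ₂ : LineData G)

/-- Line bundles pull back along equivariant maps. -/
def LineData.pointMap (ℓ : LineData G) {B B' : Type u} [MulAction G B] [MulAction G B']
    (β : B →[G] B') (r : ℤ) : (ℓ.bundle B).Point r →[G] (ℓ.bundle B').Point r where
  toFun x := ⟨⟨β x.1.1, x.1.2⟩, x.2⟩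
  map_smul' g x := LineBundle.Point.ext (map_smul β g x.1.1) rfl

/-- The points of the second line. -/
abbrev SecondLine (r : ℤ) : Type u := (ℓ₂.bundle (Pt G)).Point r

/-- The bundle with fibre the first line over the points of the second line. -/
abbrev planeBundle (r : ℤ) : LineBundle G (SecondLine ℓ₂ r) := ℓ₁.bundle (SecondLine ℓ₂ r)

/-- The presheaf of cells of the plane. -/
abbrev cells (s r : ℤ) : (OrbitCategory (vcFamily G))ᵒᵖ ⥤ Type u :=
  (planeBundle ℓ₁ ℓ₂ r).pointPresheaf s (fun _ => True) fun _ => id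

/-- The presheaf of cells of the second line. -/
abbrev lineCells (r : ℤ) : (OrbitCategory (vcFamily G))ᵒᵖ ⥤ Type u :=
  (planeBundle ℓ₁ ℓ₂ r).componentPresheaf (fun _ => True) fun _ => id

/-- The endpoints in the direction of the first line. -/
abbrev firstEndpoint (r : ℤ) (σ : ℤˣ) : cells ℓ₁ ℓ₂ 1 r ⟶ cells ℓ₁ ℓ₂ 0 r :=
  (planeBundle ℓ₁ ℓ₂ r).endpointMap (fun _ => True) (fun _ => id) σ

/-- The endpoints in the direction of the second line. -/
def secondEndpoint (s : ℤ) (σ : ℤˣ) : cells ℓ₁ ℓ₂ s 1 ⟶ cells ℓ₁ ℓ₂ s 0 :=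
  subFunctorMap (fun _ _ => id) (fun _ _ => id)
    (homPresheafMap _ (ℓ₁.pointMap ((ℓ₂.bundle (Pt G)).endpoint σ) s)) fun _ _ => id

theorem lifts_secondEndpoint (σ : ℤˣ) {L : Subgroup G} (φ : G ⧸ L →[G] SecondLine ℓ₂ 1)
    (h : LineBundle.Lifts ((planeBundle ℓ₁ ℓ₂ 1).proj 0) φ) :
    LineBundle.Lifts ((planeBundle ℓ₁ ℓ₂ 0).proj 0)
      (MulActionHom.comp ((ℓ₂.bundle (Pt G)).endpoint σ) φ) := by
  rw [ℓ₁.lifts_bundle_iff] at h ⊢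
  exact h

/-- The endpoints of the edges of the second line. -/
def lineEndpoint (σ : ℤˣ) : lineCells ℓ₁ ℓ₂ 1 ⟶ lineCells ℓ₁ ℓ₂ 0 :=
  subFunctorMap (fun f φ h => ⟨trivial, LineBundle.lifts_map _ f φ h.2⟩)
    (fun f φ h => ⟨trivial, LineBundle.lifts_map _ f φ h.2⟩)
    (homPresheafMap _ ((ℓ₂.bundle (Pt G)).endpoint σ))
    fun _ φ h => ⟨trivial, lifts_secondEndpoint ℓ₁ ℓ₂ σ φ h.2⟩

/-- The projection to the point. -/
def lineToCentre : lineCells ℓ₁ ℓ₂ 0 ⟶ centre ℓ₁ ℓ₂ :=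
  subFunctorMap (fun f φ h => ⟨trivial, LineBundle.lifts_map _ f φ h.2⟩)
    (fun f _ => fixesBoth_map ℓ₁ ℓ₂ f)
    (homPresheafMap _ ((ℓ₂.bundle (Pt G)).proj 0))
    fun _ φ h => ⟨(ℓ₁.lifts_bundle_iff _).1 h.2, (ℓ₂.lifts_bundle_iff _).1 ⟨φ, rfl⟩⟩

/-- This is the forest of the second line on the sieve of subgroups fixing a vertex of the first,
with the sieve rewritten as a lifting condition. -/
theorem line_isForest (c : (OrbitCategory (vcFamily G))ᵒᵖ) :
    IsForest ((lineEndpoint ℓ₁ ℓ₂ (-1)).app c) ((lineEndpoint ℓ₁ ℓ₂ 1).app c)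
      ((lineToCentre ℓ₁ ℓ₂).app c) := by
  have h := (ℓ₂.bundle (Pt G)).isForest_componentMap (F := vcFamily G)
    (fun c => ℓ₁.FixesVertex c.unop.subgroup) ℓ₁.fixesVertex_map c
  exact h.of_iff (fun φ => (ℓ₁.lifts_bundle_iff φ).symm.trans (iff_of_eq (true_and _)).symm)
    (fun φ => (ℓ₁.lifts_bundle_iff φ).symm.trans (iff_of_eq (true_and _)).symm)
    (fun φ => and_congr_right fun _ => ℓ₂.lifts_bundle_iff φ)
    (hs := fun _ h => h) (ht := fun _ h => h) (hγ := fun φ h => ⟨h, φ, rfl⟩)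
    (fun φ h => ⟨trivial, lifts_secondEndpoint ℓ₁ ℓ₂ (-1) φ h.2⟩)
    (fun φ h => ⟨trivial, lifts_secondEndpoint ℓ₁ ℓ₂ 1 φ h.2⟩)
    fun φ h => ⟨(ℓ₁.lifts_bundle_iff _).1 h.2, (ℓ₂.lifts_bundle_iff _).1 ⟨φ, rfl⟩⟩

/-- The map of the complexes of the fibres induced by the boundary of the second line. -/
noncomputable def planeMap :
    forestComplex _ _ _ (comp_eq_of_isForest _ _ _
      ((planeBundle ℓ₁ ℓ₂ 1).isForest_componentMap (F := vcFamily G) (fun _ => True) fun _ => id)) ⟶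
    forestComplex _ _ _ (comp_eq_of_isForest _ _ _
      ((planeBundle ℓ₁ ℓ₂ 0).isForest_componentMap (F := vcFamily G) (fun _ => True) fun _ => id))
    where
  τ₁ := boundary (secondEndpoint ℓ₁ ℓ₂ 1 (-1)) (secondEndpoint ℓ₁ ℓ₂ 1 1)
  τ₂ := boundary (secondEndpoint ℓ₁ ℓ₂ 0 (-1)) (secondEndpoint ℓ₁ ℓ₂ 0 1)
  τ₃ := boundary (lineEndpoint ℓ₁ ℓ₂ (-1)) (lineEndpoint ℓ₁ ℓ₂ 1)
  comm₁₂ := boundary_comp_boundary rfl rfl rfl rfl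
  comm₂₃ := boundary_comp_map rfl rfl

variable (hfin : Finite (ℓ₁.ker ⊓ ℓ₂.ker : Subgroup G))

-- The plane's cells give two short exact sequences, over edges and vertices of the second line, and
-- their cokernels resolve the centre. The vanishing of Ext² of the centre then makes every cochain
-- on the faces a coboundary.
open Abelian in
include hfin in
theorem exists_extension_of_cd_le_two (hcd : cd (vcFamily G) ≤ 2) {d₁ d₂ : Direction ℓ₁ ℓ₂}
    (hd : d₂ ≠ d₁) (hd₁ : ∀ g : G, g • d₁ = d₁) (hd₂ : ∀ g : G, g • d₂ = d₂)
    (N : RightModule (vcFamily G)) (f : freeMod.obj (cells ℓ₁ ℓ₂ 1 1) ⟶ N) :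
    ∃ (a : freeMod.obj (cells ℓ₁ ℓ₂ 1 0) ⟶ N) (b : freeMod.obj (cells ℓ₁ ℓ₂ 0 1) ⟶ N),
      f = boundary (secondEndpoint ℓ₁ ℓ₂ 1 (-1)) (secondEndpoint ℓ₁ ℓ₂ 1 1) ≫ a +
        boundary (firstEndpoint ℓ₁ ℓ₂ 1 (-1)) (firstEndpoint ℓ₁ ℓ₂ 1 1) ≫ b := by
  have := HasExt.standard (RightModule (vcFamily G))
  have hP : HasProjectiveDimensionLT (freeMod.obj (cells ℓ₁ ℓ₂ 0 0)) 1 :=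
    hasProjectiveDimensionLT_subFunctor_of_forall _ (fun _ _ => trivial) 1
      (hasProjectiveDimensionLT_of_stabilizer_mem (isFullFamily_vcFamily G) _
        fun x => stabilizer_point_point_mem ℓ₁ ℓ₂ hfin x)
  exact exists_extension_of_ext_two_eq_zero
    (forestComplex_shortExact _ _ _ ((planeBundle ℓ₁ ℓ₂ 1).isForest_componentMap _ _) _)
    (forestComplex_shortExact _ _ _ ((planeBundle ℓ₁ ℓ₂ 0).isForest_componentMap _ _) _)
    (planeMap ℓ₁ ℓ₂) (freeMod.map (lineToCentre ℓ₁ ℓ₂)) _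
    (forestComplex_shortExact _ _ _ (line_isForest ℓ₁ ℓ₂)
      (comp_eq_of_isForest _ _ _ (line_isForest ℓ₁ ℓ₂))) hP
    (ext_centre_eq_zero ℓ₁ ℓ₂ hfin hcd hd hd₁ hd₂ N) f

end Planes

/-! ### Cochains evaluated on cells of the plane. -/

section Values

variable {G : Type u} [Group G]

/-- The free orbit. -/
abbrev freeOrbit (G : Type u) [Group G] : (OrbitCategory (vcFamily G))ᵒᵖ :=
  op ⟨⊥, isVirtuallyCyclic_of_finite _⟩

/-- A point of a `G`-set, as a map from the free orbit. -/
def pointHom {X : Type u} [MulAction G X] (x : X) : G ⧸ (⊥ : Subgroup G) →[G] X :=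
  ofFixed ⊥ x fun l hl => by rw [Subgroup.mem_bot.1 hl, one_smul]

theorem base_pointHom {X : Type u} [MulAction G X] (x : X) :
    LineBundle.base (pointHom (G := G) x) = x :=
  ofFixed_one _ _ _

theorem comp_pointHom {X Y : Type u} [MulAction G X] [MulAction G Y] (β : X →[G] Y) (x : X) :
    MulActionHom.comp β (pointHom x) = pointHom (β x) :=
  quotient_hom_ext ((congrArg β (ofFixed_one _ _ _)).trans (ofFixed_one _ _ _).symm)

variable {ℓ₁ ℓ₂ : LineData G} {s r : ℤ}

/-- A cell of the plane, as an element of the presheaf of cells. -/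
def cellAt (x : (planeBundle ℓ₁ ℓ₂ r).Point s) : (cells ℓ₁ ℓ₂ s r).obj (freeOrbit G) :=
  ⟨pointHom x, trivial⟩

/-- The value of a cochain on a cell. -/
noncomputable def cochainValue (m : freeMod.obj (cells ℓ₁ ℓ₂ s r) ⟶ trivialModule (vcFamily G))
    (x : (planeBundle ℓ₁ ℓ₂ r).Point s) : ℤ :=
  ULift.down.{u} (m.app (freeOrbit G) (freeMk (cellAt x)))

/-- Translation by g is induced by an endomorphism of the free orbit, and the constant module sends
it to the identity. -/
theorem cochainValue_smul (m : freeMod.obj (cells ℓ₁ ℓ₂ s r) ⟶ trivialModule (vcFamily G))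
    (g : G) (x : (planeBundle ℓ₁ ℓ₂ r).Point s) : cochainValue m (g • x) = cochainValue m x := by
  let k : freeOrbit G ⟶ freeOrbit G := Quiver.Hom.op (ofEquivariant (F := vcFamily G)
    (c := (freeOrbit G).unop) (d := (freeOrbit G).unop) (pointHom (QuotientGroup.mk g)))
  have h : (cells ℓ₁ ℓ₂ s r).map k (cellAt x) = cellAt (g • x) :=
    Subtype.ext ((comp_pointHom (pointHom x) (QuotientGroup.mk g)).trans rfl)
  refine congrArg ULift.down.{u} (Eq.trans ?_ (freeMod_naturality m k (cellAt x)))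
  rw [h]

theorem cochainValue_boundary {s' r' : ℤ} (e e' : cells ℓ₁ ℓ₂ s r ⟶ cells ℓ₁ ℓ₂ s' r')
    (m : freeMod.obj (cells ℓ₁ ℓ₂ s' r') ⟶ trivialModule (vcFamily G))
    {x : (planeBundle ℓ₁ ℓ₂ r).Point s} {y y' : (planeBundle ℓ₁ ℓ₂ r').Point s'}
    (h : e.app (freeOrbit G) (cellAt x) = cellAt y)
    (h' : e'.app (freeOrbit G) (cellAt x) = cellAt y') :
    cochainValue (boundary e e' ≫ m) x = cochainValue m y' - cochainValue m y := by
  refine (congrArg (fun z => ULift.down.{u} (m.app (freeOrbit G) z))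
    (boundary_app_freeMk e e' (freeOrbit G) (cellAt x))).trans ?_
  rw [h, h', map_sub]
  rfl

theorem firstEndpoint_cellAt (σ : ℤˣ) (x : (planeBundle ℓ₁ ℓ₂ r).Point 1) :
    (firstEndpoint ℓ₁ ℓ₂ r σ).app (freeOrbit G) (cellAt x) =
      cellAt ((planeBundle ℓ₁ ℓ₂ r).endpoint σ x) :=
  Subtype.ext (comp_pointHom ((planeBundle ℓ₁ ℓ₂ r).endpoint σ) x)

theorem secondEndpoint_cellAt (σ : ℤˣ) (x : (planeBundle ℓ₁ ℓ₂ 1).Point s) :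
    (secondEndpoint ℓ₁ ℓ₂ s σ).app (freeOrbit G) (cellAt x) =
      cellAt (ℓ₁.pointMap ((ℓ₂.bundle (Pt G)).endpoint σ) s x) :=
  Subtype.ext (comp_pointHom (ℓ₁.pointMap ((ℓ₂.bundle (Pt G)).endpoint σ) s) x)

theorem cochainValue_add (m n : freeMod.obj (cells ℓ₁ ℓ₂ s r) ⟶ trivialModule (vcFamily G))
    (x : (planeBundle ℓ₁ ℓ₂ r).Point s) :
    cochainValue (m + n) x = cochainValue m x + cochainValue n x := rfl

/-- The cell with given coordinates. -/
def cell (ℓ₁ ℓ₂ : LineData G) (w v : ℤ) {s r : ℤ} (hw : w % 2 = s) (hv : v % 2 = r) :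
    (planeBundle ℓ₁ ℓ₂ r).Point s :=
  ⟨⟨⟨⟨PUnit.unit, v⟩, hv⟩, w⟩, hw⟩

end Values

/-! ### The torus and the value 3 for ℤ × ℤ. -/

section Torus

/-- The action of a product of two infinite cyclic groups by translations of the first line. -/
def translation₁ : LineData (Multiplicative ℤ × Multiplicative ℤ) where
  sign := 1
  shift g := g.1.toAdd
  shift_mul g h := by simp

/-- The action of a product of two infinite cyclic groups by translations of the second line. -/
def translation₂ : LineData (Multiplicative ℤ × Multiplicative ℤ) where
  sign := 1
  shift g := g.2.toAdd
  shift_mul g h := by simp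

theorem finite_ker_translation :
    Finite (translation₁.ker ⊓ translation₂.ker :
      Subgroup (Multiplicative ℤ × Multiplicative ℤ)) := by
  have : Subsingleton (translation₁.ker ⊓ translation₂.ker :
      Subgroup (Multiplicative ℤ × Multiplicative ℤ)) :=
    ⟨fun x y => Subtype.ext (Prod.ext (x.2.1.2.trans y.2.1.2.symm) (x.2.2.2.trans y.2.2.2.symm))⟩
  infer_instance

/-- The indicator function of one of the faces of the torus. -/
def faceIndicator (x : (planeBundle translation₁ translation₂ 1).Point 1) : ℤ :=
  if x.1.2 % 4 = 1 ∧ x.1.1.1.2 % 4 = 1 then 1 else 0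

theorem faceIndicator_smul (g : Multiplicative ℤ × Multiplicative ℤ)
    (x : (planeBundle translation₁ translation₂ 1).Point 1) :
    faceIndicator (g • x) = faceIndicator x := by
  have h₁ : (g • x).1.2 = 1 * x.1.2 + 4 * g.1.toAdd := rfl
  have h₂ : (g • x).1.1.1.2 = 1 * x.1.1.1.2 + 4 * g.2.toAdd := rfl
  unfold faceIndicator
  rw [h₁, h₂, one_mul, one_mul, Int.add_mul_emod_self_left, Int.add_mul_emod_self_left]

theorem cochainValue_translate {s r : ℤ} (m : freeMod.obj (cells translation₁ translation₂ s r) ⟶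
      trivialModule (vcFamily (Multiplicative ℤ × Multiplicative ℤ)))
    {w v w' v' : ℤ} (hw : w % 2 = s) (hv : v % 2 = r) (hw' : w' % 2 = s) (hv' : v' % 2 = r)
    (a b : ℤ) (h₁ : w' = w + 4 * a) (h₂ : v' = v + 4 * b) :
    cochainValue m (cell translation₁ translation₂ w' v' hw' hv') =
      cochainValue m (cell translation₁ translation₂ w v hw hv) := by
  have h : cell translation₁ translation₂ w' v' hw' hv' =
      ((Multiplicative.ofAdd a, Multiplicative.ofAdd b) :
        Multiplicative ℤ × Multiplicative ℤ) • cell translation₁ translation₂ w v hw hv := by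
    refine LineBundle.Point.ext (LineBundle.Point.ext rfl ?_) ?_
    · change v' = 1 * v + 4 * b
      rw [h₂, one_mul]
    · change w' = 1 * w + 4 * a
      rw [h₁, one_mul]
  rw [h, cochainValue_smul]

/-- Modulo translations by 4 the plane becomes a torus with four faces. If the dimension were at
most 2, the indicator of one face would be a coboundary, contradicting its nonzero sum against the
fundamental cycle. -/
theorem not_cd_le_two :
    ¬ cd (vcFamily (Multiplicative ℤ × Multiplicative ℤ)) ≤ 2 := by
  intro hcd
  have hfix : ∀ (d : Direction translation₁ translation₂)
      (g : Multiplicative ℤ × Multiplicative ℤ), g • d = d :=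
    fun d g => smul_direction _ _ rfl rfl d
  let f : freeMod.obj (cells translation₁ translation₂ 1 1) ⟶
      trivialModule (vcFamily (Multiplicative ℤ × Multiplicative ℤ)) :=
    invariantHom (fun _ _ => id) faceIndicator faceIndicator_smul
  obtain ⟨a, b, hab⟩ := exists_extension_of_cd_le_two translation₁ translation₂
    finite_ker_translation hcd (d₁ := ULift.up none) (d₂ := ULift.up (some 0))
    (fun h => Option.some_ne_none _ (congrArg ULift.down h)) (hfix _) (hfix _) _ f
  have hf : ∀ x, cochainValue f x = faceIndicator x := fun x =>
    (congrArg ULift.down (invariantHom_app (F := vcFamily (Multiplicative ℤ × Multiplicative ℤ))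
      (fun _ _ => id) faceIndicator faceIndicator_smul (freeOrbit _) (cellAt x))).trans
      (congrArg faceIndicator (base_pointHom x))
  have key : ∀ {w v w₁ w₂ v₁ v₂ : ℤ} (hw : w % 2 = 1) (hv : v % 2 = 1) (hw₁ : w₁ % 2 = 0)
      (hw₂ : w₂ % 2 = 0) (hv₁ : v₁ % 2 = 0) (hv₂ : v₂ % 2 = 0)
      (_ : w + LineBundle.direction w = w₁) (_ : w - LineBundle.direction w = w₂)
      (_ : v + LineBundle.direction v = v₁) (_ : v - LineBundle.direction v = v₂),
      faceIndicator (cell _ _ w v hw hv) =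
        (cochainValue a (cell _ _ w v₁ hw hv₁) - cochainValue a (cell _ _ w v₂ hw hv₂)) +
        (cochainValue b (cell _ _ w₁ v hw₁ hv) - cochainValue b (cell _ _ w₂ v hw₂ hv)) := by
    rintro w v _ _ _ _ hw hv hw₁ hw₂ hv₁ hv₂ rfl rfl rfl rfl
    rw [← hf, hab, cochainValue_add,
      cochainValue_boundary _ _ a (secondEndpoint_cellAt _ _) (secondEndpoint_cellAt _ _),
      cochainValue_boundary _ _ b (firstEndpoint_cellAt _ _) (firstEndpoint_cellAt _ _)]
    have hpos : ∀ z : ℤ, z + ((1 : ℤˣ) : ℤ) * LineBundle.direction z =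
        z + LineBundle.direction z := fun z => by rw [Units.val_one, one_mul]
    have hneg : ∀ z : ℤ, z + ((-1 : ℤˣ) : ℤ) * LineBundle.direction z =
        z - LineBundle.direction z := fun z => by
      rw [Units.val_neg, Units.val_one, neg_one_mul, sub_eq_add_neg]
    refine congrArg₂ (· + ·) (congrArg₂ (· - ·) (congrArg _ ?_) (congrArg _ ?_))
      (congrArg₂ (· - ·) (congrArg _ ?_) (congrArg _ ?_))
    · exact LineBundle.Point.ext (LineBundle.Point.ext rfl (hpos v)) rfl
    · exact LineBundle.Point.ext (LineBundle.Point.ext rfl (hneg v)) rfl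
    · exact LineBundle.Point.ext rfl (hpos w)
    · exact LineBundle.Point.ext rfl (hneg w)
  -- The faces of the torus have coordinates 1 or 3. Edge 1 runs from 0 to 2, whereas edge 3 runs
  -- from 4 to 2.
  have k₁₁ := key (w := 1) (v := 1) (w₁ := 2) (w₂ := 0) (v₁ := 2) (v₂ := 0) rfl rfl rfl rfl rfl rfl
    rfl rfl rfl rfl
  have k₁₃ := key (w := 1) (v := 3) (w₁ := 2) (w₂ := 0) (v₁ := 2) (v₂ := 4) rfl rfl rfl rfl rfl rfl
    rfl rfl rfl rfl
  have k₃₁ := key (w := 3) (v := 1) (w₁ := 2) (w₂ := 4) (v₁ := 2) (v₂ := 0) rfl rfl rfl rfl rfl rfl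
    rfl rfl rfl rfl
  have k₃₃ := key (w := 3) (v := 3) (w₁ := 2) (w₂ := 4) (v₁ := 2) (v₂ := 4) rfl rfl rfl rfl rfl rfl
    rfl rfl rfl rfl
  have f₁₁ : faceIndicator (cell _ _ 1 1 rfl rfl) = 1 := rfl
  have f₁₃ : faceIndicator (cell _ _ 1 3 rfl rfl) = 0 := rfl
  have f₃₁ : faceIndicator (cell _ _ 3 1 rfl rfl) = 0 := rfl
  have f₃₃ : faceIndicator (cell _ _ 3 3 rfl rfl) = 0 := rfl
  -- Periodicity identifies the coordinate 4 with 0, closing up the torus.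
  have a₁ := cochainValue_translate a (w := 1) (v := 0) (w' := 1) (v' := 4) rfl rfl rfl rfl 0 1 rfl rfl
  have a₃ := cochainValue_translate a (w := 3) (v := 0) (w' := 3) (v' := 4) rfl rfl rfl rfl 0 1 rfl rfl
  have b₁ := cochainValue_translate b (w := 0) (v := 1) (w' := 4) (v' := 1) rfl rfl rfl rfl 1 0 rfl rfl
  have b₃ := cochainValue_translate b (w := 0) (v := 3) (w' := 4) (v' := 3) rfl rfl rfl rfl 1 0 rfl rfl
  rw [f₁₁] at k₁₁
  rw [f₁₃, a₁] at k₁₃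
  rw [f₃₁, b₁] at k₃₁
  rw [f₃₃, a₃, b₃] at k₃₃
  -- Adjacent edges point in opposite directions, so the fundamental cycle is the alternating sum
  -- `k₁₁` − `k₁₃` − `k₃₁` + `k₃₃`. All edge values cancel in it, leaving 1 = 0.
  linarith

theorem cd_vcFamily_int : cd (vcFamily (Multiplicative ℤ)) = 0 :=
  cd_eq_zero_of_top_mem (isVirtuallyCyclic_of_isCyclic _ : IsVirtuallyCyclic (⊤ : Subgroup _))

theorem cd_vcFamily_int_prod_int :
    cd (vcFamily (Multiplicative ℤ × Multiplicative ℤ)) = 3 := by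
  refine le_antisymm ?_ ?_
  · have h := cd_vcFamily_prod_le (Multiplicative ℤ) (Multiplicative ℤ)
    rwa [cd_vcFamily_int, add_zero, zero_add] at h
  · have h := not_le.1 not_cd_le_two
    exact Order.add_one_le_of_lt h

end Torus

end Bredon

theorem mainTheorem8 (G₁ G₂ : Type u) [Group G₁] [Group G₂] :
    (∀ (F₁ : Set (Subgroup G₁)) (F₂ : Set (Subgroup G₂)) (𝔊 : Set (Subgroup (G₁ × G₂))),
      Bredon.IsFullFamily F₁ → Bredon.IsFullFamily F₂ → Bredon.IsFullFamily 𝔊 →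
      𝔊 ⊆ Bredon.completion (Bredon.prodFamily F₁ F₂) →
      ∀ k : ℕ,
        (∀ K ∈ Bredon.prodFamily F₁ F₂, Bredon.cd (Bredon.restrictFamily 𝔊 K) ≤ (k : ℕ∞)) →
        Bredon.cd 𝔊 ≤ Bredon.cd F₁ + Bredon.cd F₂ + (k : ℕ∞)) ∧
    Bredon.cd (Bredon.vcFamily (G₁ × G₂)) ≤
      Bredon.cd (Bredon.vcFamily G₁) + Bredon.cd (Bredon.vcFamily G₂) + 3 ∧
    (Bredon.cd (Bredon.vcFamily (Multiplicative ℤ)) = 0 ∧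
      Bredon.cd (Bredon.vcFamily (Multiplicative ℤ × Multiplicative ℤ)) = 3 ∧
      Bredon.cd (Bredon.vcFamily (Multiplicative ℤ × Multiplicative ℤ)) =
        Bredon.cd (Bredon.vcFamily (Multiplicative ℤ)) +
          Bredon.cd (Bredon.vcFamily (Multiplicative ℤ)) + 3) := by
  refine ⟨fun F₁ F₂ 𝔊 h₁ h₂ h h' k hk => Bredon.cd_prod_le_add h₁ h₂ h h' k hk,
    Bredon.cd_vcFamily_prod_le G₁ G₂, Bredon.cd_vcFamily_int, Bredon.cd_vcFamily_int_prod_int, ?_⟩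
  rw [Bredon.cd_vcFamily_int, Bredon.cd_vcFamily_int_prod_int, add_zero, zero_add]
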